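/- Let $V$ be a finite-dimensional real vector space of dimension $n$, $B$ a positive definite symmetric bilinear form on $V$, $Q(v)=\frac12B(v,v)$, and $L\subset V$ an even lattice (the $\mathbb Z$-span of an $\mathbb R$-basis of $V$, with $Q(L)\subseteq\mathbb Z$). Write $\mathcal V=\mathbb C\otimes_{\mathbb R}V$, extend $B,Q$ to $\mathcal V$ complex-(bi)linearly, let $L^\sharp=\{v\in V: B(v,L)\subseteq\mathbb Z\}$, let $N$ be the level of $L$ (the least positive integer with $N\,Q(L^\sharp)\subseteq\mathbb Z$), and put $\mathfrak e(x)=e^{2\pi i x}$. Square roots are principal: $-\pi/2<\arg\sqrt{\cdot}\le\pi/2$. *Jacobi group and Jacobi forms.* For $G\le \mathrm{SL}_2(\mathbb Z)$, $\widetilde G$ is the group of pairs $(\gamma,\varepsilon\sqrt{c\tau+d})$, $\gamma=\begin{pmatrix}a&b\\c&d\end{pmatrix}\in G$, $\varepsilon=\pm1$, with product $(\gamma_1,\varphi_1(\tau))(\gamma_2,\varphi_2(\tau))=(\gamma_1\gamma_2,\varphi_1(\gamma_2\tau)\varphi_2(\tau))$. For an integral lattice $\underline L=(L,B)$, $H(\underline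 L,1)$ is the group of all $([v,w],\xi)$, $v,w\in L$, $\xi=\pm1$, with $([v_1,w_1],\xi_1)([v_2,w_2],\xi_2)=([v_1+v_2,w_1+w_2],\xi_1\xi_2 e^{\pi i(B(v_1,w_2)-B(v_2,w_1))})$, and $\widetilde G\ltimes H(\underline L,1)$ is formed with the right action $[v,w]\gamma=[av+cw,bv+dw]$. For $k\in\frac12\mathbb Z$, $x=(\gamma,\varepsilon,[v,w],\xi)$ in it and $f:\mathbb H\times\mathcal V\to\mathbb C$ put $$(f|_{k,B}x)(\tau,z)=(\varepsilon\sqrt{c\tau+d})^{-2k}\,\xi\,\mathfrak e\Big(-\tfrac{c\,Q(z+\tau v+w)}{c\tau+d}+\tau Q(v)+B(v,z)+\tfrac12B(v,w)\Big)f\Big(\tfrac{a\tau+b}{c\tau+d},\tfrac{z+\tau v+w}{c\tau+d}\Big).$$ For $B$ positive definite, $G$ of finite index in $\mathrm{SL}_2(\mathbb Z)$ and a character $\chi:\widetilde G\ltimes H(\underline L,1)\to\mathbb C^\times$ whose kernel has finite index, $J_{k,\underline L}(G,\chi)$ is the space of holomorphic $f$ with $f|_{k,B}x=\chi(x)f$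 for all $x\in\widetilde G\ltimes H(\underline L,1)$ such that for every $x\in\widetilde{\mathrm{SL}_2(\mathbb Z)}\ltimes H(\underline L,1)$ there are an integer $M\ge1$ and an absolutely convergent expansion $f|_{k,B}x=\sum c(n',t)\,\mathfrak e(n'\tau+B(t,z))$ over $n'\in\frac1M\mathbb Z$, $t\in\frac1M L^\sharp$, with $c(n',t)=0$ unless $n'\ge Q(t)$. *Theta series and Gauss sums.* For $\alpha\in L^\sharp$ and $\beta\in\frac1N L$ let $$\theta_{\alpha,\beta}(\tau,z)=\sum_{v\in L}\mathfrak e(B(\beta,v))\,\mathfrak e(\tau Q(\alpha+v)+B(\alpha+v,z)),$$ and for integers $b$ and $d\neq0$ let $\mathfrak g(b,d;0)=|d|^{-n/2}\sum_{v\in L/dL}\mathfrak e(bQ(v)/d)$. Let $s(c)=-1$ if $c<0$ and $s(c)=1$ if $c\ge0$. (1) For all $\alpha\in L^\sharp$, $\beta\in\frac1NL$, the series $\theta_{\alpha,\beta}$ converges absolutely, there is a unique character $\chi_{\alpha,\beta}$ of $\widetilde{\Gamma_1(N)}\ltimes H(\underline L,1)$ mapping every $\left(\begin{pmatrix}a&b\\c&d\end{pmatrix},\varepsilon,[v,w],\xi\right)$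 with $d\ne0$ to $$\varepsilon^{-n}\,\xi\,(-i)^{\frac12n(1-\operatorname{sgn}d)s(c)}\,\mathfrak g(b,d;0)\,\mathfrak e\big(bQ(\alpha)-cQ(\beta)+\tfrac12B(v,w)-B(v,\beta)\big),$$ and $\theta_{\alpha,\beta}\in J_{n/2,\underline L}(\Gamma_1(N),\chi_{\alpha,\beta})$. (2) Let $N'$ be a positive divisor of $N$ and $\underline L_{N'}=(L,N'B)$. There is a unique character $\chi^{N'}$ of $\widetilde{\Gamma_1(N)}\ltimes H(\underline L_{N'},1)$ mapping every $\left(\begin{pmatrix}a&b\\c&d\end{pmatrix},\varepsilon,[v,w],\xi\right)$ with $d\neq0$ to $$\varepsilon^{-N'n}\,\xi\,(-i)^{\frac12N'n(1-\operatorname{sgn}d)s(c)}\,\mathfrak g(b,d;0)^{N'}\,\mathfrak e\big(\tfrac12N'B(v,w)\big),$$ and for all $\alpha\in L^\sharp$ with $Q(\alpha)\in\frac1{N'}\mathbb Z$ and all $\beta\in L^\sharp+\frac1{N'}L$ the powers $\theta_{\alpha,\beta}^{N'}$ lie in the same space $J_{N'n/2,\underline L_{N'}}(\Gamma_1(N),\chi^{N'})$.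 -/

import Mathlib

open scoped TensorProduct MatrixGroups UpperHalfPlane

noncomputable section

namespace LatticeJacobi

/-- `e(x) = exp(2πi x)`. -/
def e (x : ℂ) : ℂ := Complex.exp (2 * Real.pi * Complex.I * x)

/-! ### Symmetric bilinear forms and lattices -/

/-- A symmetric real bilinear form `B` on a real vector space `V`. -/
structure SymForm (V : Type*) [AddCommGroup V] [Module ℝ V] where
  B : LinearMap.BilinForm ℝ V
  symm : ∀ v w, B v w = B w v

namespace SymForm

variable {V : Type*} [AddCommGroup V] [Module ℝ V]

/-- The quadratic form `Q(v) = B(v, v) / 2`. -/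
def Q (F : SymForm V) (v : V) : ℝ := F.B v v / 2

def PosDef (F : SymForm V) : Prop := ∀ v, v ≠ 0 → 0 < F.B v v

/-- The form `m · B`. -/
def scale (F : SymForm V) (m : ℕ) : SymForm V where
  B := (m : ℝ) • F.B
  symm v w := by simp [F.symm v w]

/-- The `ℂ`-bilinear extension of `B` to the complexification `ℂ ⊗ V`. -/
def BC (F : SymForm V) : LinearMap.BilinForm ℂ (ℂ ⊗[ℝ] V) :=
  LinearMap.BilinForm.baseChange ℂ F.B

/-- The extension of `Q` to the complexification `ℂ ⊗ V`. -/
def QC (F : SymForm V) (z : ℂ ⊗[ℝ] V) : ℂ := F.BC z z / 2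

/-- `L` is integral: `B(L, L) ⊆ ℤ`. -/
def IsIntegral (F : SymForm V) (L : Submodule ℤ V) : Prop :=
  ∀ v ∈ L, ∀ w ∈ L, ∃ m : ℤ, F.B v w = m

/-- `L` is even: `Q(L) ⊆ ℤ`. -/
def IsEven (F : SymForm V) (L : Submodule ℤ V) : Prop :=
  ∀ v ∈ L, ∃ m : ℤ, F.Q v = m

theorem IsEven.isIntegral {F : SymForm V} {L : Submodule ℤ V} (h : F.IsEven L) :
    F.IsIntegral L := by
  intro v hv w hw
  obtain ⟨a, ha⟩ := h (v + w) (L.add_mem hv hw)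
  obtain ⟨b, hb⟩ := h v hv
  obtain ⟨c, hc⟩ := h w hw
  refine ⟨a - b - c, ?_⟩
  have hs := F.symm v w
  simp only [Q, map_add, LinearMap.add_apply] at ha hb hc
  push_cast
  linarith

theorem IsEven.scale {F : SymForm V} {L : Submodule ℤ V} (h : F.IsEven L) (m : ℕ) :
    (F.scale m).IsEven L := by
  intro v hv
  obtain ⟨a, ha⟩ := h v hv
  refine ⟨m * a, ?_⟩
  simp only [Q, SymForm.scale, LinearMap.smul_apply, smul_eq_mul] at ha ⊢
  push_cast
  rw [← ha]
  ring

/-- The dual lattice `L♯ = {v ∈ V : B(v, L) ⊆ ℤ}`. -/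
def dual (F : SymForm V) (L : Submodule ℤ V) : Submodule ℤ V where
  carrier := {v | ∀ l ∈ L, ∃ m : ℤ, F.B v l = m}
  zero_mem' := fun l _ => ⟨0, by simp⟩
  add_mem' := by
    intro v w hv hw l hl
    obtain ⟨a, ha⟩ := hv l hl
    obtain ⟨b, hb⟩ := hw l hl
    exact ⟨a + b, by simp [ha, hb]⟩
  smul_mem' := by
    intro k v hv l hl
    obtain ⟨a, ha⟩ := hv l hl
    exact ⟨k * a, by simp [ha]⟩

/-- The level of `L`: the least positive integer `N` such that `N · Q(L♯) ⊆ ℤ`. -/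
def level (F : SymForm V) (L : Submodule ℤ V) : ℕ :=
  sInf {N : ℕ | 0 < N ∧ ∀ v ∈ F.dual L, ∃ m : ℤ, N * F.Q v = m}

end SymForm

/-- A `ℤ`-lattice in `V`: the `ℤ`-span of an `ℝ`-basis of `V`. -/
def IsLattice {V : Type*} [AddCommGroup V] [Module ℝ V] (L : Submodule ℤ V) : Prop :=
  ∃ b : Module.Basis (Fin (Module.finrank ℝ V)) ℝ V, L = Submodule.span ℤ (Set.range b)

/-! ### The metaplectic double cover of `SL(2, ℤ)` -/

/-- `j(γ, τ) = cτ + d`. -/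
def autJ (γ : SL(2, ℤ)) (τ : ℍ) : ℂ := (γ 1 0 : ℂ) * (τ : ℂ) + (γ 1 1 : ℂ)

/-- The principal branch of `(cτ + d)^(1/2)`. -/
def sqrtJ (γ : SL(2, ℤ)) (τ : ℍ) : ℂ := autJ γ τ ^ (1 / 2 : ℂ)

theorem autJ_eq_denom (γ : SL(2, ℤ)) (τ : ℍ) : autJ γ τ = UpperHalfPlane.denom γ τ := by
  rw [ModularGroup.denom_apply]; rfl

theorem autJ_ne_zero (γ : SL(2, ℤ)) (τ : ℍ) : autJ γ τ ≠ 0 := by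
  rw [autJ_eq_denom]; exact UpperHalfPlane.denom_ne_zero _ _

theorem autJ_mul (γ δ : SL(2, ℤ)) (τ : ℍ) : autJ (γ * δ) τ = autJ γ (δ • τ) * autJ δ τ := by
  have h := autJ_ne_zero δ τ
  have hs : ((δ • τ : ℍ) : ℂ) = ((δ 0 0 : ℂ) * τ + (δ 0 1 : ℂ)) / autJ δ τ := by
    rw [UpperHalfPlane.coe_specialLinearGroup_apply]
    simp [autJ]
  rw [autJ, autJ, hs, add_mul, mul_assoc, div_mul_cancel₀ _ h]
  simp only [autJ, Matrix.SpecialLinearGroup.coe_mul, Matrix.mul_apply, Fin.sum_univ_two]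
  push_cast
  ring

theorem continuous_smul_slZ (γ : SL(2, ℤ)) : Continuous fun τ : ℍ => γ • τ :=
  continuous_const_smul (Matrix.SpecialLinearGroup.map (Int.castRingHom ℝ) γ : SL(2, ℝ))

theorem sqrtJ_sq (γ : SL(2, ℤ)) (τ : ℍ) : sqrtJ γ τ ^ 2 = autJ γ τ := by
  rw [sqrtJ, ← Complex.cpow_nat_mul]
  norm_num

theorem sqrtJ_ne_zero (γ : SL(2, ℤ)) (τ : ℍ) : sqrtJ γ τ ≠ 0 := fun h =>
  autJ_ne_zero γ τ (by rw [← sqrtJ_sq, h]; simp)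

theorem continuous_sqrtJ (γ : SL(2, ℤ)) : Continuous (sqrtJ γ) := by
  by_cases hc : γ 1 0 = 0
  · have : sqrtJ γ = fun _ => ((γ 1 1 : ℤ) : ℂ) ^ (1 / 2 : ℂ) := by
      funext τ; simp [sqrtJ, autJ, hc]
    rw [this]; exact continuous_const
  · refine Continuous.cpow ?_ continuous_const ?_
    · unfold autJ
      exact (continuous_const.mul UpperHalfPlane.continuous_coe).add continuous_const
    · intro τ
      refine Or.inr ?_
      have hc' : ((γ 1 0 : ℤ) : ℝ) ≠ 0 := by exact_mod_cast hc
      simpa [autJ] using ⟨hc, τ.im_pos.ne'⟩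

theorem exists_sign (γ : SL(2, ℤ)) (f : ℍ → ℂ) (hf : Continuous f)
    (hsq : ∀ τ, f τ ^ 2 = autJ γ τ) : ∃ ε : ℤˣ, ∀ τ, f τ = ((ε : ℤ) : ℂ) * sqrtJ γ τ := by
  have h := IsPreconnected.eq_or_eq_neg_of_sq_eq (f := f) (g := sqrtJ γ)
    (isPreconnected_univ (α := ℍ)) hf.continuousOn (continuous_sqrtJ γ).continuousOn
    (fun τ _ => by simp [hsq, sqrtJ_sq]) (fun {τ} _ => sqrtJ_ne_zero γ τ)
  rcases h with h | h
  · exact ⟨1, fun τ => by simpa using h (Set.mem_univ τ)⟩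
  · exact ⟨-1, fun τ => by simpa using h (Set.mem_univ τ)⟩

/-- The double cover of `SL(2, ℤ)`: pairs of a matrix and a function `ε (cτ + d)^(1/2)`, `ε = ±1`. -/
@[ext] structure Metaplectic where
  mat : SL(2, ℤ)
  root : ℍ → ℂ
  root_spec : ∃ ε : ℤˣ, ∀ τ, root τ = ((ε : ℤ) : ℂ) * sqrtJ mat τ

namespace Metaplectic

theorem root_sq (x : Metaplectic) (τ : ℍ) : x.root τ ^ 2 = autJ x.mat τ := by
  obtain ⟨ε, h⟩ := x.root_spec
  rw [h, mul_pow, sqrtJ_sq]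
  rcases Int.units_eq_one_or ε with rfl | rfl <;> simp

theorem root_ne_zero (x : Metaplectic) (τ : ℍ) : x.root τ ≠ 0 := fun h =>
  autJ_ne_zero x.mat τ (by rw [← root_sq, h]; simp)

theorem continuous_root (x : Metaplectic) : Continuous x.root := by
  obtain ⟨ε, h⟩ := x.root_spec
  rw [funext h]
  exact continuous_const.mul (continuous_sqrtJ _)

/-- `(γ₁, φ₁(τ)) (γ₂, φ₂(τ)) = (γ₁ γ₂, φ₁(γ₂ τ) φ₂(τ))`. -/
instance : Mul Metaplectic where
  mul x y :=
    { mat := x.mat * y.mat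
      root := fun τ => x.root (y.mat • τ) * y.root τ
      root_spec := exists_sign _ _
        ((x.continuous_root.comp (continuous_smul_slZ y.mat)).mul y.continuous_root)
        (fun τ => by rw [mul_pow, root_sq, root_sq, autJ_mul]) }

instance : One Metaplectic where
  one :=
    { mat := 1
      root := fun _ => 1
      root_spec := exists_sign _ _ continuous_const (fun τ => by simp [autJ]) }

instance : Inv Metaplectic where
  inv x :=
    { mat := x.mat⁻¹
      root := fun τ => (x.root (x.mat⁻¹ • τ))⁻¹
      root_spec := exists_sign _ _
        ((x.continuous_root.comp (continuous_smul_slZ x.mat⁻¹)).inv₀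
          (fun τ => x.root_ne_zero _))
        (fun τ => by
          have h := autJ_mul x.mat x.mat⁻¹ τ
          have h1 : autJ (x.mat * x.mat⁻¹) τ = 1 := by simp [autJ]
          rw [h1] at h
          rw [inv_pow, root_sq]
          exact (eq_inv_of_mul_eq_one_right h.symm).symm) }

theorem mul_mat (x y : Metaplectic) : (x * y).mat = x.mat * y.mat := rfl
theorem mul_root (x y : Metaplectic) (τ : ℍ) :
    (x * y).root τ = x.root (y.mat • τ) * y.root τ := rfl
theorem one_mat : (1 : Metaplectic).mat = 1 := rfl
theorem one_root (τ : ℍ) : (1 : Metaplectic).root τ = 1 := rfl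
theorem inv_mat (x : Metaplectic) : (x⁻¹).mat = x.mat⁻¹ := rfl
theorem inv_root (x : Metaplectic) (τ : ℍ) :
    (x⁻¹).root τ = (x.root (x.mat⁻¹ • τ))⁻¹ := rfl

instance : Group Metaplectic :=
  Group.ofLeftAxioms
    (fun x y z => by
      ext τ
      · simp [mul_mat, mul_assoc]
      · simp [mul_root, mul_mat, mul_smul, mul_assoc])
    (fun x => by
      ext τ
      · simp [mul_mat, one_mat]
      · simp [mul_root, one_root])
    (fun x => by
      ext τ
      · simp [mul_mat, one_mat, inv_mat]
      · simp [mul_root, one_root, inv_root, root_ne_zero])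

end Metaplectic

/-! ### The Jacobi group -/

section JacobiGroup

set_option linter.unusedSectionVars false

variable {V : Type*} [AddCommGroup V] [Module ℝ V]

/-- The elements `(γ, ε (cτ + d)^(1/2), [v, w], ξ)` of the semidirect product of the metaplectic
double cover of `SL(2, ℤ)` with the Heisenberg group `H(V)` of the form `F`. -/
@[ext] structure JacobiGroup (F : SymForm V) where
  mp : Metaplectic
  v : V
  w : V
  ξ : Circle

namespace JacobiGroup

variable {F : SymForm V}

/-- The alternating form `A([v₁, w₁], [v₂, w₂]) = B(v₁, w₂) - B(v₂, w₁)`. -/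
def altForm (F : SymForm V) (v₁ w₁ v₂ w₂ : V) : ℝ := F.B v₁ w₂ - F.B v₂ w₁

/-- First component of `[v, w] γ`. -/
def actV (γ : SL(2, ℤ)) (v w : V) : V := γ 0 0 • v + γ 1 0 • w

/-- Second component of `[v, w] γ`. -/
def actW (γ : SL(2, ℤ)) (v w : V) : V := γ 0 1 • v + γ 1 1 • w

/-- `(x, h) (y, k) = (x y, (h · y) k)`, where `[v, w] · y = [a v + c w, b v + d w]` and
`([v₁, w₁], ξ₁) ([v₂, w₂], ξ₂) = ([v₁ + v₂, w₁ + w₂], ξ₁ ξ₂ exp(πi A([v₁, w₁], [v₂, w₂])))`. -/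
instance : Mul (JacobiGroup F) where
  mul x y :=
    { mp := x.mp * y.mp
      v := actV y.mp.mat x.v x.w + y.v
      w := actW y.mp.mat x.v x.w + y.w
      ξ := x.ξ * y.ξ * Circle.exp (Real.pi *
        altForm F (actV y.mp.mat x.v x.w) (actW y.mp.mat x.v x.w) y.v y.w) }

instance : One (JacobiGroup F) where
  one := { mp := 1, v := 0, w := 0, ξ := 1 }

instance : Inv (JacobiGroup F) where
  inv x :=
    { mp := x.mp⁻¹
      v := -actV x.mp.mat⁻¹ x.v x.w
      w := -actW x.mp.mat⁻¹ x.v x.w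
      ξ := x.ξ⁻¹ }

theorem mul_mp (x y : JacobiGroup F) : (x * y).mp = x.mp * y.mp := rfl
theorem mul_v (x y : JacobiGroup F) : (x * y).v = actV y.mp.mat x.v x.w + y.v := rfl
theorem mul_w (x y : JacobiGroup F) : (x * y).w = actW y.mp.mat x.v x.w + y.w := rfl
theorem mul_ξ (x y : JacobiGroup F) : (x * y).ξ = x.ξ * y.ξ * Circle.exp (Real.pi *
    altForm F (actV y.mp.mat x.v x.w) (actW y.mp.mat x.v x.w) y.v y.w) := rfl
theorem one_mp : (1 : JacobiGroup F).mp = 1 := rfl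
theorem one_v : (1 : JacobiGroup F).v = 0 := rfl
theorem one_w : (1 : JacobiGroup F).w = 0 := rfl
theorem one_ξ : (1 : JacobiGroup F).ξ = 1 := rfl
theorem inv_mp (x : JacobiGroup F) : (x⁻¹).mp = x.mp⁻¹ := rfl
theorem inv_v (x : JacobiGroup F) : (x⁻¹).v = -actV x.mp.mat⁻¹ x.v x.w := rfl
theorem inv_w (x : JacobiGroup F) : (x⁻¹).w = -actW x.mp.mat⁻¹ x.v x.w := rfl
theorem inv_ξ (x : JacobiGroup F) : (x⁻¹).ξ = x.ξ⁻¹ := rfl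

theorem actV_add (γ : SL(2, ℤ)) (v w v' w' : V) :
    actV γ (v + v') (w + w') = actV γ v w + actV γ v' w' := by
  simp only [actV, smul_add]; abel

theorem actW_add (γ : SL(2, ℤ)) (v w v' w' : V) :
    actW γ (v + v') (w + w') = actW γ v w + actW γ v' w' := by
  simp only [actW, smul_add]; abel

theorem actV_mul (γ δ : SL(2, ℤ)) (v w : V) :
    actV (γ * δ) v w = actV δ (actV γ v w) (actW γ v w) := by
  simp only [actV, actW, Matrix.SpecialLinearGroup.coe_mul, Matrix.mul_apply, Fin.sum_univ_two]
  module

theorem actW_mul (γ δ : SL(2, ℤ)) (v w : V) :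
    actW (γ * δ) v w = actW δ (actV γ v w) (actW γ v w) := by
  simp only [actV, actW, Matrix.SpecialLinearGroup.coe_mul, Matrix.mul_apply, Fin.sum_univ_two]
  module

theorem actV_one (v w : V) : actV 1 v w = v := by simp [actV]
theorem actW_one (v w : V) : actW 1 v w = w := by simp [actW]

theorem altForm_act (γ : SL(2, ℤ)) (v₁ w₁ v₂ w₂ : V) :
    altForm F (actV γ v₁ w₁) (actW γ v₁ w₁) (actV γ v₂ w₂) (actW γ v₂ w₂) =
      altForm F v₁ w₁ v₂ w₂ := by
  have hdet : ((γ 0 0 : ℤ) : ℝ) * (γ 1 1 : ℤ) - (γ 0 1 : ℤ) * (γ 1 0 : ℤ) = 1 := by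
    have := γ.det_coe
    rw [Matrix.det_fin_two] at this
    exact_mod_cast this
  simp only [altForm, actV, actW, map_add, map_zsmul, LinearMap.add_apply, LinearMap.smul_apply,
    zsmul_eq_mul]
  rw [F.symm v₂ v₁, F.symm w₂ w₁, F.symm w₂ v₁, F.symm w₁ v₂]
  linear_combination (F.B v₁ w₂ - F.B v₂ w₁) * hdet

instance : Group (JacobiGroup F) :=
  Group.ofLeftAxioms
    (fun x y z => by
      ext1
      · simp [mul_mp, mul_assoc]
      · simp only [mul_v, mul_w, mul_mp, Metaplectic.mul_mat, actV_add, actV_mul]; abel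
      · simp only [mul_v, mul_w, mul_mp, Metaplectic.mul_mat, actW_add, actW_mul]; abel
      · simp only [mul_ξ, mul_v, mul_w, mul_mp, Metaplectic.mul_mat, actV_add, actW_add,
          actV_mul, actW_mul]
        have h := altForm_act (F := F) z.mp.mat (actV y.mp.mat x.v x.w) (actW y.mp.mat x.v x.w)
          y.v y.w
        set p := actV y.mp.mat x.v x.w
        set q := actW y.mp.mat x.v x.w
        rw [← h]
        have h2 : ∀ a b c d : Circle, ∀ r s t u : ℝ, r + s = t + u →
            a * b * Circle.exp (Real.pi * r) * c * Circle.exp (Real.pi * s) =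
            a * (b * c * Circle.exp (Real.pi * t)) * Circle.exp (Real.pi * u) := by
          intro a b c _ r s t u hr
          have : Circle.exp (Real.pi * r) * Circle.exp (Real.pi * s) =
              Circle.exp (Real.pi * t) * Circle.exp (Real.pi * u) := by
            rw [← Circle.exp_add, ← Circle.exp_add, ← mul_add, ← mul_add, hr]
          calc _ = a * b * c * (Circle.exp (Real.pi * r) * Circle.exp (Real.pi * s)) := by
                  simp only [mul_comm, mul_left_comm, mul_assoc]
            _ = _ := by rw [this]; simp only [mul_assoc]
        refine h2 _ _ _ 1 _ _ _ _ ?_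
        simp only [altForm, map_add, LinearMap.add_apply]
        ring)
    (fun x => by
      ext1
      · simp [mul_mp, one_mp]
      · simp [mul_v, one_v, one_w, actV]
      · simp [mul_w, one_v, one_w, actW]
      · simp [mul_ξ, one_v, one_w, one_ξ, actV, actW, altForm])
    (fun x => by
      have hneg : ∀ v w : V, actV x.mp.mat (-v) (-w) = -actV x.mp.mat v w := by
        intro v w; simp only [actV, smul_neg]; abel
      have hneg' : ∀ v w : V, actW x.mp.mat (-v) (-w) = -actW x.mp.mat v w := by
        intro v w; simp only [actW, smul_neg]; abel
      ext1
      · simp [mul_mp, one_mp, inv_mp]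
      · simp [mul_v, one_v, inv_v, inv_w, hneg, ← actV_mul, actV_one]
      · simp [mul_w, one_w, inv_v, inv_w, hneg', ← actW_mul, actW_one]
      · simp [mul_ξ, one_ξ, inv_ξ, inv_v, inv_w, hneg, hneg', ← actV_mul, ← actW_mul,
          actV_one, actW_one, altForm])

end JacobiGroup

open JacobiGroup

/-- The subgroup of the elements with matrix in `G` and Heisenberg part in
`H(L, 1) = {([v, w], ξ) : v, w ∈ L, ξ² = 1}`, for an integral lattice `L`. -/
def jacobiSubgroup (F : SymForm V) (L : Submodule ℤ V) (hL : F.IsIntegral L)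
    (G : Subgroup SL(2, ℤ)) : Subgroup (JacobiGroup F) where
  carrier := {x | x.mp.mat ∈ G ∧ x.v ∈ L ∧ x.w ∈ L ∧ x.ξ ^ 2 = 1}
  one_mem' := ⟨G.one_mem, L.zero_mem, L.zero_mem, by simp [one_ξ]⟩
  mul_mem' := by
    rintro x y ⟨hx1, hx2, hx3, hx4⟩ ⟨hy1, hy2, hy3, hy4⟩
    have hv : actV y.mp.mat x.v x.w ∈ L := L.add_mem (L.smul_mem _ hx2) (L.smul_mem _ hx3)
    have hw : actW y.mp.mat x.v x.w ∈ L := L.add_mem (L.smul_mem _ hx2) (L.smul_mem _ hx3)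
    refine ⟨G.mul_mem hx1 hy1, L.add_mem hv hy2, L.add_mem hw hy3, ?_⟩
    obtain ⟨m, hm⟩ := hL _ hv _ hy3
    obtain ⟨n, hn⟩ := hL _ hy2 _ hw
    rw [mul_ξ, mul_pow, mul_pow, hx4, hy4, altForm, hm, hn, one_mul, one_mul, pow_two,
      ← Circle.exp_add]
    have : Real.pi * ((m : ℝ) - n) + Real.pi * ((m : ℝ) - n) = ((m - n : ℤ) : ℝ) * (2 * Real.pi) := by
      push_cast; ring
    rw [this, Circle.exp_int_mul_two_pi]
  inv_mem' := by
    rintro x ⟨hx1, hx2, hx3, hx4⟩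
    refine ⟨G.inv_mem hx1, L.neg_mem ?_, L.neg_mem ?_, ?_⟩
    · exact L.add_mem (L.smul_mem _ hx2) (L.smul_mem _ hx3)
    · exact L.add_mem (L.smul_mem _ hx2) (L.smul_mem _ hx3)
    · simp [inv_ξ, hx4]

/-! ### Jacobi forms of lattice index -/

/-- The inclusion of `V` in its complexification `ℂ ⊗ V`. -/
def toC (v : V) : ℂ ⊗[ℝ] V := (1 : ℂ) ⊗ₜ[ℝ] v

/-- The point `z + τ v + w` of `ℂ ⊗ V`. -/
def shift {F : SymForm V} (x : JacobiGroup F) (τ : ℍ) (z : ℂ ⊗[ℝ] V) : ℂ ⊗[ℝ] V :=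
  z + (τ : ℂ) • toC x.v + toC x.w

/-- The automorphic factor
`J_B = ξ e(-c/(cτ+d) Q(z + τv + w) + τ Q(v) + B(v, z) + B(v, w)/2)`. -/
def facJ (F : SymForm V) (x : JacobiGroup F) (τ : ℍ) (z : ℂ ⊗[ℝ] V) : ℂ :=
  (x.ξ : ℂ) * e (-((x.mp.mat 1 0 : ℂ) / autJ x.mp.mat τ) * F.QC (shift x τ z)
    + (τ : ℂ) * (F.Q x.v : ℂ) + F.BC (toC x.v) z + (F.B x.v x.w : ℂ) / 2)

/-- The slash operator of weight `κ / 2` and form `F`. -/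
def slash (κ : ℤ) (F : SymForm V) (f : ℍ → ℂ ⊗[ℝ] V → ℂ) (x : JacobiGroup F) :
    ℍ → ℂ ⊗[ℝ] V → ℂ := fun τ z =>
  (x.mp.root τ) ^ (-κ) * facJ F x τ z *
    f (x.mp.mat • τ) ((autJ x.mp.mat τ)⁻¹ • shift x τ z)

/-- `f` is holomorphic on `ℍ × (ℂ ⊗ V)` (in the coordinates given by a basis of `V`). -/
def IsHolomorphic (f : ℍ → ℂ ⊗[ℝ] V → ℂ) : Prop :=
  ∀ b : Module.Basis (Fin (Module.finrank ℝ V)) ℝ V,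
    DifferentiableOn ℂ
      (fun p : ℂ × (Fin (Module.finrank ℝ V) → ℂ) =>
        f (UpperHalfPlane.ofComplex p.1) (∑ i, p.2 i ⊗ₜ[ℝ] b i))
      {p | 0 < p.1.im}

/-- `g(τ, z) = ∑ c(n, t) e(n τ) e(B(t, z))`, summed over `n ∈ (1/M) ℤ` and `t ∈ (1/M) L♯` for some
integer `M ≥ 1`, where `c(n, t) = 0` unless `n - Q(t) ≥ 0`. (Absolute convergence at every point of
`ℍ × (ℂ ⊗ V)` implies normal convergence for such a series.) -/
def HasHoloExpansion (F : SymForm V) (L : Submodule ℤ V) (g : ℍ → ℂ ⊗[ℝ] V → ℂ) : Prop :=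
  ∃ M : ℕ, 0 < M ∧ ∃ c : ℤ × F.dual L → ℂ,
    (∀ p, c p ≠ 0 → 0 ≤ (p.1 : ℝ) / M - F.Q ((M : ℝ)⁻¹ • (p.2 : V))) ∧
    ∀ (τ : ℍ) (z : ℂ ⊗[ℝ] V), HasSum
      (fun p => c p * e (((p.1 : ℂ) / M) * (τ : ℂ)) * e (F.BC (toC ((M : ℝ)⁻¹ • (p.2 : V))) z))
      (g τ z)

/-- The space `J_{κ/2, (L, B)}(G, χ)` of scalar-valued Jacobi forms of weight `κ / 2`, index
`(L, B)`, group `G` and character `χ`. -/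
def JacobiForms (κ : ℤ) (F : SymForm V) (L : Submodule ℤ V) (hL : F.IsIntegral L)
    (G : Subgroup SL(2, ℤ)) (χ : jacobiSubgroup F L hL G →* ℂˣ) :
    Set (ℍ → ℂ ⊗[ℝ] V → ℂ) :=
  {f | F.PosDef ∧ G.FiniteIndex ∧ χ.ker.FiniteIndex ∧ IsHolomorphic f ∧
    (∀ x : jacobiSubgroup F L hL G, ∀ τ z, slash κ F f x τ z = (χ x : ℂ) * f τ z) ∧
    ∀ x ∈ jacobiSubgroup F L hL ⊤, HasHoloExpansion F L (slash κ F f x)}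

/-! ### Theta series and their characters -/

/-- The term of index `l ∈ L` of `θ_{α,β}(τ, z)`. -/
def thetaTerm (F : SymForm V) (α β : V) (τ : ℍ) (z : ℂ ⊗[ℝ] V) (l : V) : ℂ :=
  e (F.B β l : ℂ) * e ((τ : ℂ) * (F.Q (α + l) : ℂ) + F.BC (toC (α + l)) z)

/-- `θ_{α,β}(τ, z) = ∑_{l ∈ L} e(B(β, l)) e(τ Q(α + l) + B(α + l, z))`. -/
def theta (F : SymForm V) (L : Submodule ℤ V) (α β : V) (τ : ℍ) (z : ℂ ⊗[ℝ] V) : ℂ :=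
  ∑' l : L, thetaTerm F α β τ z l

/-- The Gauss sum `g(b, d; t) = |d|^(-n/2) ∑_{v ∈ L/dL} e(b Q(t + v) / d)`, `n = dim V`. -/
def gaussSum (F : SymForm V) (L : Submodule ℤ V) (b d : ℤ) (t : V) : ℂ :=
  ((|(d : ℝ)| ^ (-(Module.finrank ℝ V : ℝ) / 2) : ℝ) : ℂ) *
    ∑ᶠ v : L ⧸ LinearMap.range (LinearMap.lsmul ℤ L d),
      e ((b : ℂ) * (F.Q (t + (Quotient.out v : L)) : ℂ) / (d : ℂ))

/-- The symbol `s(c)`, Legendre symbol of `c` over `-1`: the sign of `c`, with value `1` at `c = 0`. -/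
def signSymbol (c : ℤ) : ℤ := if c < 0 then -1 else 1

/-- `χ` maps `((a b; c d), ε, [v, w], ξ)` with `d ≠ 0` to
`ε^(-n) ξ (-i)^(n (1 - sgn d) s(c) / 2) g(b, d; 0) e(b Q(α) - c Q(β) + B(v, w)/2 - B(v, β))`. -/
def IsThetaCharacter (F : SymForm V) (L : Submodule ℤ V) (hL : F.IsIntegral L)
    (G : Subgroup SL(2, ℤ)) (α β : V) (χ : jacobiSubgroup F L hL G →* ℂˣ) : Prop :=
  ∀ (x : JacobiGroup F) (hx : x ∈ jacobiSubgroup F L hL G) (a b c d : ℤ) (ε : ℤˣ),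
    a = x.mp.mat 0 0 → b = x.mp.mat 0 1 → c = x.mp.mat 1 0 → d = x.mp.mat 1 1 →
    (∀ τ, x.mp.root τ = ((ε : ℤ) : ℂ) * sqrtJ x.mp.mat τ) → d ≠ 0 →
    (χ ⟨x, hx⟩ : ℂ) =
      ((ε : ℤ) : ℂ) ^ (-(Module.finrank ℝ V : ℤ)) * (x.ξ : ℂ) *
        (-Complex.I) ^ ((Module.finrank ℝ V : ℤ) * ((1 - d.sign) / 2) * signSymbol c) *
        gaussSum F L b d 0 *
        e ((b : ℂ) * (F.Q α : ℂ) - (c : ℂ) * (F.Q β : ℂ) + (F.B x.v x.w : ℂ) / 2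
          - (F.B x.v β : ℂ))

/-- `χ` maps `((a b; c d), ε, [v, w], ξ)` with `d ≠ 0` to
`ε^(-mn) ξ (-i)^(mn (1 - sgn d) s(c) / 2) g(b, d; 0)^m e(m B(v, w)/2)`, where the Gauss sum
`g(b, d; 0)` is that of `(L, B)`; here `χ` is a character of the group attached to `(L, m B)`. -/
def IsThetaPowCharacter (F : SymForm V) (L : Submodule ℤ V) (m : ℕ)
    (hL : (F.scale m).IsIntegral L) (G : Subgroup SL(2, ℤ))
    (χ : jacobiSubgroup (F.scale m) L hL G →* ℂˣ) : Prop :=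
  ∀ (x : JacobiGroup (F.scale m)) (hx : x ∈ jacobiSubgroup (F.scale m) L hL G)
    (a b c d : ℤ) (ε : ℤˣ),
    a = x.mp.mat 0 0 → b = x.mp.mat 0 1 → c = x.mp.mat 1 0 → d = x.mp.mat 1 1 →
    (∀ τ, x.mp.root τ = ((ε : ℤ) : ℂ) * sqrtJ x.mp.mat τ) → d ≠ 0 →
    (χ ⟨x, hx⟩ : ℂ) =
      ((ε : ℤ) : ℂ) ^ (-((m : ℤ) * (Module.finrank ℝ V : ℤ))) * (x.ξ : ℂ) *
        (-Complex.I) ^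
          ((m : ℤ) * (Module.finrank ℝ V : ℤ) * ((1 - d.sign) / 2) * signSymbol c) *
        gaussSum F L b d 0 ^ m *
        e ((m : ℂ) * (F.B x.v x.w : ℂ) / 2)

end JacobiGroup

end LatticeJacobi

end

noncomputable section
namespace LatticeJacobi

/-! The heart of the matter is the transformation law of θ_{α,β} under γ ∈ Γ₁(N) with d ≠ 0. For
such γ one has d²·γτ = bd + τ₁ with τ₁ = dτ/(cτ+d). Since (d-1)α ∈ L, the shift α may be replaced by
dα, and splitting L into the cosets of dL (`latTheta_split`) turns the theta series at γτ into a sum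
over r ∈ L/dL of e(bQ(r)/d) times a theta series at τ₁ with shift α + r/d. Poisson summation
(`exists_latTheta_eq`) rewrites each of these as a sum over t ∈ L♯, and -1/τ₁ = -1/τ - c/d splits
off the phase e((B(t,r) - cQ(t))/d). Because cL♯ ⊆ L and cQ(L♯) ⊆ ℤ, completing the square shows
that the sum over r is the same Gauss sum for every t (`sum_gauss_complete_square`). Poisson
summation at τ, read backwards, then restores the original theta series. Its constant C appears in
both applications and never has to be evaluated; only the branches of the square roots need care
(`sqrt_quotient`), and they produce the power of -i.

The Heisenberg part acts by reindexing the series (`theta_shift`). The slash operator is a right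
action (`slash_mul`) and the theta series is not identically zero, so its eigenvalues form a
character. An element with d = 0 is a product of two elements with d ≠ 0; this gives both the
existence of the character on the whole group and its uniqueness (`exists_character`,
`character_ext`).

The kernel has finite index because the normalised Gauss sum is an eighth root of unity
(`gaussSum_pow_eight`): orthogonality gives |G|² = |d|^n, and G⁴ is real because a quaternion of
norm ≡ -1 mod d acts on (L/dL)⁴.

For the expansion at an arbitrary cusp with c ≠ 0, the same splitting is done modulo c, with τ₁ =
-c/(cτ+d). Now -1/τ₁ = τ + d/c, so one Poisson summation already yields a series of terms e(τQ(s) +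
B(s,z)) with s ∈ (1/N)L, for which the condition n ≥ Q(t) is an equality. Convexity of Q carries the
support condition to m-th powers with respect to mB. Finally, the integrality conditions on α and β
in the second statement are exactly what makes the m-th power of the phase independent of them
(`mul_thetaFactor_pow`). -/

theorem e_add (x y : ℂ) : e (x + y) = e x * e y := by
  simp only [e, mul_add, Complex.exp_add]

theorem e_zero : e 0 = 1 := by simp [e]

theorem e_ne_zero (x : ℂ) : e x ≠ 0 := Complex.exp_ne_zero _

theorem e_int (k : ℤ) : e k = 1 := by
  rw [e, mul_comm]; exact Complex.exp_int_mul_two_pi_mul_I k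

theorem e_add_int (x : ℂ) (k : ℤ) : e (x + k) = e x := by rw [e_add, e_int, mul_one]

theorem e_eq_of_sub {x y : ℂ} (k : ℤ) (h : x - y = k) : e x = e y := by
  rw [← e_add_int y k, ← h, add_sub_cancel]

theorem norm_e (x : ℂ) : ‖e x‖ = Real.exp (-2 * Real.pi * x.im) := by
  rw [e, Complex.norm_exp]
  congr 1
  simp [Complex.mul_re, Complex.mul_im]

theorem norm_e_ofReal (x : ℝ) : ‖e (x : ℂ)‖ = 1 := by simp [norm_e]

theorem continuous_e : Continuous e := by unfold e; fun_prop

theorem e_sum {κ : Type*} (s : Finset κ) (f : κ → ℂ) : e (∑ i ∈ s, f i) = ∏ i ∈ s, e (f i) := by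
  simp only [e, Finset.mul_sum, Complex.exp_sum]

theorem e_nat_mul (k : ℕ) (x : ℂ) : e (k * x) = e x ^ k := by
  rw [e, e, ← Complex.exp_nat_mul]; ring_nf

/-! ### Poisson summation on ℝ^ι and Gaussian bounds. -/

section Poisson

open MeasureTheory Set

set_option linter.unusedSectionVars false

variable {ι : Type*} [Fintype ι]

theorem mFourier_coe (m : ι → ℤ) (x : ι → ℝ) :
    UnitAddTorus.mFourier m (fun i => (x i : UnitAddCircle)) =
      e (∑ i, (m i : ℂ) * (x i : ℂ)) := by
  rw [e_sum]
  simp only [UnitAddTorus.mFourier, ContinuousMap.coe_mk]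
  refine Finset.prod_congr rfl fun i _ => ?_
  rw [fourier_coe_apply, e]
  congr 1
  push_cast; ring

/-- The half-open unit cube. -/
def unitCube (ι : Type*) : Set (ι → ℝ) := {x | ∀ i, x i ∈ Ioc (0 : ℝ) 1}

theorem measurableSet_unitCube : MeasurableSet (unitCube ι) :=
  MeasurableSet.univ_pi' fun _ => measurableSet_Ioc

theorem volume_unitCube : volume (unitCube ι) = 1 := by
  have : unitCube ι = Set.pi univ fun _ => Ioc (0 : ℝ) 1 := by ext; simp [unitCube]
  rw [this, Real.volume_pi_Ioc]; simp

/-- The integer vector `k` as a real vector. -/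
def intVec (k : ι → ℤ) : ι → ℝ := fun i => (k i : ℝ)

theorem intVec_add (k l : ι → ℤ) : intVec (k + l) = intVec k + intVec l := by
  ext i; simp [intVec]

theorem exists_sub_intVec_mem (x : ι → ℝ) : ∃ k : ι → ℤ, x + intVec k ∈ unitCube ι := by
  -- The cube is open at 0 and closed at 1, hence the ceiling rather than the floor.
  refine ⟨fun i => 1 - ⌈x i⌉, fun i => ?_⟩
  have h1 := Int.ceil_lt_add_one (x i)
  have h2 := Int.le_ceil (x i)
  simp only [intVec, Pi.add_apply, mem_Ioc]
  push_cast
  constructor <;> linarith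

theorem intVec_unique {x : ι → ℝ} {k l : ι → ℤ} (hk : x + intVec k ∈ unitCube ι)
    (hl : x + intVec l ∈ unitCube ι) : k = l := by
  ext i
  have h1 := hk i
  have h2 := hl i
  simp only [intVec, Pi.add_apply, mem_Ioc] at h1 h2
  have h3 : ((k i : ℤ) : ℝ) < l i + 1 := by linarith
  have h4 : ((l i : ℤ) : ℝ) < k i + 1 := by linarith
  have h5 : k i < l i + 1 := by exact_mod_cast h3
  have h6 : l i < k i + 1 := by exact_mod_cast h4
  omega

/-- Integrating over all translates of the unit cube. -/
theorem hasSum_integral_unitCube {h : (ι → ℝ) → ℂ} (hc : Continuous h) {u : (ι → ℤ) → ℝ}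
    (hu : Summable u) (hb : ∀ k, ∀ x ∈ unitCube ι, ‖h (x + intVec k)‖ ≤ u k) :
    HasSum (fun k => ∫ x in unitCube ι, h (x + intVec k)) (∫ x, h x) := by
  -- `s k` is the unit cube translated by `k`; these sets tile the whole space.
  set s : (ι → ℤ) → Set (ι → ℝ) := fun k => (fun x => x + intVec (-k)) ⁻¹' unitCube ι with hs
  have hm : ∀ k, MeasurableSet (s k) := fun k =>
    measurableSet_unitCube.preimage (measurable_add_const _)
  have hU : ⋃ k, s k = univ := by
    ext x
    simp only [mem_iUnion, mem_univ, iff_true]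
    obtain ⟨k, hk⟩ := exists_sub_intVec_mem x
    exact ⟨-k, by simpa [hs] using hk⟩
  have hd : Pairwise (Function.onFun Disjoint s) := by
    intro k l hkl
    refine Set.disjoint_left.2 fun x hk hl => hkl ?_
    exact neg_injective (intVec_unique (x := x) hk hl)
  have hI : ∀ k, ∀ g : (ι → ℝ) → ℝ, ∫ x in s k, g x = ∫ x in unitCube ι, g (x + intVec k) := by
    intro k g
    have := (measurePreserving_add_right (volume : Measure (ι → ℝ)) (intVec (-k))).setIntegral_preimage_emb
      (MeasurableEquiv.addRight (intVec (-k))).measurableEmbedding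
      (fun x => g (x + intVec k)) (unitCube ι)
    rw [← this]
    congr 1
    ext x
    rw [add_assoc, ← intVec_add]; simp [intVec, Pi.add_def]
  have hI' : ∀ k, ∫ x in s k, h x = ∫ x in unitCube ι, h (x + intVec k) := by
    intro k
    have := (measurePreserving_add_right (volume : Measure (ι → ℝ)) (intVec (-k))).setIntegral_preimage_emb
      (MeasurableEquiv.addRight (intVec (-k))).measurableEmbedding
      (fun x => h (x + intVec k)) (unitCube ι)
    rw [← this]
    congr 1
    ext x
    rw [add_assoc, ← intVec_add]; simp [intVec, Pi.add_def]
  have hbs : ∀ k, ∀ x ∈ s k, ‖h x‖ ≤ u k := by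
    intro k x hx
    have := hb k _ hx
    rwa [add_assoc, ← intVec_add, neg_add_cancel, show intVec (0 : ι → ℤ) = 0 by
      ext; simp [intVec], add_zero] at this
  have hvol : ∀ k, volume (s k) = 1 := by
    intro k
    rw [hs]
    simp only
    rw [measure_preimage_add_right, volume_unitCube]
  have hint : ∀ k, IntegrableOn h (s k) := fun k =>
    Measure.integrableOn_of_bounded (by rw [hvol]; simp) hc.aestronglyMeasurable
      ((ae_restrict_iff' (hm k)).2 (Filter.Eventually.of_forall (hbs k)))
  have hnorm : ∀ k, ∫ x in s k, ‖h x‖ ≤ u k := by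
    intro k
    calc ∫ x in s k, ‖h x‖ ≤ ∫ x in s k, u k :=
          setIntegral_mono_on (hint k).norm (integrableOn_const (by rw [hvol]; simp)) (hm k) (hbs k)
      _ = u k := by simp [Measure.real, hvol]
  have hon : IntegrableOn h (⋃ k, s k) :=
    integrableOn_iUnion_of_summable_integral_norm hint
      (Summable.of_nonneg_of_le (fun k => integral_nonneg fun _ => norm_nonneg _) hnorm hu)
  have := hasSum_integral_iUnion hm hd hon
  rw [hU, setIntegral_univ] at this
  simpa only [hI'] using this

theorem continuous_tsum_intVec {f : (ι → ℝ) → ℂ} (hf : Continuous f)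
    (hb : ∀ R : ℝ, ∃ u : (ι → ℤ) → ℝ, Summable u ∧
      ∀ k x, (∀ i, |x i| ≤ R) → ‖f (x + intVec k)‖ ≤ u k) :
    Continuous fun x => ∑' k, f (x + intVec k) := by
  rw [continuous_iff_continuousAt]
  intro x₀
  obtain ⟨u, hu, hub⟩ := hb (‖x₀‖ + 1)
  refine ContinuousOn.continuousAt (s := Metric.ball 0 (‖x₀‖ + 1)) ?_
    (Metric.isOpen_ball.mem_nhds (by simp))
  refine continuousOn_tsum (fun k => (hf.comp (continuous_add_const _)).continuousOn) hu ?_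
  intro k x hx
  refine hub k x fun i => ?_
  rw [mem_ball_zero_iff] at hx
  exact (norm_le_pi_norm x i).trans hx.le

/-- The Poisson summation formula on `ℝ^ι`. -/
theorem tsum_eq_tsum_integral {f : (ι → ℝ) → ℂ} (hf : Continuous f)
    (hb : ∀ R : ℝ, ∃ u : (ι → ℤ) → ℝ, Summable u ∧
      ∀ k x, (∀ i, |x i| ≤ R) → ‖f (x + intVec k)‖ ≤ u k)
    (hF : Summable fun m : ι → ℤ => ∫ y, e (-∑ i, (m i : ℂ) * (y i : ℂ)) * f y) :
    ∑' k, f (intVec k) = ∑' m : ι → ℤ, ∫ y, e (-∑ i, (m i : ℂ) * (y i : ℂ)) * f y := by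
  set P : (ι → ℝ) → ℂ := fun x => ∑' k, f (x + intVec k) with hP
  have hPc : Continuous P := continuous_tsum_intVec hf hb
  have hper : ∀ x l, P (x + intVec l) = P x := by
    intro x l
    rw [hP]
    simp only
    rw [← (Equiv.addLeft l).tsum_eq fun k => f (x + intVec k)]
    refine tsum_congr fun k => ?_
    simp only [Equiv.coe_addLeft, intVec_add, add_assoc]
  set π : (ι → ℝ) → UnitAddTorus ι := fun x i => (x i : UnitAddCircle) with hπ
  have hq : IsOpenQuotientMap π :=
    IsOpenQuotientMap.piMap (f := fun _ : ι => ((↑) : ℝ → UnitAddCircle))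
      fun _ => QuotientAddGroup.isOpenQuotientMap_mk
  -- The periodisation `P` descends to the torus; the choice of a preimage is immaterial because `P`
  -- is invariant under integer translations.
  set g : UnitAddTorus ι → ℂ := fun t => P (Function.surjInv hq.surjective t) with hg
  have hgP : ∀ x, g (π x) = P x := by
    intro x
    have h1 : π (Function.surjInv hq.surjective (π x)) = π x := Function.surjInv_eq _ _
    set y := Function.surjInv hq.surjective (π x) with hy
    have h2 : ∀ i, ∃ k : ℤ, y i = x i + k := by
      intro i
      have := congrFun h1 i
      simp only [hπ] at this
      rw [eq_comm, QuotientAddGroup.eq, AddSubgroup.mem_zmultiples_iff] at this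
      obtain ⟨k, hk⟩ := this
      refine ⟨k, ?_⟩
      simp at hk
      linarith
    choose k hk using h2
    have h3 : y = x + intVec k := by ext i; simp [intVec, hk]
    rw [hg]
    simp only
    rw [← hy, h3, hper]
  have hgc : Continuous g := by
    rw [hq.isQuotientMap.continuous_iff]
    have : g ∘ π = P := funext hgP
    rw [this]; exact hPc
  have hcoef : ∀ m, UnitAddTorus.mFourierCoeff g m =
      ∫ y, e (-∑ i, (m i : ℂ) * (y i : ℂ)) * f y := by
    intro m
    -- The coefficient is an integral over (0,1]^ι. Unfolding `P` and using e(-m·k) = 1 turns it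
    -- into an integral over all translates of the cube.
    rw [UnitAddTorus.mFourierCoeff_eq_integral g m 0]
    have hset : {x : ι → ℝ | ∀ i, x i ∈ Ioc ((0 : ι → ℝ) i) ((0 : ι → ℝ) i + 1)} = unitCube ι := by
      simp [unitCube]
    rw [hset]
    set h : (ι → ℝ) → ℂ := fun y => e (-∑ i, (m i : ℂ) * (y i : ℂ)) * f y with hh
    have hhc : Continuous h := (continuous_e.comp (by fun_prop)).mul hf
    have hnh : ∀ y, ‖h y‖ = ‖f y‖ := by
      intro y
      rw [hh]
      simp only
      rw [norm_mul, show -∑ i, (m i : ℂ) * (y i : ℂ) = ((-∑ i, (m i : ℝ) * y i : ℝ) : ℂ) by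
        push_cast; rfl, norm_e_ofReal, one_mul]
    obtain ⟨u, hu, hub⟩ := hb 1
    have hub' : ∀ k, ∀ x ∈ unitCube ι, ‖h (x + intVec k)‖ ≤ u k := by
      intro k x hx
      rw [hnh]
      exact hub k x fun i => abs_le.2 ⟨by linarith [(hx i).1], (hx i).2⟩
    have h1 := hasSum_integral_unitCube hhc hu hub'
    have hfin : IsFiniteMeasure (volume.restrict (unitCube ι)) := ⟨by simp [volume_unitCube]⟩
    have hint : ∀ k, IntegrableOn (fun x => h (x + intVec k)) (unitCube ι) := fun k =>
      Measure.integrableOn_of_bounded (by rw [volume_unitCube]; simp)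
        (hhc.comp (continuous_add_const _)).aestronglyMeasurable
        ((ae_restrict_iff' measurableSet_unitCube).2 (Filter.Eventually.of_forall (hub' k)))
    have hnorm : ∀ k, ∫ x in unitCube ι, ‖h (x + intVec k)‖ ≤ u k := by
      intro k
      calc ∫ x in unitCube ι, ‖h (x + intVec k)‖ ≤ ∫ x in unitCube ι, u k :=
            setIntegral_mono_on (hint k).norm (integrableOn_const (by rw [volume_unitCube]; simp))
              measurableSet_unitCube (hub' k)
        _ = u k := by simp [Measure.real, volume_unitCube]
    have h2 := hasSum_integral_of_summable_integral_norm hint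
      (Summable.of_nonneg_of_le (fun k => integral_nonneg fun _ => norm_nonneg _) hnorm hu)
    rw [h1.unique h2]
    refine setIntegral_congr_fun measurableSet_unitCube fun x _ => ?_
    have : (fun i => ((x i : ℝ) : UnitAddCircle)) = π x := rfl
    rw [mFourier_coe, this, hgP, smul_eq_mul, hP]
    simp only
    rw [← tsum_mul_left]
    refine tsum_congr fun k => ?_
    rw [hh]
    simp only
    congr 1
    refine e_eq_of_sub (∑ i, m i * k i) ?_
    push_cast
    rw [← Finset.sum_neg_distrib, ← Finset.sum_sub_distrib]
    refine Finset.sum_congr rfl fun i _ => ?_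
    simp [intVec]; ring
  -- The Fourier series is evaluated at the origin, where every character equals 1.
  have key := UnitAddTorus.hasSum_mFourier_series_apply_of_summable (f := ⟨g, hgc⟩)
    (by
      have : UnitAddTorus.mFourierCoeff (⟨g, hgc⟩ : C(UnitAddTorus ι, ℂ)) =
        fun m : ι → ℤ => ∫ y, e (-∑ i, (m i : ℂ) * (y i : ℂ)) * f y := funext hcoef
      rw [this]; exact hF) (π 0)
  have h4 := key.tsum_eq
  simp only [ContinuousMap.coe_mk, hgP] at h4
  rw [show P 0 = ∑' k, f (intVec k) by simp [hP]] at h4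
  rw [← h4]
  refine tsum_congr fun m => ?_
  rw [hcoef, hπ, mFourier_coe]
  simp [e_zero]

/-! Gaussian bounds on `ℤ^ι` -/

/-- A finite set of integer vectors lies in the box spanned by its coordinate projections, over
which the sum of products factorises. -/
theorem summable_prod_pi {a : ι → ℤ → ℝ} (h0 : ∀ i k, 0 ≤ a i k) (h : ∀ i, Summable (a i)) :
    Summable fun k : ι → ℤ => ∏ i, a i (k i) := by
  classical
  refine summable_of_sum_le (c := ∏ i, ∑' k, a i k) (fun k => Finset.prod_nonneg fun i _ => h0 _ _)
    fun s => ?_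
  calc ∑ k ∈ s, ∏ i, a i (k i)
      ≤ ∑ k ∈ Fintype.piFinset fun i => s.image fun k => k i, ∏ i, a i (k i) := by
        refine Finset.sum_le_sum_of_subset_of_nonneg ?_ fun k _ _ =>
          Finset.prod_nonneg fun i _ => h0 _ _
        intro k hk
        exact Fintype.mem_piFinset.2 fun i => Finset.mem_image_of_mem _ hk
    _ = ∏ i, ∑ j ∈ s.image fun k => k i, a i j := (Finset.prod_univ_sum _ _).symm
    _ ≤ _ := Finset.prod_le_prod (fun i _ => Finset.sum_nonneg fun _ _ => h0 _ _)
        fun i _ => (h i).sum_le_tsum _ fun _ _ => h0 _ _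

theorem summable_exp_neg_sq {a : ℝ} (ha : 0 < a) (A : ℝ) :
    Summable fun k : ℤ => Real.exp (-a * (k : ℝ) ^ 2 + A * |(k : ℝ)|) := by
  have h1 : Summable fun k : ℤ => Real.exp (-|(k : ℝ)|) := by
    refine Summable.of_nat_of_neg ?_ ?_ <;>
      simpa using Real.summable_exp_neg_nat
  refine Summable.of_nonneg_of_le (fun k => (Real.exp_pos _).le) (fun k => ?_)
    (h1.mul_left (Real.exp ((A + 1) ^ 2 / (4 * a))))
  rw [← Real.exp_add]
  refine Real.exp_le_exp.2 ?_
  have h2 : (k : ℝ) ^ 2 = |(k : ℝ)| ^ 2 := (sq_abs _).symm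
  rw [h2, ← sub_nonneg]
  -- Completing the square: this is exactly the difference of the two exponents.
  have h3 : 0 ≤ (2 * a * |(k : ℝ)| - (A + 1)) ^ 2 / (4 * a) := by positivity
  convert h3 using 1
  field_simp
  ring

/-- Half of the quadratic decay in k is given up to absorb the shift by x, uniformly for |x| ≤ R. -/
theorem gaussian_exponent_le {a A R x : ℝ} (ha : 0 < a) (hA : 0 ≤ A) (hx : |x| ≤ R) (k : ℝ) :
    -a * (x + k) ^ 2 + A * |x + k| ≤
      a * R ^ 2 + A * R + (-(a / 2) * k ^ 2 + A * |k|) := by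
  have h1 : |x + k| ≤ R + |k| := (abs_add_le _ _).trans (by linarith)
  have h2 : x ^ 2 ≤ R ^ 2 := by
    rw [← sq_abs x]; exact pow_le_pow_left₀ (abs_nonneg _) hx 2
  have h3 : k ^ 2 / 2 - R ^ 2 ≤ (x + k) ^ 2 := by
    linarith [sq_nonneg (2 * x + k)]
  have h4 := mul_le_mul_of_nonneg_left h1 hA
  have h5 := mul_le_mul_of_nonneg_left h3 ha.le
  linarith

theorem exists_gaussian_bound {a : ℝ} (ha : 0 < a) (A R : ℝ) (hA : 0 ≤ A) :
    ∃ u : (ι → ℤ) → ℝ, Summable u ∧ ∀ k x, (∀ i, |x i| ≤ R) →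
      Real.exp (-a * ∑ i, (x + intVec k) i ^ 2 + A * ∑ i, |(x + intVec k) i|) ≤ u k := by
  have hs := summable_prod_pi (ι := ι) (a := fun _ k => Real.exp (a * R ^ 2 + A * R) *
    Real.exp (-(a / 2) * (k : ℝ) ^ 2 + A * |(k : ℝ)|))
    (fun _ _ => mul_nonneg (Real.exp_pos _).le (Real.exp_pos _).le)
    (fun _ => (summable_exp_neg_sq (half_pos ha) A).mul_left _)
  refine ⟨_, hs, fun k x hx => ?_⟩
  rw [Finset.mul_sum, Finset.mul_sum, ← Finset.sum_add_distrib, Real.exp_sum]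
  refine Finset.prod_le_prod (fun i _ => (Real.exp_pos _).le) fun i _ => ?_
  rw [← Real.exp_add]
  refine Real.exp_le_exp.2 ?_
  simp only [Pi.add_apply, intVec]
  exact gaussian_exponent_le ha hA (hx i) (k i)

end Poisson

/-! ### Complexified forms, dual lattices and the level. -/

section Forms

set_option linter.unusedSectionVars false

variable {V : Type*} [AddCommGroup V] [Module ℝ V]

theorem toC_add (v w : V) : toC (v + w) = toC v + toC w := TensorProduct.tmul_add _ _ _

theorem toC_smul (r : ℝ) (v : V) : toC (r • v) = (r : ℂ) • toC v := by
  rw [toC, toC, TensorProduct.tmul_smul, TensorProduct.smul_tmul', TensorProduct.smul_tmul']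
  simp

theorem toC_zsmul (k : ℤ) (v : V) : toC (k • v) = (k : ℂ) • toC v := by
  rw [← Int.cast_smul_eq_zsmul ℝ, toC_smul]; simp

theorem toC_neg (v : V) : toC (-v) = -toC v := TensorProduct.tmul_neg _ _

theorem toC_sub (v w : V) : toC (v - w) = toC v - toC w := TensorProduct.tmul_sub _ _ _

theorem toC_zero : toC (0 : V) = 0 := TensorProduct.tmul_zero _ _

theorem toC_sum {κ : Type*} (s : Finset κ) (f : κ → V) :
    toC (∑ i ∈ s, f i) = ∑ i ∈ s, toC (f i) := TensorProduct.tmul_sum _ _ _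

theorem apply_eq_sum_repr {κ : Type*} [Fintype κ] (b : Module.Basis κ ℝ V) (f : V →ₗ[ℝ] ℝ) (v : V) :
    f v = ∑ i, b.repr v i * f (b i) := by
  conv_lhs => rw [← b.sum_repr v, map_sum]
  simp only [map_smul, smul_eq_mul]

namespace SymForm

variable (F : SymForm V)

theorem BC_tmul (a c : ℂ) (v w : V) : F.BC (a ⊗ₜ v) (c ⊗ₜ w) = a * c * (F.B v w : ℂ) := by
  rw [BC, LinearMap.BilinForm.baseChange_tmul, Complex.real_smul]; ring

theorem BC_toC (v w : V) : F.BC (toC v) (toC w) = (F.B v w : ℂ) := by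
  rw [toC, toC, BC_tmul]; simp

theorem BC_symm (z w : ℂ ⊗[ℝ] V) : F.BC z w = F.BC w z := by
  induction z with
  | zero => simp
  | add x y hx hy => simp [hx, hy]
  | tmul a v =>
    induction w with
    | zero => simp
    | add x y hx hy => simp [hx, hy]
    | tmul c w => rw [BC_tmul, BC_tmul, F.symm v w, mul_comm a]

theorem QC_add (z w : ℂ ⊗[ℝ] V) : F.QC (z + w) = F.QC z + F.QC w + F.BC z w := by
  simp only [QC, map_add, LinearMap.add_apply, F.BC_symm w z]; ring

theorem QC_smul (c : ℂ) (z : ℂ ⊗[ℝ] V) : F.QC (c • z) = c ^ 2 * F.QC z := by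
  simp only [QC, map_smul, LinearMap.smul_apply, smul_eq_mul]; ring

theorem QC_toC (v : V) : F.QC (toC v) = (F.Q v : ℂ) := by
  rw [QC, BC_toC, Q]; push_cast; rfl

theorem Q_add (v w : V) : F.Q (v + w) = F.Q v + F.Q w + F.B v w := by
  simp only [Q, map_add, LinearMap.add_apply, F.symm w v]; ring

theorem Q_smul (r : ℝ) (v : V) : F.Q (r • v) = r ^ 2 * F.Q v := by
  simp only [Q, map_smul, LinearMap.smul_apply, smul_eq_mul]; ring

theorem Q_zsmul (k : ℤ) (v : V) : F.Q (k • v) = (k : ℝ) ^ 2 * F.Q v := by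
  rw [← Int.cast_smul_eq_zsmul ℝ, Q_smul]

theorem Q_neg (v : V) : F.Q (-v) = F.Q v := by simp [Q]

theorem Q_sub (v w : V) : F.Q (v - w) = F.Q v + F.Q w - F.B v w := by
  rw [sub_eq_add_neg, Q_add, Q_neg]; simp; ring

theorem Q_zero : F.Q 0 = 0 := by simp [Q]

theorem B_zsmul_left (k : ℤ) (v w : V) : F.B (k • v) w = k * F.B v w := by
  simp

theorem B_zsmul_right (k : ℤ) (v w : V) : F.B v (k • w) = k * F.B v w := by
  simp

variable {F}

theorem PosDef.nondegenerate (h : F.PosDef) : F.B.Nondegenerate := by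
  constructor
  · intro v hv
    by_contra hne
    exact (h v hne).ne' (hv v)
  · intro v hv
    by_contra hne
    exact (h v hne).ne' (hv v)

theorem isSymm (F : SymForm V) : F.B.IsSymm := ⟨fun v w => F.symm v w⟩

theorem PosDef.Q_nonneg (h : F.PosDef) (v : V) : 0 ≤ F.Q v := by
  by_cases hv : v = 0
  · simp [hv, Q_zero]
  · exact (div_pos (h v hv) two_pos).le

theorem PosDef.exists_orthonormal [FiniteDimensional ℝ V] (h : F.PosDef) :
    ∃ o : Module.Basis (Fin (Module.finrank ℝ V)) ℝ V,
      ∀ i j, F.B (o i) (o j) = if i = j then 1 else 0 := by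
  have : Invertible (2 : ℝ) := invertibleOfNonzero two_ne_zero
  obtain ⟨v, hv⟩ := LinearMap.BilinForm.exists_orthogonal_basis (B := F.B)
    ⟨fun x y => by simp [F.symm x y]⟩
  have hp : ∀ i, 0 < F.B (v i) (v i) := fun i => h _ (v.ne_zero i)
  have hu : ∀ i, IsUnit ((Real.sqrt (F.B (v i) (v i)))⁻¹) := fun i =>
    (inv_pos.2 (Real.sqrt_pos.2 (hp i))).ne'.isUnit
  refine ⟨v.isUnitSMul hu, fun i j => ?_⟩
  rw [Module.Basis.isUnitSMul_apply, Module.Basis.isUnitSMul_apply]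
  simp only [map_smul, LinearMap.smul_apply, smul_eq_mul]
  split_ifs with hij
  · subst hij
    have h1 := Real.mul_self_sqrt (hp i).le
    have h2 := (Real.sqrt_pos.2 (hp i)).ne'
    field_simp
    rw [sq, h1]
  · have : F.B (v i) (v j) = 0 := hv hij
    rw [this]; simp

theorem B_eq_sum_of_orthonormal {κ : Type*} [Fintype κ] [DecidableEq κ]
    {o : Module.Basis κ ℝ V} (ho : ∀ i j, F.B (o i) (o j) = if i = j then 1 else 0) (v w : V) :
    F.B v w = ∑ i, o.repr v i * o.repr w i := by
  rw [F.symm, apply_eq_sum_repr o (F.B w)]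
  refine Finset.sum_congr rfl fun i _ => ?_
  rw [F.symm, apply_eq_sum_repr o (F.B (o i)) w]
  simp [ho]

/-- 2Q(v) is the squared length of v in orthonormal coordinates, and Cauchy–Schwarz bounds every
other coordinate by that length. -/
theorem PosDef.exists_Q_ge [FiniteDimensional ℝ V] (h : F.PosDef) {κ : Type*} [Fintype κ]
    (b : Module.Basis κ ℝ V) : ∃ c > 0, ∀ v, c * ∑ i, (b.repr v i) ^ 2 ≤ F.Q v := by
  obtain ⟨o, ho⟩ := h.exists_orthonormal
  set K : ℝ := ∑ i, ∑ j, (b.repr (o j) i) ^ 2 with hK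
  have hK0 : 0 ≤ K := Finset.sum_nonneg fun i _ => Finset.sum_nonneg fun j _ => sq_nonneg _
  have hle : ∀ v, ∑ i, (b.repr v i) ^ 2 ≤ 2 * F.Q v * K := by
    intro v
    rw [hK, Finset.mul_sum]
    refine Finset.sum_le_sum fun i _ => ?_
    have h1 : b.repr v i = ∑ j, o.repr v j * b.repr (o j) i := by
      simpa using apply_eq_sum_repr o (b.coord i) v
    have h2 : 2 * F.Q v = ∑ j, (o.repr v j) ^ 2 := by
      rw [Q, B_eq_sum_of_orthonormal ho]
      rw [mul_div_cancel₀ _ two_ne_zero]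
      exact Finset.sum_congr rfl fun j _ => (sq _).symm
    rw [h1, h2]
    exact Finset.sum_mul_sq_le_sq_mul_sq _ _ _
  -- The summand 1 keeps the constant positive when `K = 0`, that is, when V is trivial.
  refine ⟨(2 * K + 1)⁻¹, by positivity, fun v => ?_⟩
  rw [inv_mul_le_iff₀ (by positivity)]
  have := hle v
  have := h.Q_nonneg v
  nlinarith

theorem exists_Q_le {κ : Type*} [Fintype κ]
    (F : SymForm V) (b : Module.Basis κ ℝ V) : ∃ D ≥ 0, ∀ v, |F.Q v| ≤ D * (∑ i, |b.repr v i|) ^ 2 := by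
  refine ⟨∑ i, ∑ j, |F.B (b i) (b j)|, by positivity, fun v => ?_⟩
  have h1 : F.B v v = ∑ i, ∑ j, b.repr v i * (b.repr v j * F.B (b i) (b j)) := by
    conv_lhs => rw [← b.sum_repr v]
    simp only [map_sum, map_smul, LinearMap.sum_apply, LinearMap.smul_apply, smul_eq_mul,
      Finset.mul_sum]
    rw [Finset.sum_comm]
    refine Finset.sum_congr rfl fun i _ => Finset.sum_congr rfl fun j _ => ?_
    ring
  have h2 : |F.B v v| ≤ (∑ i, ∑ j, |F.B (b i) (b j)|) * (∑ i, |b.repr v i|) ^ 2 := by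
    rw [h1, Finset.sum_mul]
    refine (Finset.abs_sum_le_sum_abs _ _).trans (Finset.sum_le_sum fun i _ => ?_)
    rw [Finset.sum_mul]
    refine (Finset.abs_sum_le_sum_abs _ _).trans (Finset.sum_le_sum fun j _ => ?_)
    have hi : ∀ i, |b.repr v i| ≤ ∑ i, |b.repr v i| := fun i =>
      Finset.single_le_sum (f := fun i => |b.repr v i|) (fun _ _ => abs_nonneg _) (Finset.mem_univ i)
    rw [← mul_assoc, abs_mul, abs_mul, mul_comm, sq]
    exact mul_le_mul_of_nonneg_left (mul_le_mul (hi i) (hi j) (abs_nonneg _)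
      ((abs_nonneg _).trans (hi i))) (abs_nonneg _)
  rw [Q, abs_div, abs_two]
  have := abs_nonneg (F.B v v)
  linarith

end SymForm

/-! ### Dual lattice and level -/

variable [FiniteDimensional ℝ V] {F : SymForm V} {L : Submodule ℤ V}

theorem dual_eq_dualSubmodule (F : SymForm V) (L : Submodule ℤ V) :
    F.dual L = F.B.dualSubmodule L := by
  ext v
  simp only [LinearMap.BilinForm.mem_dualSubmodule, Submodule.mem_one]
  constructor
  · intro h y hy
    obtain ⟨m, hm⟩ := h y hy
    exact ⟨m, by simp [hm]⟩
  · intro h y hy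
    obtain ⟨m, hm⟩ := h y hy
    exact ⟨m, by simp [← hm]⟩

theorem exists_dual_basis (hF : F.PosDef) (b : Module.Basis (Fin (Module.finrank ℝ V)) ℝ V) :
    ∃ b' : Module.Basis (Fin (Module.finrank ℝ V)) ℝ V,
      (∀ i j, F.B (b' i) (b j) = if i = j then 1 else 0) ∧
      F.dual (Submodule.span ℤ (Set.range b)) = Submodule.span ℤ (Set.range b') := by
  refine ⟨F.B.dualBasis hF.nondegenerate b, fun i j => ?_, ?_⟩
  · rw [LinearMap.BilinForm.apply_dualBasis_left]; simp [eq_comm]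
  · rw [dual_eq_dualSubmodule, LinearMap.BilinForm.dualSubmodule_span_of_basis]

theorem IsLattice.dual (hF : F.PosDef) (hL : IsLattice L) : IsLattice (F.dual L) := by
  obtain ⟨b, rfl⟩ := hL
  obtain ⟨b', -, h⟩ := exists_dual_basis hF b
  exact ⟨b', h⟩

/-- Biduality of lattices, in the form that places multiples of dual vectors in L. -/
theorem mem_of_dual (hF : F.PosDef) (hL : IsLattice L) {v : V}
    (h : ∀ t ∈ F.dual L, ∃ m : ℤ, F.B v t = m) : v ∈ L := by
  obtain ⟨b, rfl⟩ := hL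
  rw [← LinearMap.BilinForm.dualSubmodule_dualSubmodule_of_basis (B := F.B) hF.nondegenerate F.isSymm b,
    ← dual_eq_dualSubmodule, ← dual_eq_dualSubmodule]
  exact h

theorem le_dual (hL : F.IsIntegral L) : L ≤ F.dual L := fun v hv w hw => hL v hv w hw

/-- Cramer's rule: the Gram matrix is integral, and its determinant clears the denominators of its
inverse. -/
theorem exists_nat_smul_dual_mem (hF : F.PosDef) (hL : IsLattice L) (hi : F.IsIntegral L) :
    ∃ D : ℕ, 0 < D ∧ ∀ v ∈ F.dual L, (D : ℤ) • v ∈ L := by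
  obtain ⟨b, rfl⟩ := hL
  set S : Matrix (Fin (Module.finrank ℝ V)) (Fin (Module.finrank ℝ V)) ℝ :=
    LinearMap.BilinForm.toMatrix b F.B with hS
  have hm : ∀ i, b i ∈ Submodule.span ℤ (Set.range b) := fun i => Submodule.subset_span ⟨i, rfl⟩
  choose s hs using fun i j => hi (b i) (hm i) (b j) (hm j)
  set T : Matrix (Fin (Module.finrank ℝ V)) (Fin (Module.finrank ℝ V)) ℤ := Matrix.of s with hT
  have hST : S = T.map (Int.castRingHom ℝ) := by
    ext i j; simp [hS, hT, LinearMap.BilinForm.toMatrix_apply, hs]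
  have hdet : S.det ≠ 0 :=
    (LinearMap.BilinForm.nondegenerate_iff_det_ne_zero b).1 hF.nondegenerate
  have hdT : T.det ≠ 0 := by
    intro h0
    apply hdet
    rw [hST, ← RingHom.mapMatrix_apply, ← RingHom.map_det, h0]; simp
  refine ⟨T.det.natAbs, Int.natAbs_pos.2 hdT, fun v hv => ?_⟩
  suffices h : T.det • v ∈ Submodule.span ℤ (Set.range b) by
    rcases Int.natAbs_eq T.det with h' | h'
    · rwa [← h']
    · rw [h'] at h
      rw [neg_smul] at h
      exact neg_mem_iff.1 h
  choose x hx using fun j => hv (b j) (hm j)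
  have h1 : T.det • v = ∑ j, (Matrix.vecMul x T.adjugate) j • b j := by
    apply b.ext_elem
    intro j
    have h2 : Matrix.vecMul (fun i => b.repr v i) S = fun j => (x j : ℝ) := by
      ext j
      rw [← hx j]
      rw [F.symm, apply_eq_sum_repr b (F.B (b j)) v]
      simp [Matrix.vecMul, dotProduct, hS, LinearMap.BilinForm.toMatrix_apply, F.symm (b j)]
    have h3 : Matrix.vecMul (fun j => (x j : ℝ)) S.adjugate = S.det • fun i => b.repr v i := by
      rw [← h2, Matrix.vecMul_vecMul, Matrix.mul_adjugate, Matrix.vecMul_smul, Matrix.vecMul_one]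
    have h4 : S.adjugate = T.adjugate.map (Int.castRingHom ℝ) := by
      rw [hST, ← RingHom.mapMatrix_apply, ← RingHom.map_adjugate, RingHom.mapMatrix_apply]
    have h5 : S.det = T.det := by
      rw [hST, ← RingHom.mapMatrix_apply, ← RingHom.map_det]; simp
    have h6 := congrFun h3 j
    rw [h4, h5] at h6
    simp only [Pi.smul_apply, smul_eq_mul] at h6
    have h7 : b.repr (T.det • v) j = T.det * b.repr v j := by
      rw [← Int.cast_smul_eq_zsmul ℝ]; simp
    rw [h7, ← h6]
    have h8 : ∀ (k : ℤ) (i), b.repr (k • b i) j = if i = j then (k : ℝ) else 0 := by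
      intro k i
      rw [← Int.cast_smul_eq_zsmul ℝ]; simp [Finsupp.single_apply]
    rw [map_sum, Finsupp.finsetSum_apply]
    simp only [h8]
    simp [Matrix.vecMul, dotProduct]
  rw [h1]
  exact Submodule.sum_mem _ fun j _ => Submodule.smul_mem _ _ (hm j)

/-- An infimum of natural numbers is attained as soon as the set is nonempty; here D² belongs to it,
because Q(Dv) = D²Q(v). -/
theorem level_spec (hF : F.PosDef) (hL : IsLattice L) (he : F.IsEven L) :
    0 < F.level L ∧ ∀ v ∈ F.dual L, ∃ m : ℤ, F.level L * F.Q v = m := by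
  obtain ⟨D, hD, h⟩ := exists_nat_smul_dual_mem hF hL he.isIntegral
  have hne : {N : ℕ | 0 < N ∧ ∀ v ∈ F.dual L, ∃ m : ℤ, N * F.Q v = m}.Nonempty := by
    refine ⟨D ^ 2, by positivity, fun v hv => ?_⟩
    obtain ⟨m, hm⟩ := he _ (h v hv)
    refine ⟨m, ?_⟩
    rw [← hm, SymForm.Q_zsmul]
    push_cast; rfl
  exact Nat.sInf_mem hne

/-- Polarising N·Q at v, t and v + t gives B(Nv, t) ∈ ℤ for every t ∈ L♯, so Nv lies in the bidual
lattice. -/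
theorem level_smul_dual_mem (hF : F.PosDef) (hL : IsLattice L) (he : F.IsEven L) {v : V}
    (hv : v ∈ F.dual L) : (F.level L : ℤ) • v ∈ L := by
  refine mem_of_dual hF hL fun t ht => ?_
  have h := (level_spec hF hL he).2
  obtain ⟨p, hp⟩ := h v hv
  obtain ⟨q, hq⟩ := h t ht
  obtain ⟨r, hr⟩ := h (v + t) (add_mem hv ht)
  refine ⟨r - p - q, ?_⟩
  rw [SymForm.Q_add] at hr
  rw [SymForm.B_zsmul_left]
  push_cast
  linear_combination hr - hp - hq

end Forms

/-! ### Lattice theta series and their inversion formula. -/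

section LatticeTheta

set_option linter.unusedSectionVars false

open MeasureTheory

variable {V : Type*} [AddCommGroup V] [Module ℝ V] [FiniteDimensional ℝ V]

/-- The exponential `e(τ Q(x) + B(x, z))`. -/
def gaussTerm (F : SymForm V) (τ : ℂ) (z : ℂ ⊗[ℝ] V) (x : V) : ℂ :=
  e (τ * (F.Q x : ℂ) + F.BC (toC x) z)

/-- The series `∑_{l ∈ L} e(τ Q(ρ + l) + B(ρ + l, z))`. -/
def latTheta (F : SymForm V) (L : Submodule ℤ V) (τ : ℂ) (z : ℂ ⊗[ℝ] V) (ρ : V) : ℂ :=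
  ∑' l : L, gaussTerm F τ z (ρ + l)

variable {F : SymForm V} {L : Submodule ℤ V}

/-- The parametrisation of `V` by coordinates. -/
def vec {κ : Type*} [Fintype κ] (b : Module.Basis κ ℝ V) (x : κ → ℝ) : V := b.equivFun.symm x

theorem repr_vec {κ : Type*} [Fintype κ] (b : Module.Basis κ ℝ V) (x : κ → ℝ) (i : κ) :
    b.repr (vec b x) i = x i := by
  have := b.equivFun.apply_symm_apply x
  rw [← Module.Basis.equivFun_apply, vec, this]

theorem vec_add {κ : Type*} [Fintype κ] (b : Module.Basis κ ℝ V) (x y : κ → ℝ) :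
    vec b (x + y) = vec b x + vec b y := map_add _ _ _

theorem vec_repr {κ : Type*} [Fintype κ] (b : Module.Basis κ ℝ V) (v : V) :
    vec b (fun i => b.repr v i) = v := b.equivFun.symm_apply_apply v

theorem vec_eq_sum {κ : Type*} [Fintype κ] (b : Module.Basis κ ℝ V) (x : κ → ℝ) :
    vec b x = ∑ i, x i • b i := b.equivFun_symm_apply x

/-- Integer vectors parametrise the lattice spanned by a basis. -/
def latEquiv {κ : Type*} [Fintype κ] (b : Module.Basis κ ℝ V) :
    (κ → ℤ) ≃ Submodule.span ℤ (Set.range b) :=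
  ((b.restrictScalars ℤ).equivFun.symm).toEquiv

theorem coe_latEquiv {κ : Type*} [Fintype κ] (b : Module.Basis κ ℝ V) (k : κ → ℤ) :
    (latEquiv b k : V) = vec b (intVec k) := by
  rw [vec_eq_sum, latEquiv]
  simp [Module.Basis.equivFun_symm_apply, intVec, Int.cast_smul_eq_zsmul]

theorem norm_BC_le {κ : Type*} [Fintype κ] (b : Module.Basis κ ℝ V) {z : ℂ ⊗[ℝ] V} {A : ℝ}
    (hA : ∀ i, ‖F.BC (toC (b i)) z‖ ≤ A) (v : V) :
    ‖F.BC (toC v) z‖ ≤ A * ∑ i, |b.repr v i| := by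
  have h : F.BC (toC v) z = ∑ i, (b.repr v i : ℂ) * F.BC (toC (b i)) z := by
    conv_lhs => rw [← b.sum_repr v, toC_sum, map_sum]
    simp only [toC_smul, map_smul, LinearMap.smul_apply, LinearMap.sum_apply, smul_eq_mul]
  rw [h, Finset.mul_sum]
  refine (norm_sum_le _ _).trans (Finset.sum_le_sum fun i _ => ?_)
  rw [norm_mul, Complex.norm_real, mul_comm]
  exact mul_le_mul_of_nonneg_right (hA i) (abs_nonneg _)

theorem norm_gaussTerm_le (hF : F.PosDef) {κ : Type*} [Fintype κ] (b : Module.Basis κ ℝ V)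
    {c : ℝ} (hc : ∀ v, c * ∑ i, (b.repr v i) ^ 2 ≤ F.Q v) {y A : ℝ} (hy : 0 < y)
    {τ : ℂ} {z : ℂ ⊗[ℝ] V} (hτ : y ≤ τ.im) (hA : ∀ i, ‖F.BC (toC (b i)) z‖ ≤ A) (v : V) :
    ‖gaussTerm F τ z v‖ ≤ Real.exp (-(2 * Real.pi * y * c) * ∑ i, (b.repr v i) ^ 2 +
      2 * Real.pi * A * ∑ i, |b.repr v i|) := by
  rw [gaussTerm, norm_e]
  refine Real.exp_le_exp.2 ?_
  have h1 := norm_BC_le b hA v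
  have h2 := (abs_le.1 (Complex.abs_im_le_norm (F.BC (toC v) z))).1
  have h3 := mul_le_mul_of_nonneg_right hτ (hF.Q_nonneg v)
  have h4 := mul_le_mul_of_nonneg_left (hc v) hy.le
  have h5 : (τ * (F.Q v : ℂ) + F.BC (toC v) z).im = τ.im * F.Q v + (F.BC (toC v) z).im := by
    simp [Complex.mul_im]
  rw [h5]
  have h6 : y * (c * ∑ i, (b.repr v i) ^ 2) - A * ∑ i, |b.repr v i| ≤
      τ.im * F.Q v + (F.BC (toC v) z).im := by linarith
  have h7 := mul_le_mul_of_nonneg_left h6 Real.two_pi_pos.le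
  linarith

/-- A locally uniform summable bound for the terms of the theta series. -/
theorem exists_gaussTerm_bound (hF : F.PosDef) {κ : Type*} [Fintype κ] (b : Module.Basis κ ℝ V)
    {y A : ℝ} (hy : 0 < y) (hA : 0 ≤ A) (R : ℝ) :
    ∃ u : (κ → ℤ) → ℝ, Summable u ∧ ∀ (τ : ℂ) (z : ℂ ⊗[ℝ] V), y ≤ τ.im →
      (∀ i, ‖F.BC (toC (b i)) z‖ ≤ A) → ∀ k x, (∀ i, |x i| ≤ R) →
        ‖gaussTerm F τ z (vec b (x + intVec k))‖ * Real.exp (∑ i, |(x + intVec k) i|) ≤ u k := by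
  obtain ⟨c, hc0, hc⟩ := hF.exists_Q_ge b
  -- The extra 1 in the linear coefficient pays for the factor exp(∑|x_i|), which later dominates
  -- the derivatives of the exponents.
  obtain ⟨u, hu, hub⟩ := exists_gaussian_bound (ι := κ) (a := 2 * Real.pi * y * c) (by positivity)
    (2 * Real.pi * A + 1) R (by positivity)
  refine ⟨u, hu, fun τ z hτ hz k x hx => (le_trans ?_ (hub k x hx))⟩
  have h := norm_gaussTerm_le hF b hc hy hτ hz (vec b (x + intVec k))
  simp only [repr_vec] at h
  refine (mul_le_mul_of_nonneg_right h (Real.exp_pos _).le).trans ?_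
  rw [← Real.exp_add]
  refine Real.exp_le_exp.2 (le_of_eq ?_)
  ring

theorem exists_bound_BC {κ : Type*} [Fintype κ] (F : SymForm V) (b : Module.Basis κ ℝ V)
    (z : ℂ ⊗[ℝ] V) : ∃ A ≥ 0, ∀ i, ‖F.BC (toC (b i)) z‖ ≤ A :=
  ⟨∑ i, ‖F.BC (toC (b i)) z‖, Finset.sum_nonneg fun _ _ => norm_nonneg _, fun i =>
    Finset.single_le_sum (f := fun i => ‖F.BC (toC (b i)) z‖) (fun _ _ => norm_nonneg _)
      (Finset.mem_univ i)⟩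

theorem exists_bound_repr {κ : Type*} [Fintype κ] (b : Module.Basis κ ℝ V) (v : V) :
    ∃ R, ∀ i, |b.repr v i| ≤ R :=
  ⟨∑ i, |b.repr v i|, fun i =>
    Finset.single_le_sum (f := fun i => |b.repr v i|) (fun _ _ => abs_nonneg _)
      (Finset.mem_univ i)⟩

theorem summable_norm_gaussTerm (hF : F.PosDef) (hL : IsLattice L) {τ : ℂ} (hτ : 0 < τ.im)
    (z : ℂ ⊗[ℝ] V) (ρ : V) : Summable fun l : L => ‖gaussTerm F τ z (ρ + l)‖ := by
  obtain ⟨b, rfl⟩ := hL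
  obtain ⟨A, hA0, hA⟩ := exists_bound_BC F b z
  obtain ⟨R, hR⟩ := exists_bound_repr b ρ
  obtain ⟨u, hu, hub⟩ := exists_gaussTerm_bound hF b hτ hA0 R
  rw [← (latEquiv b).summable_iff]
  refine Summable.of_nonneg_of_le (fun _ => norm_nonneg _) (fun k => ?_) hu
  have h := hub τ z le_rfl hA k (fun i => b.repr ρ i) hR
  rw [vec_add, vec_repr] at h
  simp only [Function.comp, coe_latEquiv]
  refine le_trans ?_ h
  exact le_mul_of_one_le_right (norm_nonneg _)
    (Real.one_le_exp (Finset.sum_nonneg fun _ _ => abs_nonneg _))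

theorem summable_gaussTerm (hF : F.PosDef) (hL : IsLattice L) {τ : ℂ} (hτ : 0 < τ.im)
    (z : ℂ ⊗[ℝ] V) (ρ : V) : Summable fun l : L => gaussTerm F τ z (ρ + l) :=
  (summable_norm_gaussTerm hF hL hτ z ρ).of_norm

theorem gaussTerm_sub_toC (τ : ℂ) (z : ℂ ⊗[ℝ] V) (t x : V) :
    gaussTerm F τ (z - toC t) x = e (-(F.B t x : ℂ)) * gaussTerm F τ z x := by
  rw [gaussTerm, gaussTerm, ← e_add, map_sub, F.BC_toC, F.symm x t]
  ring_nf

/-- This identifies the dual side of Poisson summation with a theta series of L♯ at -1/τ, whence its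
absolute convergence. -/
theorem e_neg_QC_div {τ : ℂ} (z : ℂ ⊗[ℝ] V) (t : V) :
    e (-F.QC (z - toC t) / τ) = e (-F.QC z / τ) * gaussTerm F (-1 / τ) (τ⁻¹ • z) t := by
  rw [gaussTerm, ← e_add, sub_eq_add_neg, ← toC_neg, F.QC_add, F.QC_toC, F.Q_neg, toC_neg,
    map_neg, map_smul, smul_eq_mul, F.BC_symm z]
  congr 1
  ring

theorem im_neg_one_div {τ : ℂ} (hτ : 0 < τ.im) : 0 < (-1 / τ).im := by
  have h : τ ≠ 0 := by rintro rfl; simp at hτ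
  rw [neg_div, one_div, Complex.neg_im, Complex.inv_im, neg_div, neg_neg]
  exact div_pos hτ (Complex.normSq_pos.2 h)

theorem continuous_gaussTerm_vec {κ : Type*} [Fintype κ] (b : Module.Basis κ ℝ V) (τ : ℂ)
    (z : ℂ ⊗[ℝ] V) : Continuous fun x => gaussTerm F τ z (vec b x) := by
  have h1 : ∀ x, (F.Q (vec b x)) = (∑ i, ∑ j, x i * x j * F.B (b i) (b j)) / 2 := by
    intro x
    rw [SymForm.Q, vec_eq_sum]
    simp only [map_sum, map_smul, LinearMap.sum_apply, LinearMap.smul_apply, smul_eq_mul,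
      Finset.mul_sum]
    rw [Finset.sum_comm]
    congr 1
    refine Finset.sum_congr rfl fun i _ => Finset.sum_congr rfl fun j _ => ?_
    ring
  have h2 : ∀ x, F.BC (toC (vec b x)) z = ∑ i, (x i : ℂ) * F.BC (toC (b i)) z := by
    intro x
    rw [vec_eq_sum, toC_sum, map_sum]
    simp only [toC_smul, map_smul, LinearMap.smul_apply, LinearMap.sum_apply, smul_eq_mul]
  simp only [gaussTerm, h1, h2]
  refine continuous_e.comp ?_
  fun_prop

/-- The Gaussian integral, in the coordinates of any basis. -/
theorem exists_integral_gaussTerm (hF : F.PosDef)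
    (b : Module.Basis (Fin (Module.finrank ℝ V)) ℝ V) :
    ∃ C : ℂ, ∀ τ : ℂ, 0 < τ.im → ∀ z, ∫ x, gaussTerm F τ z (vec b x) =
      C * ((-Complex.I * τ) ^ (1 / 2 : ℂ))⁻¹ ^ (Module.finrank ℝ V) * e (-F.QC z / τ) := by
  obtain ⟨o, ho⟩ := hF.exists_orthonormal
  -- `f` passes from orthonormal coordinates to those of `b`. Its determinant is the only trace of
  -- the basis and becomes the constant `C`.
  set f : (Fin (Module.finrank ℝ V) → ℝ) ≃ₗ[ℝ] (Fin (Module.finrank ℝ V) → ℝ) :=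
    o.equivFun.symm.trans b.equivFun with hf
  have hdet : LinearMap.det (f : (Fin (Module.finrank ℝ V) → ℝ) →ₗ[ℝ] _) ≠ 0 :=
    (LinearEquiv.isUnit_det' f).ne_zero
  have hmap := Measure.map_linearMap_addHaar_eq_smul_addHaar
    (volume : Measure (Fin (Module.finrank ℝ V) → ℝ)) hdet
  set r := LinearMap.det (f : (Fin (Module.finrank ℝ V) → ℝ) →ₗ[ℝ] _) with hr
  refine ⟨(|r| : ℝ), fun τ hτ z => ?_⟩
  have hτ0 : τ ≠ 0 := by rintro rfl; simp at hτ
  set g : (Fin (Module.finrank ℝ V) → ℝ) → ℂ := fun x => gaussTerm F τ z (vec b x) with hg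
  have h1 : ∫ x, g (f x) = (|r|⁻¹ : ℝ) • ∫ x, g x := by
    have hfm : Measurable f.toLinearMap :=
      (LinearMap.continuous_of_finiteDimensional _).measurable
    have := integral_map (μ := volume) hfm.aemeasurable (f := g)
      (continuous_gaussTerm_vec b τ z).aestronglyMeasurable
    rw [hmap, integral_smul_measure, abs_inv, ENNReal.toReal_ofReal (by positivity)] at this
    rw [this]; rfl
  have h2 : ∀ x, g (f x) = Complex.exp (-(-Complex.I * τ * Real.pi) * ∑ i, (x i : ℂ) ^ 2 +
      ∑ i, (2 * Real.pi * Complex.I * F.BC (toC (o i)) z) * x i) := by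
    intro x
    have h3 : vec b (f x) = vec o x := by simp [vec, hf]
    rw [hg]
    simp only
    rw [h3, gaussTerm, e, SymForm.Q, SymForm.B_eq_sum_of_orthonormal ho]
    simp only [repr_vec]
    have h4 : F.BC (toC (vec o x)) z = ∑ i, (x i : ℂ) * F.BC (toC (o i)) z := by
      rw [vec_eq_sum, toC_sum, map_sum]
      simp only [toC_smul, map_smul, LinearMap.smul_apply, LinearMap.sum_apply, smul_eq_mul]
    rw [h4]
    congr 1
    push_cast
    rw [mul_add, Finset.mul_sum (a := 2 * (Real.pi : ℂ) * Complex.I)]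
    congr 1
    · simp only [sq]; ring
    · refine Finset.sum_congr rfl fun i _ => ?_
      ring
  have hre : 0 < (-Complex.I * τ * Real.pi).re := by
    simp [Complex.mul_re, Complex.mul_im]; positivity
  have h5 := GaussianFourier.integral_cexp_neg_mul_sum_add hre
    fun i => 2 * Real.pi * Complex.I * F.BC (toC (o i)) z
  simp only [h2] at h1
  rw [h5, Fintype.card_fin] at h1
  have hz : ∑ i, (F.BC (toC (o i)) z) ^ 2 = 2 * F.QC z := by
    have hz1 : ∀ y : ℂ ⊗[ℝ] V, F.BC y z = ∑ i, F.BC (toC (o i)) y * F.BC (toC (o i)) z := by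
      intro y
      induction y with
      | zero => simp
      | add y y' h h' => simp [h, h', add_mul, Finset.sum_add_distrib]
      | tmul a v =>
        have hz2 : (a ⊗ₜ[ℝ] v : ℂ ⊗[ℝ] V) = a • toC v := by
          rw [toC, TensorProduct.smul_tmul']; simp
        have hz3 : toC v = ∑ i, (F.B (o i) v : ℂ) • toC (o i) := by
          conv_lhs => rw [← o.sum_repr v, toC_sum]
          refine Finset.sum_congr rfl fun i _ => ?_
          rw [toC_smul, SymForm.B_eq_sum_of_orthonormal ho]
          simp [Finsupp.single_apply]
        rw [hz2]
        simp only [map_smul, smul_eq_mul, LinearMap.smul_apply, F.BC_toC]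
        conv_lhs => rw [hz3]
        simp only [map_sum, LinearMap.sum_apply, map_smul, LinearMap.smul_apply, smul_eq_mul]
        rw [Finset.mul_sum]
        exact Finset.sum_congr rfl fun i _ => by ring
    rw [SymForm.QC, hz1 z, mul_div_cancel₀ _ two_ne_zero]
    exact Finset.sum_congr rfl fun i _ => sq _
  have h6 : Complex.exp ((∑ i, (2 * Real.pi * Complex.I * F.BC (toC (o i)) z) ^ 2) /
      (4 * (-Complex.I * τ * Real.pi))) = e (-F.QC z / τ) := by
    have : ∀ i, (2 * Real.pi * Complex.I * F.BC (toC (o i)) z) ^ 2 =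
        -4 * Real.pi ^ 2 * (F.BC (toC (o i)) z) ^ 2 := by
      intro i
      rw [mul_pow, mul_pow, Complex.I_sq]; ring
    simp only [this]
    rw [← Finset.mul_sum, hz, e]
    congr 1
    have hpi : (Real.pi : ℂ) ≠ 0 := by exact_mod_cast Real.pi_ne_zero
    have hI := Complex.I_ne_zero
    field_simp
    rw [show (Complex.I ^ 2 : ℂ) = -1 from Complex.I_sq]
    ring
  have h7 : (Real.pi / (-Complex.I * τ * Real.pi)) ^ ((Module.finrank ℝ V : ℂ) / 2) =
      ((-Complex.I * τ) ^ (1 / 2 : ℂ))⁻¹ ^ (Module.finrank ℝ V) := by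
    have hpi : (Real.pi : ℂ) ≠ 0 := by exact_mod_cast Real.pi_ne_zero
    have h8 : (Real.pi / (-Complex.I * τ * Real.pi) : ℂ) = (-Complex.I * τ)⁻¹ := by
      field_simp
    -- -iτ has positive real part, so inversion commutes with the principal square root.
    have h9 : (-Complex.I * τ).arg ≠ Real.pi := by
      intro h
      have := (Complex.arg_eq_pi_iff.1 h).1
      simp [Complex.mul_re] at this
      linarith
    rw [h8, show (Module.finrank ℝ V : ℂ) / 2 = (Module.finrank ℝ V : ℕ) * (1 / 2 : ℂ) by ring,
      Complex.cpow_nat_mul, Complex.inv_cpow _ _ h9]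
  rw [h6, h7] at h1
  have hr0 : ((|r| : ℝ) : ℂ) ≠ 0 := by
    exact_mod_cast abs_ne_zero.2 hdet
  rw [mul_assoc, h1, Complex.real_smul]
  push_cast
  rw [mul_inv_cancel_left₀ (by exact_mod_cast hr0)]

/-- The transformation formula of the theta series under `τ ↦ -1/τ`. -/
theorem exists_latTheta_eq (hF : F.PosDef) (hL : IsLattice L) :
    ∃ C : ℂ, ∀ τ : ℂ, 0 < τ.im → ∀ z ρ, latTheta F L τ z ρ =
      C * ((-Complex.I * τ) ^ (1 / 2 : ℂ))⁻¹ ^ (Module.finrank ℝ V) *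
        ∑' t : F.dual L, e (F.B t ρ : ℂ) * e (-F.QC (z - toC (t : V)) / τ) := by
  have hL' := hL.dual hF
  obtain ⟨b, rfl⟩ := hL
  obtain ⟨b', hb', hd⟩ := exists_dual_basis hF b
  obtain ⟨C, hC⟩ := exists_integral_gaussTerm hF b
  refine ⟨C, fun τ hτ z ρ => ?_⟩
  set f : (Fin (Module.finrank ℝ V) → ℝ) → ℂ := fun x => gaussTerm F τ z (ρ + vec b x) with hf
  set ρ' : Fin (Module.finrank ℝ V) → ℝ := fun i => b.repr ρ i with hρ'
  have hf' : ∀ x, f x = gaussTerm F τ z (vec b (x + ρ')) := by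
    intro x
    rw [hf, vec_add, vec_repr, add_comm]
  have hcont : Continuous f := by
    rw [funext hf']
    exact (continuous_gaussTerm_vec b τ z).comp (continuous_add_const _)
  have hbd : ∀ R : ℝ, ∃ u : (Fin (Module.finrank ℝ V) → ℤ) → ℝ, Summable u ∧
      ∀ k x, (∀ i, |x i| ≤ R) → ‖f (x + intVec k)‖ ≤ u k := by
    intro R
    obtain ⟨A, hA0, hA⟩ := exists_bound_BC F b z
    obtain ⟨R', hR'⟩ := exists_bound_repr b ρ
    obtain ⟨u, hu, hub⟩ := exists_gaussTerm_bound hF b hτ hA0 (R + R')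
    refine ⟨u, hu, fun k x hx => ?_⟩
    have h := hub τ z le_rfl hA k (x + ρ') fun i =>
      (abs_add_le _ _).trans (add_le_add (hx i) (hR' i))
    rw [hf', show x + intVec k + ρ' = x + ρ' + intVec k by abel]
    refine le_trans ?_ h
    exact le_mul_of_one_le_right (norm_nonneg _)
      (Real.one_le_exp (Finset.sum_nonneg fun _ _ => abs_nonneg _))
  have hdot : ∀ (m : Fin (Module.finrank ℝ V) → ℤ) (x : Fin (Module.finrank ℝ V) → ℝ),
      F.B (vec b' (intVec m)) (vec b x) = ∑ i, m i * x i := by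
    intro m x
    rw [vec_eq_sum, vec_eq_sum]
    simp [hb', intVec, mul_comm]
  have hint : ∀ m : Fin (Module.finrank ℝ V) → ℤ,
      ∫ y, e (-∑ i, (m i : ℂ) * (y i : ℂ)) * f y =
      C * ((-Complex.I * τ) ^ (1 / 2 : ℂ))⁻¹ ^ (Module.finrank ℝ V) *
        (e (F.B (vec b' (intVec m)) ρ : ℂ) * e (-F.QC (z - toC (vec b' (intVec m))) / τ)) := by
    intro m
    set t := vec b' (intVec m) with ht
    -- In dual coordinates the Fourier character is y ↦ e(-B(t, y)). It is absorbed into z at the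
    -- price of e(B(t, ρ)), and translation invariance of the integral then removes ρ.
    have h1 : ∀ y, e (-∑ i, (m i : ℂ) * (y i : ℂ)) * f y =
        e (F.B t ρ : ℂ) * gaussTerm F τ (z - toC t) (vec b (y + ρ')) := by
      intro y
      rw [gaussTerm_sub_toC, hf', ← mul_assoc, ← e_add, vec_add, map_add, hρ', vec_repr]
      congr 2
      rw [ht, hdot]
      push_cast
      ring
    simp only [h1]
    rw [integral_const_mul, integral_add_right_eq_self (fun y => gaussTerm F τ (z - toC t) (vec b y)) ρ',
      hC τ hτ]
    ring
  have hre : ∀ g : V → ℂ, (∑' t : F.dual (Submodule.span ℤ (Set.range b)), g t) =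
      ∑' m : Fin (Module.finrank ℝ V) → ℤ, g (vec b' (intVec m)) := by
    intro g
    rw [hd, ← (latEquiv b').tsum_eq]
    simp only [coe_latEquiv]
  have hsum : Summable fun m : Fin (Module.finrank ℝ V) → ℤ =>
      ∫ y, e (-∑ i, (m i : ℂ) * (y i : ℂ)) * f y := by
    simp only [hint]
    refine Summable.mul_left _ ?_
    have h1 := summable_norm_gaussTerm hF hL' (im_neg_one_div hτ) (τ⁻¹ • z) 0
    rw [hd, ← (latEquiv b').summable_iff] at h1
    refine Summable.of_norm ((h1.mul_left ‖e (-F.QC z / τ)‖).congr fun m => ?_)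
    rw [norm_mul, norm_e_ofReal, one_mul, e_neg_QC_div, norm_mul]
    simp only [Function.comp, coe_latEquiv, zero_add]
  have key := tsum_eq_tsum_integral hcont hbd hsum
  rw [latTheta, ← (latEquiv b).tsum_eq]
  simp only [coe_latEquiv]
  rw [hre fun t => e (F.B t ρ : ℂ) * e (-F.QC (z - toC t) / τ), ← tsum_mul_left]
  simp only [← hint]
  exact key

theorem summable_dual_term (hF : F.PosDef) (hL : IsLattice L) {τ : ℂ} (hτ : 0 < τ.im)
    (z : ℂ ⊗[ℝ] V) : Summable fun t : F.dual L => ‖e (-F.QC (z - toC (t : V)) / τ)‖ := by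
  have h1 := summable_norm_gaussTerm hF (hL.dual hF) (im_neg_one_div hτ) (τ⁻¹ • z) 0
  refine (h1.mul_left ‖e (-F.QC z / τ)‖).congr fun t => ?_
  rw [e_neg_QC_div, norm_mul, zero_add]

end LatticeTheta

/-! ### Splitting modulo d and Gauss sums over L/dL. -/

section Split

set_option linter.unusedSectionVars false

variable {V : Type*} [AddCommGroup V] [Module ℝ V] [FiniteDimensional ℝ V]
variable {F : SymForm V} {L : Submodule ℤ V}

/-- The quotient `L / dL`. -/
abbrev LatQuot (L : Submodule ℤ V) (d : ℤ) : Type _ :=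
  L ⧸ LinearMap.range (LinearMap.lsmul ℤ L d)

theorem LatQuot.mk_eq_mk {d : ℤ} {x y : L} :
    (Submodule.Quotient.mk x : LatQuot L d) = Submodule.Quotient.mk y ↔ ∃ l : L, x = y + d • l := by
  rw [Submodule.Quotient.eq, LinearMap.mem_range]
  constructor
  · rintro ⟨l, hl⟩
    exact ⟨l, by rw [LinearMap.lsmul_apply] at hl; rw [hl]; abel⟩
  · rintro ⟨l, hl⟩
    exact ⟨l, by rw [LinearMap.lsmul_apply, hl]; abel⟩

theorem LatQuot.mk_out {d : ℤ} (r : LatQuot L d) :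
    (Submodule.Quotient.mk (Quotient.out r) : LatQuot L d) = r := Quotient.out_eq r

/-- Integer coordinates reduced modulo d; this gives the finiteness of L/dL and its order |d|^n. -/
theorem LatQuot.nonempty_equiv (hL : IsLattice L) (d : ℤ) :
    Nonempty (LatQuot L d ≃ (Fin (Module.finrank ℝ V) → ZMod d.natAbs)) := by
  obtain ⟨b, rfl⟩ := hL
  set B := b.restrictScalars ℤ with hB
  set f : Submodule.span ℤ (Set.range b) →ₗ[ℤ] (Fin (Module.finrank ℝ V) → ZMod d.natAbs) :=
    (LinearMap.pi fun i => (Int.castAddHom (ZMod d.natAbs)).toIntLinearMap ∘ₗ LinearMap.proj i) ∘ₗ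
      B.equivFun.toLinearMap with hf
  have hfa : ∀ x i, f x i = ((B.equivFun x i : ℤ) : ZMod d.natAbs) := fun x i => rfl
  have hs : Function.Surjective f := by
    intro y
    refine ⟨B.equivFun.symm fun i => ((y i).cast : ℤ), ?_⟩
    ext i
    rw [hfa, LinearEquiv.apply_symm_apply]
    simp
  have hk : LinearMap.ker f = LinearMap.range (LinearMap.lsmul ℤ _ d) := by
    ext x
    rw [LinearMap.mem_ker, LinearMap.mem_range]
    constructor
    · intro h
      have h1 : ∀ i, ∃ m : ℤ, B.equivFun x i = d * m := by
        intro i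
        have h2 := congrFun h i
        rw [hfa, Pi.zero_apply, ZMod.intCast_zmod_eq_zero_iff_dvd] at h2
        exact Int.natAbs_dvd.1 h2
      choose m hm using h1
      refine ⟨B.equivFun.symm m, ?_⟩
      rw [LinearMap.lsmul_apply, ← map_smul, LinearEquiv.symm_apply_eq]
      ext i
      simp [← hm]
    · rintro ⟨y, rfl⟩
      ext i
      rw [hfa, LinearMap.lsmul_apply, map_smul]
      simp only [Pi.smul_apply, smul_eq_mul, Pi.zero_apply]
      rw [ZMod.intCast_zmod_eq_zero_iff_dvd]
      exact Dvd.dvd.mul_right (Int.natAbs_dvd.2 dvd_rfl) _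
  rw [LatQuot, ← hk]
  exact ⟨(f.quotKerEquivOfSurjective hs).toEquiv⟩

theorem LatQuot.finite (hL : IsLattice L) {d : ℤ} (hd : d ≠ 0) : Finite (LatQuot L d) := by
  obtain ⟨E⟩ := LatQuot.nonempty_equiv hL d
  have : NeZero d.natAbs := ⟨Int.natAbs_ne_zero.2 hd⟩
  exact Finite.of_equiv _ E.symm

theorem LatQuot.card (hL : IsLattice L) {d : ℤ} (hd : d ≠ 0) :
    Nat.card (LatQuot L d) = d.natAbs ^ Module.finrank ℝ V := by
  obtain ⟨E⟩ := LatQuot.nonempty_equiv hL d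
  have : NeZero d.natAbs := ⟨Int.natAbs_ne_zero.2 hd⟩
  rw [Nat.card_congr E, Nat.card_eq_fintype_card]
  simp [ZMod.card]

theorem zsmul_injective_lattice (hd : (d : ℤ) ≠ 0) {x y : L} (h : d • x = d • y) : x = y := by
  have h1 : (d : ℤ) • (x : V) = d • (y : V) := by
    have := congrArg (fun l : L => (l : V)) h
    simpa using this
  rw [← Int.cast_smul_eq_zsmul ℝ, ← Int.cast_smul_eq_zsmul ℝ] at h1
  exact Subtype.ext (smul_right_injective V (Int.cast_ne_zero.2 hd) h1)

/-- A lattice is the disjoint union of the cosets of `dL`. -/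
def cosetEquiv (L : Submodule ℤ V) {d : ℤ} (hd : d ≠ 0) : LatQuot L d × L ≃ L :=
  Equiv.ofBijective (fun p => Quotient.out p.1 + d • p.2) (by
    constructor
    · rintro ⟨r, l⟩ ⟨r', l'⟩ h
      simp only at h
      have h1 : r = r' := by
        rw [← LatQuot.mk_out r, ← LatQuot.mk_out r', LatQuot.mk_eq_mk]
        refine ⟨l' - l, ?_⟩
        rw [smul_sub, ← add_sub_assoc, ← h]; abel
      subst h1
      rw [add_right_inj] at h
      rw [zsmul_injective_lattice hd h]
    · intro x
      obtain ⟨l, hl⟩ := LatQuot.mk_eq_mk.1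
        (LatQuot.mk_out (Submodule.Quotient.mk x : LatQuot L d)).symm
      exact ⟨(Submodule.Quotient.mk x, l), hl.symm⟩)

theorem tsum_eq_sum_cosets {d : ℤ} (hd : d ≠ 0) [Fintype (LatQuot L d)] {f : L → ℂ}
    (hf : Summable f) :
    ∑' l, f l = ∑ r : LatQuot L d, ∑' l : L, f (Quotient.out r + d • l) := by
  rw [← (cosetEquiv L hd).tsum_eq]
  have h : Summable fun p => f (cosetEquiv L hd p) := (cosetEquiv L hd).summable_iff.2 hf
  rw [h.tsum_prod, tsum_fintype]
  rfl

/-- Periodicity makes the value independent of the representative, and translation by s permutes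
L/dL. -/
theorem sum_quot_shift {d : ℤ} [Fintype (LatQuot L d)] {f : L → ℂ}
    (hf : ∀ x l : L, f (x + d • l) = f x) (s : L) :
    ∑ r : LatQuot L d, f (Quotient.out r + s) = ∑ r : LatQuot L d, f (Quotient.out r) := by
  have hmk : ∀ x y : L, (Submodule.Quotient.mk x : LatQuot L d) = Submodule.Quotient.mk y →
      f x = f y := by
    intro x y h
    obtain ⟨l, rfl⟩ := LatQuot.mk_eq_mk.1 h
    exact hf y l
  refine Eq.trans ?_ (Equiv.sum_comp (Equiv.addRight (Submodule.Quotient.mk s : LatQuot L d))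
    fun r => f (Quotient.out r))
  refine Finset.sum_congr rfl fun r _ => hmk _ _ ?_
  rw [LatQuot.mk_out, Submodule.Quotient.mk_add, LatQuot.mk_out]
  rfl

theorem IsEven.B_int (he : F.IsEven L) (v w : L) : ∃ m : ℤ, F.B v w = m :=
  he.isIntegral v v.2 w w.2

theorem gauss_periodic (he : F.IsEven L) (b : ℤ) {d : ℤ} (hd : d ≠ 0) (x l : L) :
    e ((b : ℂ) * (F.Q ((x + d • l : L) : V) : ℂ) / d) = e ((b : ℂ) * (F.Q (x : V) : ℂ) / d) := by
  obtain ⟨m, hm⟩ := IsEven.B_int he x l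
  obtain ⟨q, hq⟩ := he l l.2
  refine e_eq_of_sub (b * m + b * d * q) ?_
  have hd' : (d : ℂ) ≠ 0 := Int.cast_ne_zero.2 hd
  rw [Submodule.coe_add, Submodule.coe_smul, F.Q_add, F.Q_zsmul, F.B_zsmul_right, hm, hq]
  push_cast
  field_simp
  ring

/-- Since bc ≡ -1 mod d and both B(t,r) and cQ(t) are integers, bQ(r - ct) ≡ bQ(r) + B(t,r) - cQ(t)
mod d. As ct ∈ L, the substitution r ↦ r - ct permutes the classes, so the sum does not depend on t.
-/
theorem sum_gauss_complete_square (he : F.IsEven L) {a b c d : ℤ} (hdet : a * d - b * c = 1)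
    (hd : d ≠ 0) [Fintype (LatQuot L d)] {t : V} (ht : t ∈ F.dual L) (hct : c • t ∈ L)
    (hcQ : ∃ m : ℤ, c * F.Q t = m) :
    ∑ r : LatQuot L d, e (((b : ℂ) * (F.Q (Quotient.out r : L) : ℂ) +
      (F.B t (Quotient.out r : L) : ℂ) - c * (F.Q t : ℂ)) / d) =
    ∑ r : LatQuot L d, e ((b : ℂ) * (F.Q (Quotient.out r : L) : ℂ) / d) := by
  rw [← sum_quot_shift (f := fun x : L => e ((b : ℂ) * (F.Q (x : V) : ℂ) / d))
    (gauss_periodic he b hd) (-⟨c • t, hct⟩)]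
  refine Finset.sum_congr rfl fun r _ => ?_
  obtain ⟨m, hm⟩ := hcQ
  obtain ⟨p, hp⟩ := ht _ (Quotient.out r : L).2
  refine e_eq_of_sub (a * (p - m)) ?_
  have hd' : (d : ℂ) ≠ 0 := Int.cast_ne_zero.2 hd
  have hdet' : (a : ℂ) * d - b * c = 1 := by exact_mod_cast hdet
  have hm' : (c : ℂ) * (F.Q t : ℂ) = m := by exact_mod_cast hm
  rw [Submodule.coe_add, Submodule.coe_neg, ← sub_eq_add_neg, F.Q_sub, F.Q_zsmul,
    F.B_zsmul_right, F.symm _ t, hp]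
  push_cast
  rw [← hm']
  field_simp
  linear_combination (-(p : ℂ) + c * (F.Q t : ℂ)) * hdet'

theorem latTheta_add_mem (τ : ℂ) (z : ℂ ⊗[ℝ] V) (ρ : V) {l : V} (hl : l ∈ L) :
    latTheta F L τ z (ρ + l) = latTheta F L τ z ρ := by
  rw [latTheta, latTheta, ← (Equiv.addLeft (⟨l, hl⟩ : L)).tsum_eq fun x : L => gaussTerm F τ z (ρ + x)]
  refine tsum_congr fun x => ?_
  simp [add_assoc]

theorem thetaTerm_eq (α β : V) (τ : ℍ) (z : ℂ ⊗[ℝ] V) (l : V) :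
    thetaTerm F α β τ z l = e (-(F.B β α : ℂ)) * gaussTerm F τ (z + toC β) (α + l) := by
  rw [thetaTerm, gaussTerm, ← e_add, ← e_add, map_add (F.BC (toC (α + l))), F.BC_toC,
    F.symm (α + l), map_add (F.B β)]
  congr 1
  push_cast
  ring

theorem theta_eq (α β : V) (τ : ℍ) (z : ℂ ⊗[ℝ] V) :
    theta F L α β τ z = e (-(F.B β α : ℂ)) * latTheta F L τ (z + toC β) α := by
  rw [theta, latTheta, ← tsum_mul_left]
  exact tsum_congr fun l => thetaTerm_eq α β τ z l

theorem summable_thetaTerm (hF : F.PosDef) (hL : IsLattice L) (α β : V) (τ : ℍ)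
    (z : ℂ ⊗[ℝ] V) : Summable fun l : L => thetaTerm F α β τ z l := by
  simp only [thetaTerm_eq]
  exact (summable_gaussTerm hF hL τ.im_pos _ _).mul_left _

/-- The splitting of a theta series at `τ' = b/d + τ₁/d²` into classes modulo `d`. -/
theorem latTheta_split (hF : F.PosDef) (hL : IsLattice L) (he : F.IsEven L) {b d : ℤ} (hd : d ≠ 0)
    [Fintype (LatQuot L d)] {α : V} (hα : ∀ l ∈ L, ∃ m : ℤ, b * d * F.B α l = m)
    {τ' τ₁ : ℂ} (hτ' : 0 < τ'.im) (h : (d : ℂ) ^ 2 * τ' = b * d + τ₁) (y : ℂ ⊗[ℝ] V) :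
    latTheta F L τ' y (d • α) = ∑ r : LatQuot L d,
      e (b * d * (F.Q α : ℂ) + b * (F.B α (Quotient.out r : L) : ℂ) +
        (b : ℂ) * (F.Q (Quotient.out r : L) : ℂ) / d) *
        latTheta F L τ₁ ((d : ℂ) • y) (α + (d : ℝ)⁻¹ • ((Quotient.out r : L) : V)) := by
  rw [latTheta, tsum_eq_sum_cosets hd (summable_gaussTerm hF hL hτ' y (d • α))]
  refine Finset.sum_congr rfl fun r _ => ?_
  rw [latTheta, ← tsum_mul_left]
  refine tsum_congr fun l => ?_
  set ro : L := Quotient.out r with hro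
  obtain ⟨p, hp⟩ := hα l l.2
  obtain ⟨m, hm⟩ := IsEven.B_int he ro l
  obtain ⟨q, hq⟩ := he l l.2
  have hdR : (d : ℝ) ≠ 0 := Int.cast_ne_zero.2 hd
  have hd' : (d : ℂ) ≠ 0 := Int.cast_ne_zero.2 hd
  -- The summation point is dx, so τ'Q(dx) = (bd + τ₁)Q(x), and bdQ(x) depends modulo ℤ only on the
  -- coset.
  set x : V := α + (d : ℝ)⁻¹ • (ro : V) + l with hx
  have hdx : d • α + ((ro + d • l : L) : V) = d • x := by
    rw [hx, Submodule.coe_add, Submodule.coe_smul, ← Int.cast_smul_eq_zsmul ℝ d x, smul_add,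
      smul_add, smul_inv_smul₀ hdR, Int.cast_smul_eq_zsmul, Int.cast_smul_eq_zsmul]
    abel
  rw [hdx, gaussTerm, gaussTerm, ← e_add, F.Q_zsmul, toC_zsmul]
  refine e_eq_of_sub (p + b * m + b * d * q) ?_
  have hQ : F.Q x = F.Q α + F.B α ro / d + F.B α l + (F.Q ro / d ^ 2 + m / d + q) := by
    rw [hx, add_assoc, F.Q_add α, F.Q_add, F.Q_smul, hq, map_smul, LinearMap.smul_apply, hm,
      map_add, map_smul]
    simp only [smul_eq_mul]
    field_simp
    ring
  have hp' : (b : ℂ) * d * (F.B α l : ℂ) = p := by exact_mod_cast hp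
  rw [map_smul, map_smul, LinearMap.smul_apply]
  have h2 : (((d : ℝ) ^ 2 * F.Q x : ℝ) : ℂ) * τ' = (b * d + τ₁) * (F.Q x : ℂ) := by
    push_cast; rw [← h]; ring
  have h3 : (b : ℂ) * d * (F.Q x : ℂ) = b * d * F.Q α + b * F.B α ro + p + b * F.Q ro / d +
      b * m + b * d * q := by
    rw [hQ, ← hp']
    push_cast
    field_simp
    ring
  push_cast at h2 ⊢
  linear_combination h2 + h3

end Split

/-! ### Branches of square roots. -/

section SquareRoots

open Complex

theorem cpow_half_sq (x : ℂ) : (x ^ (1 / 2 : ℂ)) ^ 2 = x := by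
  rw [← Complex.cpow_nat_mul]; norm_num

theorem cpow_half_ne_zero {x : ℂ} (hx : x ≠ 0) : x ^ (1 / 2 : ℂ) ≠ 0 := fun h =>
  hx (by rw [← cpow_half_sq x, h]; simp)

theorem log_mul_half_im (x : ℂ) : (Complex.log x * (1 / 2)).im = Complex.arg x / 2 := by
  have : (1 / 2 : ℂ) = ((1 / 2 : ℝ) : ℂ) := by push_cast; rfl
  rw [this, Complex.im_mul_ofReal, Complex.log_im]; ring

theorem cpow_half_re_nonneg (x : ℂ) : 0 ≤ (x ^ (1 / 2 : ℂ)).re := by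
  by_cases hx : x = 0
  · simp [hx]
  rw [Complex.cpow_def_of_ne_zero hx, Complex.exp_re, log_mul_half_im]
  have h1 := Complex.neg_pi_lt_arg x
  have h2 := Complex.arg_le_pi x
  exact mul_nonneg (Real.exp_pos _).le (Real.cos_nonneg_of_mem_Icc ⟨by linarith, by linarith⟩)

theorem cpow_half_im_nonneg {x : ℂ} (h : 0 ≤ x.im) : 0 ≤ (x ^ (1 / 2 : ℂ)).im := by
  by_cases hx : x = 0
  · simp [hx]
  rw [Complex.cpow_def_of_ne_zero hx, Complex.exp_im, log_mul_half_im]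
  have h1 := Complex.arg_nonneg_iff.2 h
  have h2 := Complex.arg_le_pi x
  exact mul_nonneg (Real.exp_pos _).le (Real.sin_nonneg_of_nonneg_of_le_pi (by linarith)
    (by linarith [Real.pi_pos]))

theorem cpow_half_im_nonpos {x : ℂ} (h : x.im < 0) : (x ^ (1 / 2 : ℂ)).im ≤ 0 := by
  by_cases hx : x = 0
  · simp [hx]
  rw [Complex.cpow_def_of_ne_zero hx, Complex.exp_im, log_mul_half_im]
  have h1 := Complex.arg_neg_iff.2 h
  have h2 := Complex.neg_pi_lt_arg x
  exact mul_nonpos_of_nonneg_of_nonpos (Real.exp_pos _).le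
    (Real.sin_nonpos_of_nonpos_of_neg_pi_le (by linarith) (by linarith [Real.pi_pos]))

/-- If w² has positive real part then (Re w)² > (Im w)², and the principal root has Re w ≥ 0. -/
theorem cpow_half_sector {x : ℂ} (h : 0 < x.re) :
    |(x ^ (1 / 2 : ℂ)).im| < (x ^ (1 / 2 : ℂ)).re := by
  have h1 := congrArg Complex.re (cpow_half_sq x)
  rw [sq, Complex.mul_re] at h1
  exact abs_lt_of_sq_lt_sq (by nlinarith) (cpow_half_re_nonneg x)

/-- The square root `|d|^(-1/2) (-i)^((1 - sgn d) s(c) / 2)` of `1 / d`. -/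
def rootFactor (c d : ℤ) : ℂ :=
  ((|(d : ℝ)| ^ (-(1 / 2) : ℝ) : ℝ) : ℂ) * (-I) ^ ((1 - d.sign) / 2 * signSymbol c)

theorem abs_rpow_neg_half_sq {d : ℤ} :
    (|(d : ℝ)| ^ (-(1 / 2) : ℝ)) ^ 2 = |(d : ℝ)|⁻¹ := by
  rw [← Real.rpow_natCast, ← Real.rpow_mul (abs_nonneg _)]
  norm_num
  rw [Real.rpow_neg_one]

theorem rootFactor_of_pos {c d : ℤ} (hd : 0 < d) :
    rootFactor c d = ((|(d : ℝ)| ^ (-(1 / 2) : ℝ) : ℝ) : ℂ) := by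
  rw [rootFactor, Int.sign_eq_one_of_pos hd]; simp

theorem rootFactor_of_neg {c d : ℤ} (hd : d < 0) (hc : 0 ≤ c) :
    rootFactor c d = ((|(d : ℝ)| ^ (-(1 / 2) : ℝ) : ℝ) : ℂ) * -I := by
  rw [rootFactor, Int.sign_eq_neg_one_of_neg hd, signSymbol, if_neg (not_lt.2 hc)]; norm_num

theorem rootFactor_of_neg' {c d : ℤ} (hd : d < 0) (hc : c < 0) :
    rootFactor c d = ((|(d : ℝ)| ^ (-(1 / 2) : ℝ) : ℝ) : ℂ) * I := by
  rw [rootFactor, Int.sign_eq_neg_one_of_neg hd, signSymbol, if_pos hc]; norm_num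

theorem rootFactor_sq {c d : ℤ} (hd : d ≠ 0) : rootFactor c d ^ 2 = (d : ℂ)⁻¹ := by
  have h := congrArg (fun r : ℝ => (r : ℂ)) (abs_rpow_neg_half_sq (d := d))
  rw [Complex.ofReal_pow] at h
  rcases lt_or_gt_of_ne hd with hd | hd
  · have h1 : |(d : ℝ)| = -d := abs_of_neg (by exact_mod_cast hd)
    have h2 : (((-(d : ℝ))⁻¹ : ℝ) : ℂ) = -(d : ℂ)⁻¹ := by push_cast; rw [inv_neg]
    rcases le_or_gt 0 c with hc | hc
    · rw [rootFactor_of_neg hd hc, mul_pow, h, h1, neg_sq, I_sq, h2]; ring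
    · rw [rootFactor_of_neg' hd hc, mul_pow, h, h1, I_sq, h2]; ring
  · rw [rootFactor_of_pos hd, h, abs_of_pos (by exact_mod_cast hd)]; push_cast; rfl

/-- The comparison of the square roots of `-iτ`, `-iτ₁` and `cτ + d`, for `τ₁ = dτ / (cτ + d)`. -/
theorem sqrt_quotient {c d : ℤ} (hd : d ≠ 0) {τ : ℂ} (hτ : 0 < τ.im)
    (hJ : (c : ℂ) * τ + d ≠ 0) (hτ₁ : 0 < ((d : ℂ) * τ / (c * τ + d)).im) :
    (-I * τ) ^ (1 / 2 : ℂ) * ((-I * ((d : ℂ) * τ / (c * τ + d))) ^ (1 / 2 : ℂ))⁻¹ =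
      rootFactor c d * ((c : ℂ) * τ + d) ^ (1 / 2 : ℂ) := by
  set J := (c : ℂ) * τ + d with hJdef
  set τ₁ := (d : ℂ) * τ / J with hτ₁def
  have hτ0 : τ ≠ 0 := by rintro rfl; simp at hτ
  have hτ₁0 : τ₁ ≠ 0 := by intro h; rw [h] at hτ₁; simp at hτ₁
  have hd' : (d : ℂ) ≠ 0 := Int.cast_ne_zero.2 hd
  have hA := cpow_half_sector (x := -I * τ) (by simpa using hτ)
  have hB := cpow_half_sector (x := -I * τ₁) (by simpa using hτ₁)
  have hB0 : (-I * τ₁) ^ (1 / 2 : ℂ) ≠ 0 := cpow_half_ne_zero (by simp [hτ₁0])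
  -- The two sides agree up to sign; the signs of their real parts settle which.
  have hsq : ((-I * τ) ^ (1 / 2 : ℂ) * ((-I * τ₁) ^ (1 / 2 : ℂ))⁻¹) ^ 2 =
      (rootFactor c d * J ^ (1 / 2 : ℂ)) ^ 2 := by
    rw [mul_pow, inv_pow, mul_pow, cpow_half_sq, cpow_half_sq, cpow_half_sq, rootFactor_sq hd,
      hτ₁def]
    field_simp
  -- Both roots lie in the open sector |arg| < π/4, so their quotient lies in the right half-plane.
  have hpos : 0 < ((-I * τ) ^ (1 / 2 : ℂ) * ((-I * τ₁) ^ (1 / 2 : ℂ))⁻¹).re := by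
    set A := (-I * τ) ^ (1 / 2 : ℂ)
    set B := (-I * τ₁) ^ (1 / 2 : ℂ)
    rw [Complex.inv_def, ← mul_assoc, Complex.re_mul_ofReal]
    refine mul_pos ?_ (inv_pos.2 (Complex.normSq_pos.2 hB0))
    rw [Complex.mul_re, Complex.conj_re, Complex.conj_im]
    have h1 : |A.im| * |B.im| < A.re * B.re :=
      mul_lt_mul'' hA hB (abs_nonneg _) (abs_nonneg _)
    rw [← abs_mul] at h1
    have := (abs_lt.1 h1).1
    linarith
  -- For d < 0 the imaginary part of √(cτ+d) has the sign s(c), up to vanishing, and the factor ∓i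
  -- turns it into a nonnegative real part. The value s(0) = 1 fits because the principal root of a
  -- negative number lies on the positive imaginary axis.
  have hnn : 0 ≤ (rootFactor c d * J ^ (1 / 2 : ℂ)).re := by
    have hr : 0 ≤ |(d : ℝ)| ^ (-(1 / 2) : ℝ) := Real.rpow_nonneg (abs_nonneg _) _
    have hJim : J.im = c * τ.im := by simp [hJdef]
    rcases lt_or_gt_of_ne hd with hd | hd
    · rcases le_or_gt 0 c with hc | hc
      · rw [rootFactor_of_neg hd hc, mul_assoc, Complex.re_ofReal_mul]
        refine mul_nonneg hr ?_
        have := cpow_half_im_nonneg (x := J) (by rw [hJim]; exact mul_nonneg (by exact_mod_cast hc) hτ.le)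
        simpa using this
      · rw [rootFactor_of_neg' hd hc, mul_assoc, Complex.re_ofReal_mul]
        refine mul_nonneg hr ?_
        have := cpow_half_im_nonpos (x := J)
          (by rw [hJim]; exact mul_neg_of_neg_of_pos (by exact_mod_cast hc) hτ)
        simpa using this
    · rw [rootFactor_of_pos hd, Complex.re_ofReal_mul]
      exact mul_nonneg hr (cpow_half_re_nonneg _)
  rcases sq_eq_sq_iff_eq_or_eq_neg.1 hsq with h | h
  · exact h
  · rw [h, Complex.neg_re] at hpos
    linarith

end SquareRoots

/-! ### The transformation law under matrices with d ≠ 0. -/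

section Transformation

set_option linter.unusedSectionVars false

variable {V : Type*} [AddCommGroup V] [Module ℝ V] [FiniteDimensional ℝ V]
variable {F : SymForm V} {L : Submodule ℤ V}

/-- The bookkeeping behind -1/τ₁ = -1/τ - c/d. The leftover `q + c * p` is an integer where the
identity is applied. -/
theorem dual_exponent_identity {b c d τ J q x y Qr Qz Qu Qt Qβ w p : ℂ} (hd : d ≠ 0) (hτ : τ ≠ 0)
    (hJ : J = c * τ + d) (hJ0 : J ≠ 0) (h : Qu = d ^ 2 * Qβ - d * p + Qt) :
    b * Qr / d + (x + q + d⁻¹ * y + -((d / J) ^ 2 * Qz + Qu + d / J * w) / (d * τ / J)) -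
      ((b * Qr + y - c * Qt) / d + (-(c * d * Qβ) + c / J * Qz +
        (x + -(Qz + Qu + w) / τ))) = q + c * p := by
  have h' : Qt = Qu - d ^ 2 * Qβ + d * p := by rw [h]; ring
  rw [h']
  field_simp
  rw [hJ]
  ring

/-- Poisson summation is used at τ₁ for each class modulo d and once more at τ in reverse; in
between, the sum over classes is a Gauss sum independent of the dual variable. The hypotheses on c
and d are those that membership in Γ₁(N) provides. -/
theorem latTheta_transform (hF : F.PosDef) (hL : IsLattice L) (he : F.IsEven L) {a b c d : ℤ}
    (hdet : a * d - b * c = 1) (hd : d ≠ 0) [Fintype (LatQuot L d)] {α β : V}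
    (hα : α ∈ F.dual L) (hdα : (d - 1) • α ∈ L) (hdβ : (d - 1) • β ∈ L) (hcβ : c • β ∈ L)
    (hcL : ∀ t ∈ F.dual L, c • t ∈ L) (hcQ : ∀ t ∈ F.dual L, ∃ m : ℤ, c * F.Q t = m)
    {τ : ℂ} (hτ : 0 < τ.im) (hJ : (c : ℂ) * τ + d ≠ 0)
    (hτ' : 0 < (((a : ℂ) * τ + b) / (c * τ + d)).im) (z : ℂ ⊗[ℝ] V) :
    e (-((c : ℂ) / (c * τ + d)) * F.QC z) *
      latTheta F L (((a : ℂ) * τ + b) / (c * τ + d)) (((c : ℂ) * τ + d)⁻¹ • z + toC β) α =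
    (rootFactor c d * ((c : ℂ) * τ + d) ^ (1 / 2 : ℂ)) ^ Module.finrank ℝ V *
      (∑ r : LatQuot L d, e ((b : ℂ) * (F.Q (Quotient.out r : L) : ℂ) / d)) *
      e (b * d * (F.Q α : ℂ) - c * d * (F.Q β : ℂ)) * latTheta F L τ (z + toC β) α := by
  set J := (c : ℂ) * τ + d with hJdef
  set τ' := ((a : ℂ) * τ + b) / J with hτ'def
  set τ₁ := (d : ℂ) * τ / J with hτ₁def
  have hd' : (d : ℂ) ≠ 0 := Int.cast_ne_zero.2 hd
  have hτ0 : τ ≠ 0 := by rintro rfl; simp at hτ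
  have hdet' : (a : ℂ) * d - b * c = 1 := by exact_mod_cast hdet
  have h1 : (d : ℂ) ^ 2 * τ' = b * d + τ₁ := by
    rw [hτ'def, hτ₁def]
    field_simp
    rw [hJdef]
    linear_combination τ * hdet'
  have hτ₁ : 0 < τ₁.im := by
    have h2 : τ₁ = ((d ^ 2 : ℤ) : ℝ) * τ' - ((b * d : ℤ) : ℝ) := by push_cast; rw [h1]; ring
    rw [h2, Complex.sub_im, Complex.im_ofReal_mul, Complex.ofReal_im, sub_zero]
    exact mul_pos (by exact_mod_cast pow_pos (abs_pos.2 hd) 2 |>.trans_le (sq_abs d).le) hτ'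
  obtain ⟨C, hC⟩ := exists_latTheta_eq hF hL
  set s := (-Complex.I * τ) ^ (1 / 2 : ℂ) with hs
  set s₁ := (-Complex.I * τ₁) ^ (1 / 2 : ℂ) with hs₁
  have hs0 : s ≠ 0 := cpow_half_ne_zero (by simp [hτ0])
  have hquot : s * s₁⁻¹ = rootFactor c d * J ^ (1 / 2 : ℂ) := sqrt_quotient hd hτ hJ hτ₁
  set y := J⁻¹ • z + toC β with hy
  set n := Module.finrank ℝ V
  have hβ' : (d - 1) • β ∈ F.dual L := le_dual he.isIntegral hdβ
  -- The dual variable is shifted by (d-1)β ∈ L so that dβ - t' = β - t, which is the vector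
  -- occurring in the dual series at τ.
  have hterm : ∀ (t : F.dual L) (r : LatQuot L d),
      e ((b : ℂ) * (F.Q (Quotient.out r : L) : ℂ) / d) *
        (e (F.B ((t : V) + (d - 1) • β) (α + (d : ℝ)⁻¹ • ((Quotient.out r : L) : V)) : ℂ) *
          e (-F.QC ((d : ℂ) • y - toC ((t : V) + (d - 1) • β)) / τ₁)) =
      e (((b : ℂ) * (F.Q (Quotient.out r : L) : ℂ) +
      (F.B ((t : V) + (d - 1) • β) (Quotient.out r : L) : ℂ) -
        c * (F.Q ((t : V) + (d - 1) • β) : ℂ)) / d) *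
      (e (-(c * d * (F.Q β : ℂ))) * e ((c / J) * F.QC z) *
        (e (F.B t α : ℂ) * e (-F.QC (z + toC β - toC (t : V)) / τ))) := by
    intro t r
    set ro : L := Quotient.out r
    set t' : V := (t : V) + (d - 1) • β with ht'
    have ht'm : t' ∈ F.dual L := add_mem t.2 hβ'
    set u : V := β - t with hu
    have hu' : d • β - t' = u := by rw [ht', hu, sub_smul, one_smul]; abel
    obtain ⟨p, hp⟩ := ht'm _ hcβ
    obtain ⟨q, hq⟩ := hα _ hdβ
    have e1 : (d : ℂ) • y - toC t' = ((d : ℂ) / J) • z + toC u := by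
      rw [hy, smul_add, smul_smul, ← div_eq_mul_inv, ← toC_zsmul, add_sub_assoc, ← toC_sub, hu']
    have e2 : z + toC β - toC (t : V) = z + toC u := by rw [hu, toC_sub, add_sub_assoc]
    have e3 : F.Q u = d ^ 2 * F.Q β - d * F.B t' β + F.Q t' := by
      rw [← hu', F.Q_sub, F.Q_zsmul, F.B_zsmul_left, F.symm β]; ring
    have e4 : F.B t' α = F.B t α + q := by
      rw [ht', map_add, LinearMap.add_apply, ← hq, F.symm α]
    rw [e1, e2, ← e_add, ← e_add, ← e_add, ← e_add, ← e_add, ← e_add]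
    refine e_eq_of_sub (q + p) ?_
    rw [F.QC_add, F.QC_add, F.QC_smul, F.QC_toC, map_smul, LinearMap.smul_apply, smul_eq_mul,
      map_add (F.B t'), e4, map_smul]
    have hp' : (c : ℂ) * (F.B t' β : ℂ) = p := by
      rw [F.B_zsmul_right] at hp
      exact_mod_cast hp
    have e3' : (F.Q u : ℂ) = d ^ 2 * F.Q β - d * F.B t' β + F.Q t' := by exact_mod_cast e3
    simp only [smul_eq_mul]
    push_cast
    rw [← hp', hτ₁def]
    exact dual_exponent_identity hd' hτ0 hJdef hJ e3'
  have hgauss : ∀ t : F.dual L, ∑ r : LatQuot L d,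
      e (((b : ℂ) * (F.Q (Quotient.out r : L) : ℂ) +
      (F.B ((t : V) + (d - 1) • β) (Quotient.out r : L) : ℂ) -
        c * (F.Q ((t : V) + (d - 1) • β) : ℂ)) / d) =
      ∑ r : LatQuot L d, e ((b : ℂ) * (F.Q (Quotient.out r : L) : ℂ) / d) := by
    intro t
    have ht'm : (t : V) + (d - 1) • β ∈ F.dual L := add_mem t.2 hβ'
    exact sum_gauss_complete_square he hdet hd ht'm (hcL _ ht'm) (hcQ _ ht'm)
  set G := ∑ r : LatQuot L d, e ((b : ℂ) * (F.Q (Quotient.out r : L) : ℂ) / d) with hG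
  have hsum : ∀ r : LatQuot L d, Summable fun t : F.dual L =>
      e ((b : ℂ) * (F.Q (Quotient.out r : L) : ℂ) / d) *
        (e (F.B ((t : V) + (d - 1) • β) (α + (d : ℝ)⁻¹ • ((Quotient.out r : L) : V)) : ℂ) *
          e (-F.QC ((d : ℂ) • y - toC ((t : V) + (d - 1) • β)) / τ₁)) := by
    intro r
    refine Summable.mul_left _ (Summable.of_norm ?_)
    have h2 := (Equiv.addRight (⟨(d - 1) • β, hβ'⟩ : F.dual L)).summable_iff.2
      (summable_dual_term hF hL hτ₁ ((d : ℂ) • y))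
    refine h2.congr fun t => ?_
    rw [norm_mul, norm_e_ofReal, one_mul]
    rfl
  have hαd : latTheta F L τ' y α = latTheta F L τ' y (d • α) := by
    rw [← latTheta_add_mem τ' y α hdα]
    congr 1
    rw [sub_smul, one_smul]; abel
  rw [hαd, latTheta_split hF hL he hd (fun l hl => by
    obtain ⟨m, hm⟩ := hα l hl
    exact ⟨b * d * m, by rw [hm]; push_cast; rfl⟩) hτ' h1 y]
  -- B(α, r) is an integer, so the mixed term of the phase disappears.
  have hph : ∀ r : LatQuot L d, e (b * d * (F.Q α : ℂ) + b * (F.B α (Quotient.out r : L) : ℂ) +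
      (b : ℂ) * (F.Q (Quotient.out r : L) : ℂ) / d) =
      e (b * d * (F.Q α : ℂ)) * e ((b : ℂ) * (F.Q (Quotient.out r : L) : ℂ) / d) := by
    intro r
    obtain ⟨m, hm⟩ := hα _ (Quotient.out r : L).2
    rw [← e_add]
    refine e_eq_of_sub (b * m) ?_
    rw [hm]
    push_cast
    ring
  simp only [hph, mul_assoc (e (b * d * (F.Q α : ℂ)))]
  rw [← Finset.mul_sum]
  have hshift : ∀ r : LatQuot L d,
      latTheta F L τ₁ ((d : ℂ) • y) (α + (d : ℝ)⁻¹ • ((Quotient.out r : L) : V)) =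
      C * s₁⁻¹ ^ n * ∑' t : F.dual L,
        (e (F.B ((t : V) + (d - 1) • β) (α + (d : ℝ)⁻¹ • ((Quotient.out r : L) : V)) : ℂ) *
          e (-F.QC ((d : ℂ) • y - toC ((t : V) + (d - 1) • β)) / τ₁)) := by
    intro r
    rw [hC τ₁ hτ₁]
    congr 1
    exact ((Equiv.addRight (⟨(d - 1) • β, hβ'⟩ : F.dual L)).tsum_eq fun t : F.dual L =>
      e (F.B (t : V) (α + (d : ℝ)⁻¹ • ((Quotient.out r : L) : V)) : ℂ) *
        e (-F.QC ((d : ℂ) • y - toC (t : V)) / τ₁)).symm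
  have hmain : ∑ r : LatQuot L d, e ((b : ℂ) * (F.Q (Quotient.out r : L) : ℂ) / d) *
        latTheta F L τ₁ ((d : ℂ) • y) (α + (d : ℝ)⁻¹ • ((Quotient.out r : L) : V)) =
      s₁⁻¹ ^ n * G * e (-(c * d * (F.Q β : ℂ))) * e ((c / J) * F.QC z) *
        (s ^ n * latTheta F L τ (z + toC β) α) := by
    calc _ = C * s₁⁻¹ ^ n * ∑ r : LatQuot L d, ∑' t : F.dual L,
        (e ((b : ℂ) * (F.Q (Quotient.out r : L) : ℂ) / d) *
        (e (F.B ((t : V) + (d - 1) • β) (α + (d : ℝ)⁻¹ • ((Quotient.out r : L) : V)) : ℂ) *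
          e (-F.QC ((d : ℂ) • y - toC ((t : V) + (d - 1) • β)) / τ₁))) := by
          rw [Finset.mul_sum]
          refine Finset.sum_congr rfl fun r _ => ?_
          rw [hshift, tsum_mul_left]; ring
      _ = C * s₁⁻¹ ^ n * (G * (e (-(c * d * (F.Q β : ℂ))) * e ((c / J) * F.QC z) *
          ∑' t : F.dual L, (e (F.B t α : ℂ) * e (-F.QC (z + toC β - toC (t : V)) / τ)))) := by
          -- After the interchange of sums, the sum over r is the Gauss sum for each t, and the dual
          -- series at τ factors out.
          rw [← Summable.tsum_finsetSum fun r _ => hsum r]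
          congr 1
          rw [← tsum_mul_left, ← tsum_mul_left]
          refine tsum_congr fun t => ?_
          simp only [hterm]
          rw [← Finset.sum_mul, hgauss]
      _ = _ := by
          rw [hC τ hτ, ← hs]
          have h3 : s ^ n * s⁻¹ ^ n = 1 := by rw [← mul_pow, mul_inv_cancel₀ hs0, one_pow]
          linear_combination (-C * s₁⁻¹ ^ n * (G * (e (-(c * d * (F.Q β : ℂ))) *
            e ((c / J) * F.QC z) * ∑' t : F.dual L,
              (e (F.B t α : ℂ) * e (-F.QC (z + toC β - toC (t : V)) / τ))))) * h3
  have h4 : e (-(c / J) * F.QC z) * e (c / J * F.QC z) = 1 := by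
    rw [← e_add, neg_mul, neg_add_cancel, e_zero]
  rw [hmain, ← hquot, mul_pow, sub_eq_add_neg, e_add]
  linear_combination (e (b * d * (F.Q α : ℂ)) * s₁⁻¹ ^ n * G * e (-(c * d * (F.Q β : ℂ))) *
    (s ^ n * latTheta F L τ (z + toC β) α)) * h4

end Transformation

/-! ### The slash operator as a right action of the Jacobi group. -/

section Slash

set_option linter.unusedSectionVars false

open JacobiGroup

variable {V : Type*} [AddCommGroup V] [Module ℝ V] [FiniteDimensional ℝ V]
variable {F : SymForm V} {L : Submodule ℤ V}

theorem coe_smul_eq (γ : SL(2, ℤ)) (τ : ℍ) :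
    ((γ • τ : ℍ) : ℂ) = ((γ 0 0 : ℂ) * τ + (γ 0 1 : ℂ)) / autJ γ τ := by
  rw [UpperHalfPlane.coe_specialLinearGroup_apply]
  simp [autJ]

theorem det_eq (γ : SL(2, ℤ)) : γ 0 0 * γ 1 1 - γ 0 1 * γ 1 0 = 1 := by
  have := γ.det_coe
  rwa [Matrix.det_fin_two] at this

theorem e_half (r : ℝ) : ((Circle.exp (Real.pi * r) : Circle) : ℂ) = e ((r : ℂ) / 2) := by
  rw [Circle.coe_exp, e]
  congr 1
  push_cast
  ring

theorem toC_actV (γ : SL(2, ℤ)) (v w : V) :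
    toC (actV γ v w) = (γ 0 0 : ℂ) • toC v + (γ 1 0 : ℂ) • toC w := by
  rw [actV, toC_add, toC_zsmul, toC_zsmul]

theorem toC_actW (γ : SL(2, ℤ)) (v w : V) :
    toC (actW γ v w) = (γ 0 1 : ℂ) • toC v + (γ 1 1 : ℂ) • toC w := by
  rw [actW, toC_add, toC_zsmul, toC_zsmul]

theorem shift_mul (x y : JacobiGroup F) (τ : ℍ) (z : ℂ ⊗[ℝ] V) :
    shift (x * y) τ z = autJ y.mp.mat τ •
      shift x (y.mp.mat • τ) ((autJ y.mp.mat τ)⁻¹ • shift y τ z) := by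
  have hJ := autJ_ne_zero y.mp.mat τ
  rw [shift, shift, smul_add, smul_add, smul_inv_smul₀ hJ, smul_smul, coe_smul_eq,
    mul_div_cancel₀ _ hJ, mul_v, mul_w, toC_add, toC_add, toC_actV, toC_actW, shift, autJ]
  module

/-- The cocycle relation for the automorphic factor. All exponents are expressed through the shifted
point of `y`; the factor exp(πi A) of the Heisenberg product enters through `e_half`. -/
theorem facJ_mul (x y : JacobiGroup F) (τ : ℍ) (z : ℂ ⊗[ℝ] V) :
    facJ F (x * y) τ z = facJ F y τ z *
      facJ F x (y.mp.mat • τ) ((autJ y.mp.mat τ)⁻¹ • shift y τ z) := by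
  have hJ := autJ_ne_zero y.mp.mat τ
  have hJ₁ := autJ_ne_zero x.mp.mat (y.mp.mat • τ)
  have hshift := shift_mul x y τ z
  set s := shift y τ z with hs
  set J := autJ y.mp.mat τ with hJdef
  set τ' := y.mp.mat • τ with hτ'
  set J₁ := autJ x.mp.mat τ' with hJ₁def
  have hτ'c : (τ' : ℂ) = ((y.mp.mat 0 0 : ℂ) * τ + (y.mp.mat 0 1 : ℂ)) / J := coe_smul_eq _ _
  have hdet : (y.mp.mat 0 0 : ℂ) * y.mp.mat 1 1 - y.mp.mat 0 1 * y.mp.mat 1 0 = 1 := by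
    exact_mod_cast det_eq y.mp.mat
  have hJ₁e : J₁ = (x.mp.mat 1 0 : ℂ) * τ' + x.mp.mat 1 1 := rfl
  have hJe : J = (y.mp.mat 1 0 : ℂ) * τ + y.mp.mat 1 1 := rfl
  have hc : ((x * y).mp.mat 1 0 : ℂ) =
      (x.mp.mat 1 0 : ℂ) * y.mp.mat 0 0 + x.mp.mat 1 1 * y.mp.mat 1 0 := by
    rw [mul_mp, Metaplectic.mul_mat, Matrix.SpecialLinearGroup.coe_mul, Matrix.mul_apply,
      Fin.sum_univ_two]
    push_cast; ring
  have hJJ : autJ (x * y).mp.mat τ = J₁ * J := by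
    rw [mul_mp, Metaplectic.mul_mat, autJ_mul]
  -- This decomposition separates the quadratic contributions of `y` and of `x`.
  have hcJ : ((x * y).mp.mat 1 0 : ℂ) / (J₁ * J) =
      (y.mp.mat 1 0 : ℂ) / J + (x.mp.mat 1 0 : ℂ) / (J₁ * J ^ 2) := by
    rw [hc]
    field_simp
    have h1 : (τ' : ℂ) * J = (y.mp.mat 0 0 : ℂ) * τ + (y.mp.mat 0 1 : ℂ) := by
      rw [hτ'c, div_mul_cancel₀ _ hJ]
    rw [hJ₁e]
    linear_combination (-(x.mp.mat 1 0 : ℂ) * y.mp.mat 1 0) * h1 +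
      ((x.mp.mat 1 0 : ℂ) * y.mp.mat 0 0 ) * hJe + (x.mp.mat 1 0 : ℂ) * hdet
  set S := shift x τ' (J⁻¹ • s) with hS
  have hSe : J • S = s + J • ((τ' : ℂ) • toC x.v + toC x.w) := by
    rw [hS, shift, add_assoc, smul_add, smul_inv_smul₀ hJ]
  have hsB : F.BC (toC x.v) s = F.BC (toC x.v) z + τ * (F.B x.v y.v : ℂ) + (F.B x.v y.w : ℂ) := by
    rw [hs, shift, map_add, map_add, map_smul, F.BC_toC, F.BC_toC, smul_eq_mul]
  have hsB' : F.BC (toC x.w) s = F.BC (toC x.w) z + τ * (F.B x.w y.v : ℂ) + (F.B x.w y.w : ℂ) := by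
    rw [hs, shift, map_add, map_add, map_smul, F.BC_toC, F.BC_toC, smul_eq_mul]
  have hQS : F.QC (J • S) = F.QC s + J ^ 2 * (τ' ^ 2 * (F.Q x.v : ℂ) + F.Q x.w +
      τ' * F.B x.v x.w) + J * (τ' * F.BC (toC x.v) s + F.BC (toC x.w) s) := by
    rw [hSe, F.QC_add, F.QC_smul, F.QC_add, F.QC_smul, F.QC_toC, F.QC_toC, F.BC_symm s]
    simp only [map_add, map_smul, LinearMap.add_apply, LinearMap.smul_apply, smul_eq_mul, F.BC_toC]
  rw [facJ, facJ, facJ, ← hJdef, ← hs, mul_ξ, hJJ, hshift, ← hJ₁def, ← hS, hcJ, Circle.coe_mul, Circle.coe_mul, e_half]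
  have hexp : ∀ (A B C D E G : ℂ), C + D = E + G → (A * B * e C) * e D = B * e E * (A * e G) := by
    intro A B C D E G h
    calc (A * B * e C) * e D = A * B * e (C + D) := by rw [e_add]; ring
      _ = _ := by rw [h, e_add]; ring
  refine hexp _ _ _ _ _ _ ?_
  have hQJS : F.QC (J • S) = J ^ 2 * F.QC S := F.QC_smul _ _
  have hbv : F.BC (toC x.v) (J⁻¹ • s) = J⁻¹ * F.BC (toC x.v) s := by rw [map_smul, smul_eq_mul]
  rw [hbv]
  have hτJ : (τ' : ℂ) * J = (y.mp.mat 0 0 : ℂ) * τ + (y.mp.mat 0 1 : ℂ) := by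
    rw [hτ'c, div_mul_cancel₀ _ hJ]
  have hlast : -((y.mp.mat 1 0 : ℂ) / J + (x.mp.mat 1 0 : ℂ) / (J₁ * J ^ 2)) * F.QC (J • S) =
      -((y.mp.mat 1 0 : ℂ) / J) * F.QC (J • S) - (x.mp.mat 1 0 : ℂ) / J₁ * F.QC S := by
    rw [hQJS]; field_simp; ring
  rw [hlast, hQS]
  have hactV : actV y.mp.mat x.v x.w = (y.mp.mat 0 0 : ℝ) • x.v + (y.mp.mat 1 0 : ℝ) • x.w := by
    rw [actV, Int.cast_smul_eq_zsmul, Int.cast_smul_eq_zsmul]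
  have hactW : actW y.mp.mat x.v x.w = (y.mp.mat 0 1 : ℝ) • x.v + (y.mp.mat 1 1 : ℝ) • x.w := by
    rw [actW, Int.cast_smul_eq_zsmul, Int.cast_smul_eq_zsmul]
  rw [mul_v, mul_w, toC_add, toC_actV, altForm, hactV, hactW, F.Q_add, F.Q_add, F.Q_smul, F.Q_smul]
  have hvv : F.B x.v x.v = 2 * F.Q x.v := by rw [SymForm.Q]; ring
  have hww : F.B x.w x.w = 2 * F.Q x.w := by rw [SymForm.Q]; ring
  simp only [map_add, map_smul, LinearMap.add_apply, LinearMap.smul_apply, smul_eq_mul, hvv, hww,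
    F.symm y.v x.v, F.symm y.v x.w, F.symm x.w x.v]
  push_cast
  have hzv : F.BC (toC x.v) z = F.BC (toC x.v) s - τ * (F.B x.v y.v : ℂ) - (F.B x.v y.w : ℂ) := by
    rw [hsB]; ring
  have hzw : F.BC (toC x.w) z = F.BC (toC x.w) s - τ * (F.B x.w y.v : ℂ) - (F.B x.w y.w : ℂ) := by
    rw [hsB']; ring
  rw [hzv, hzw]
  generalize F.BC (toC x.v) s = X
  generalize F.BC (toC x.w) s = Y
  generalize (F.Q x.v : ℂ) = qv
  generalize (F.Q x.w : ℂ) = qw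
  generalize ((F.B x.v x.w : ℝ) : ℂ) = bvw
  have ht : (τ' : ℂ) = ((y.mp.mat 0 0 : ℂ) * τ + (y.mp.mat 0 1 : ℂ)) / J := hτ'c
  rw [ht]
  have hda : (y.mp.mat 0 0 : ℂ) * y.mp.mat 1 1 = 1 + y.mp.mat 0 1 * y.mp.mat 1 0 := by
    linear_combination hdet
  have hJ' := hJ
  rw [hJe] at hJ' ⊢
  generalize (y.mp.mat 0 0 : ℂ) = a at *
  generalize (y.mp.mat 0 1 : ℂ) = b at *
  generalize (y.mp.mat 1 0 : ℂ) = c at *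
  generalize (y.mp.mat 1 1 : ℂ) = d at *
  generalize (τ : ℂ) = t at *
  -- The discrepancy between the exponents is this multiple of ad - bc - 1.
  linear_combination (norm := skip) (X / (c * t + d) + (a * t + b) / (c * t + d) * qv + bvw / 2) * hdet
  field_simp
  ring

theorem slash_mul (κ : ℤ) (f : ℍ → ℂ ⊗[ℝ] V → ℂ) (x y : JacobiGroup F) (τ : ℍ) (z : ℂ ⊗[ℝ] V) :
    slash κ F f (x * y) τ z = slash κ F (slash κ F f x) y τ z := by
  simp only [slash]
  rw [facJ_mul, shift_mul, mul_mp, Metaplectic.mul_root, Metaplectic.mul_mat, mul_zpow, autJ_mul,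
    mul_smul, mul_inv, mul_smul, inv_smul_smul₀ (autJ_ne_zero _ _)]
  ring

end Slash

/-! ### Characters of the Jacobi group and eigenvalues of theta series. -/

section Characters

set_option linter.unusedSectionVars false

open JacobiGroup

variable {V : Type*} [AddCommGroup V] [Module ℝ V] [FiniteDimensional ℝ V]
variable {F : SymForm V} {L : Submodule ℤ V}

theorem slash_one (κ : ℤ) (f : ℍ → ℂ ⊗[ℝ] V → ℂ) (τ : ℍ) (z : ℂ ⊗[ℝ] V) :
    slash κ F f 1 τ z = f τ z := by
  simp [slash, facJ, shift, one_mp, one_v, one_w, one_ξ, Metaplectic.one_mat, Metaplectic.one_root,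
    autJ, toC_zero, F.Q_zero, e_zero]

theorem slash_const_mul (κ : ℤ) (f : ℍ → ℂ ⊗[ℝ] V → ℂ) (c : ℂ) (x : JacobiGroup F) (τ : ℍ)
    (z : ℂ ⊗[ℝ] V) : slash κ F (fun τ z => c * f τ z) x τ z = c * slash κ F f x τ z := by
  simp only [slash]; ring

/-- The lift of `T` to the Jacobi group. -/
def jacobiT (F : SymForm V) : JacobiGroup F where
  mp :=
    { mat := ModularGroup.T
      root := sqrtJ ModularGroup.T
      root_spec := ⟨1, fun τ => by simp⟩ }
  v := 0
  w := 0
  ξ := 1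

theorem T_mem_Gamma1 (N : ℕ) : ModularGroup.T ∈ CongruenceSubgroup.Gamma1 N := by
  rw [CongruenceSubgroup.Gamma1_mem]
  simp [ModularGroup.coe_T]

theorem jacobiT_mem (hL : F.IsIntegral L) (N : ℕ) :
    jacobiT F ∈ jacobiSubgroup F L hL (CongruenceSubgroup.Gamma1 N) :=
  ⟨T_mem_Gamma1 N, L.zero_mem, L.zero_mem, by simp [jacobiT]⟩

/-- Right multiplication by T adds the left column to the right one, and d = 0 forces c ≠ 0 by the
determinant. -/
theorem mul_jacobiT_ne_zero {x : JacobiGroup F} (hx : x.mp.mat 1 1 = 0) :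
    (x * jacobiT F).mp.mat 1 1 ≠ 0 := by
  have h := det_eq x.mp.mat
  rw [hx] at h
  rw [mul_mp, Metaplectic.mul_mat, Matrix.SpecialLinearGroup.coe_mul, Matrix.mul_apply,
    Fin.sum_univ_two, hx]
  have h1 : (jacobiT F).mp.mat 0 1 = 1 := by simp [jacobiT, ModularGroup.coe_T]
  rw [h1]
  intro h2
  have h3 : x.mp.mat 1 0 = 0 := by simpa using h2
  rw [h3] at h
  simp at h

theorem jacobiT_inv_ne_zero : ((jacobiT F)⁻¹).mp.mat 1 1 ≠ 0 := by
  rw [inv_mp, Metaplectic.inv_mat]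
  simp [jacobiT]

/-- The elements with nonzero lower right entry generate. -/
theorem exists_mul_of_entry_ne_zero (hL : F.IsIntegral L) (N : ℕ)
    (x : jacobiSubgroup F L hL (CongruenceSubgroup.Gamma1 N)) :
    ∃ y y' : jacobiSubgroup F L hL (CongruenceSubgroup.Gamma1 N), x = y * y' ∧
      (y : JacobiGroup F).mp.mat 1 1 ≠ 0 ∧ (y' : JacobiGroup F).mp.mat 1 1 ≠ 0 := by
  by_cases hx : (x : JacobiGroup F).mp.mat 1 1 = 0
  · refine ⟨x * ⟨jacobiT F, jacobiT_mem hL N⟩, ⟨jacobiT F, jacobiT_mem hL N⟩⁻¹, by group,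
      mul_jacobiT_ne_zero hx, jacobiT_inv_ne_zero⟩
  · refine ⟨x, 1, (mul_one _).symm, hx, ?_⟩
    change (1 : JacobiGroup F).mp.mat 1 1 ≠ 0
    simp [one_mp, Metaplectic.one_mat]

theorem character_ext {hL : F.IsIntegral L} {N : ℕ}
    {χ χ' : jacobiSubgroup F L hL (CongruenceSubgroup.Gamma1 N) →* ℂˣ}
    (h : ∀ x : jacobiSubgroup F L hL (CongruenceSubgroup.Gamma1 N), (x : JacobiGroup F).mp.mat 1 1 ≠ 0 → (χ x : ℂ) = χ' x) : χ = χ' := by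
  ext x
  obtain ⟨y, y', rfl, hy, hy'⟩ := exists_mul_of_entry_ne_zero hL N x
  rw [map_mul, map_mul, Units.val_mul, Units.val_mul, h y hy, h y' hy']

/-- A nonzero function which is an eigenfunction of all elements with nonzero lower right entry
defines a character. -/
theorem exists_character {hL : F.IsIntegral L} {N : ℕ} {κ : ℤ} {f : ℍ → ℂ ⊗[ℝ] V → ℂ}
    (hne : ∃ τ z, f τ z ≠ 0)
    (h : ∀ x : jacobiSubgroup F L hL (CongruenceSubgroup.Gamma1 N),
      (x : JacobiGroup F).mp.mat 1 1 ≠ 0 → ∃ c : ℂ, ∀ τ z, slash κ F f x τ z = c * f τ z) :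
    ∃ χ : jacobiSubgroup F L hL (CongruenceSubgroup.Gamma1 N) →* ℂˣ,
      ∀ (x : jacobiSubgroup F L hL (CongruenceSubgroup.Gamma1 N)) (τ z),
        slash κ F f x τ z = (χ x : ℂ) * f τ z := by
  have hcomp : ∀ (x y : jacobiSubgroup F L hL (CongruenceSubgroup.Gamma1 N)) (c c' : ℂ),
      (∀ τ z, slash κ F f x τ z = c * f τ z) → (∀ τ z, slash κ F f y τ z = c' * f τ z) →
      ∀ τ z, slash κ F f ((x * y : jacobiSubgroup F L hL _) : JacobiGroup F) τ z =
        (c * c') * f τ z := by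
    intro x y c c' hx hy τ z
    rw [Subgroup.coe_mul, slash_mul, show slash κ F f x = fun τ z => c * f τ z from
      funext fun τ => funext fun z => hx τ z, slash_const_mul, hy, mul_assoc]
  have hall : ∀ x : jacobiSubgroup F L hL (CongruenceSubgroup.Gamma1 N),
      ∃ c : ℂ, ∀ τ z, slash κ F f x τ z = c * f τ z := by
    intro x
    obtain ⟨y, y', rfl, hy, hy'⟩ := exists_mul_of_entry_ne_zero hL N x
    obtain ⟨c, hc⟩ := h y hy
    obtain ⟨c', hc'⟩ := h y' hy'
    exact ⟨c * c', hcomp y y' c c' hc hc'⟩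
  choose c hc using hall
  obtain ⟨τ₀, z₀, h0⟩ := hne
  -- At a point where f does not vanish the eigenvalue can be read off, so it is unique and hence
  -- multiplicative.
  let ψ : jacobiSubgroup F L hL (CongruenceSubgroup.Gamma1 N) →* ℂ :=
    { toFun := c
      map_one' := by
        have h1 := hc 1 τ₀ z₀
        rw [Subgroup.coe_one, slash_one] at h1
        exact mul_right_cancel₀ h0 (by rw [← h1, one_mul])
      map_mul' := fun x y => by
        have h1 := hc (x * y) τ₀ z₀
        rw [hcomp x y _ _ (hc x) (hc y)] at h1
        exact (mul_right_cancel₀ h0 h1).symm }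
  exact ⟨ψ.toHomUnits, fun x τ z => by rw [MonoidHom.coe_toHomUnits]; exact hc x τ z⟩

/-- The image lies in the finite group of K-th roots of unity. -/
theorem finiteIndex_ker_of_pow {G : Type*} [Group G] (χ : G →* ℂˣ) {K : ℕ} (hK : 0 < K)
    (h : ∀ x, (χ x : ℂ) ^ K = 1) : χ.ker.FiniteIndex := by
  have : NeZero K := ⟨hK.ne'⟩
  have hle : ∀ y : χ.range, (y : ℂˣ) ∈ rootsOfUnity K ℂ := by
    rintro ⟨_, x, rfl⟩
    rw [mem_rootsOfUnity]
    ext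
    simpa using h x
  have hfin : Finite χ.range := by
    refine Finite.of_injective (fun y : χ.range => (⟨y, hle y⟩ : rootsOfUnity K ℂ)) ?_
    intro y y' hyy
    exact Subtype.ext (congrArg (fun u : rootsOfUnity K ℂ => (u : ℂˣ)) hyy)
  exact Subgroup.finiteIndex_ker χ

theorem finiteIndex_ker {hL : F.IsIntegral L} {N : ℕ}
    (χ : jacobiSubgroup F L hL (CongruenceSubgroup.Gamma1 N) →* ℂˣ) {K : ℕ} (hK : 0 < K)
    (h : ∀ x : jacobiSubgroup F L hL (CongruenceSubgroup.Gamma1 N), (x : JacobiGroup F).mp.mat 1 1 ≠ 0 → (χ x : ℂ) ^ K = 1) : χ.ker.FiniteIndex := by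
  refine finiteIndex_ker_of_pow χ hK fun x => ?_
  obtain ⟨y, y', rfl, hy, hy'⟩ := exists_mul_of_entry_ne_zero hL N x
  rw [map_mul, Units.val_mul, mul_pow, h y hy, h y' hy', one_mul]

/-- Reindexing by l ↦ v + l matches the terms up to e of the integers B(α, w) and B(l, w). -/
theorem theta_shift {α β : V} (hα : α ∈ F.dual L) {v w : V} (hv : v ∈ L) (hw : w ∈ L)
    (hi : F.IsIntegral L) (τ : ℍ) (z : ℂ ⊗[ℝ] V) :
    e ((τ : ℂ) * (F.Q v : ℂ) + F.BC (toC v) z + (F.B v w : ℂ) / 2) *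
      theta F L α β τ (z + (τ : ℂ) • toC v + toC w) =
    e ((F.B v w : ℂ) / 2 - (F.B v β : ℂ)) * theta F L α β τ z := by
  rw [theta, theta, ← tsum_mul_left, ← tsum_mul_left,
    ← (Equiv.addLeft (⟨v, hv⟩ : L)).tsum_eq fun l : L =>
      e ((F.B v w : ℂ) / 2 - (F.B v β : ℂ)) * thetaTerm F α β τ z l]
  refine tsum_congr fun l => ?_
  simp only [Equiv.coe_addLeft, thetaTerm, Submodule.coe_add]
  obtain ⟨p, hp⟩ := hα w hw
  obtain ⟨q, hq⟩ := hi l l.2 w hw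
  simp only [← e_add]
  refine e_eq_of_sub (p + q) ?_
  rw [show α + (v + l) = (α + l) + v by abel, F.Q_add (α + l) v, toC_add _ v]
  simp only [map_add, map_smul, LinearMap.add_apply, smul_eq_mul, F.BC_toC, toC_add, hp, hq,
    F.symm β v]
  push_cast
  ring

theorem theta_ne_zero (hF : F.PosDef) (hL : IsLattice L) (α β : V) :
    ∃ τ z, theta F L α β τ z ≠ 0 := by
  -- This point makes every term of the lattice theta series a positive real number, so nothing can
  -- cancel.
  refine ⟨UpperHalfPlane.I, -(UpperHalfPlane.I : ℂ) • toC α - toC β, ?_⟩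
  rw [theta_eq, sub_add_cancel, latTheta]
  refine mul_ne_zero (e_ne_zero _) ?_
  have h1 : ∀ l : L, gaussTerm F (UpperHalfPlane.I : ℂ) (-(UpperHalfPlane.I : ℂ) • toC α) (α + l) =
      ((Real.exp (-2 * Real.pi * (F.Q l - F.Q α)) : ℝ) : ℂ) := by
    intro l
    rw [gaussTerm, map_smul, F.BC_toC, F.Q_add, map_add, LinearMap.add_apply, F.symm α,
      show F.B α α = 2 * F.Q α by rw [SymForm.Q]; ring, e, Complex.ofReal_exp,
      UpperHalfPlane.coe_I]
    congr 1
    push_cast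
    rw [smul_eq_mul]
    linear_combination (2 * Real.pi * ((F.Q l : ℂ) - F.Q α)) * Complex.I_sq
  have hs := summable_gaussTerm (L := L) hF hL (τ := UpperHalfPlane.I) (by simp)
    (-(UpperHalfPlane.I : ℂ) • toC α) α
  simp only [h1] at hs ⊢
  rw [← Complex.ofReal_tsum]
  have hs' : Summable fun l : L => Real.exp (-2 * Real.pi * (F.Q l - F.Q α)) :=
    Complex.summable_ofReal.1 hs
  exact_mod_cast (hs'.tsum_pos (fun _ => (Real.exp_pos _).le) 0 (Real.exp_pos _)).ne'

/-- The value at `x` of the character of `θ_{α,β}`. -/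
def thetaFactor (L : Submodule ℤ V) (α β : V) (x : JacobiGroup F) (ε : ℤˣ) : ℂ :=
  ((ε : ℤ) : ℂ) ^ (-(Module.finrank ℝ V : ℤ)) * (x.ξ : ℂ) *
    (-Complex.I) ^ ((Module.finrank ℝ V : ℤ) * ((1 - (x.mp.mat 1 1).sign) / 2) *
      signSymbol (x.mp.mat 1 0)) *
    gaussSum F L (x.mp.mat 0 1) (x.mp.mat 1 1) 0 *
    e ((x.mp.mat 0 1 : ℂ) * (F.Q α : ℂ) - (x.mp.mat 1 0 : ℂ) * (F.Q β : ℂ) +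
      (F.B x.v x.w : ℂ) / 2 - (F.B x.v β : ℂ))

theorem gaussSum_eq (b d : ℤ) [Fintype (LatQuot L d)] :
    gaussSum F L b d 0 = ((|(d : ℝ)| ^ (-(Module.finrank ℝ V : ℝ) / 2) : ℝ) : ℂ) *
      ∑ r : LatQuot L d, e ((b : ℂ) * (F.Q (Quotient.out r : L) : ℂ) / d) := by
  rw [gaussSum, finsum_eq_sum_of_fintype]
  simp only [zero_add]

theorem rootFactor_pow (c d : ℤ) (n : ℕ) : rootFactor c d ^ n =
    ((|(d : ℝ)| ^ (-(n : ℝ) / 2) : ℝ) : ℂ) *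
      (-Complex.I) ^ ((n : ℤ) * ((1 - d.sign) / 2) * signSymbol c) := by
  rw [rootFactor, mul_pow, ← Complex.ofReal_pow, ← Real.rpow_natCast, ← Real.rpow_mul (abs_nonneg _),
    ← zpow_natCast (_ ^ _), ← zpow_mul]
  have h1 : -(1 / 2 : ℝ) * n = -(n : ℝ) / 2 := by ring
  have h2 : (1 - d.sign) / 2 * signSymbol c * (n : ℤ) =
      (n : ℤ) * ((1 - d.sign) / 2) * signSymbol c := by ring
  rw [h1, h2]

theorem Gamma1_dvd {N : ℕ} {γ : SL(2, ℤ)} (hγ : γ ∈ CongruenceSubgroup.Gamma1 N) :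
    (N : ℤ) ∣ γ 1 0 ∧ (N : ℤ) ∣ γ 1 1 - 1 := by
  obtain ⟨-, h1, h2⟩ := (CongruenceSubgroup.Gamma1_mem N γ).1 hγ
  constructor
  · exact (ZMod.intCast_zmod_eq_zero_iff_dvd _ _).1 h2
  · rw [← ZMod.intCast_zmod_eq_zero_iff_dvd]
    push_cast
    rw [h1, sub_self]

/-- `latTheta_transform` accounts for the matrix and `theta_shift` for the Heisenberg part. -/
theorem theta_slash (hF : F.PosDef) (hL : IsLattice L) (he : F.IsEven L) {α β : V}
    (hα : α ∈ F.dual L) (hβ : (F.level L : ℝ) • β ∈ L) {x : JacobiGroup F}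
    (hγ : x.mp.mat ∈ CongruenceSubgroup.Gamma1 (F.level L)) (hv : x.v ∈ L) (hw : x.w ∈ L)
    (hd : x.mp.mat 1 1 ≠ 0) {ε : ℤˣ} (hε : ∀ τ, x.mp.root τ = ((ε : ℤ) : ℂ) * sqrtJ x.mp.mat τ)
    (τ : ℍ) (z : ℂ ⊗[ℝ] V) :
    slash (Module.finrank ℝ V) F (theta F L α β) x τ z =
      thetaFactor L α β x ε * theta F L α β τ z := by
  obtain ⟨hN0, hN⟩ := level_spec hF hL he
  set N := F.level L with hNdef
  obtain ⟨⟨c', hc'⟩, ⟨d', hd'⟩⟩ := Gamma1_dvd hγ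
  have hNβ : (N : ℤ) • β ∈ L := by
    rw [← Int.cast_smul_eq_zsmul ℝ]; exact_mod_cast hβ
  have hNd : ∀ t ∈ F.dual L, (N : ℤ) • t ∈ L := fun t ht => level_smul_dual_mem hF hL he ht
  have := LatQuot.finite hL hd
  have := Fintype.ofFinite (LatQuot L (x.mp.mat 1 1))
  have hdet := det_eq x.mp.mat
  set a := x.mp.mat 0 0
  set b := x.mp.mat 0 1
  set c := x.mp.mat 1 0
  set d := x.mp.mat 1 1
  set s := shift x τ z with hs
  have hJ : (c : ℂ) * τ + d ≠ 0 := autJ_ne_zero x.mp.mat τ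
  have hJe : autJ x.mp.mat τ = (c : ℂ) * τ + d := rfl
  have hτ' := coe_smul_eq x.mp.mat τ
  have key := latTheta_transform hF hL he hdet hd hα (β := β)
    (by rw [hd', mul_comm, mul_smul]; exact L.smul_mem _ (hNd _ hα))
    (by rw [hd', mul_comm, mul_smul]; exact L.smul_mem _ hNβ)
    (by rw [hc', mul_comm, mul_smul]; exact L.smul_mem _ hNβ)
    (fun t ht => by rw [hc', mul_comm, mul_smul]; exact L.smul_mem _ (hNd _ ht))
    (fun t ht => by
      obtain ⟨m, hm⟩ := hN t ht
      refine ⟨c' * m, ?_⟩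
      rw [hc']; push_cast; rw [← hm]; ring)
    τ.im_pos hJ (by rw [← hJe, ← hτ']; exact UpperHalfPlane.im_pos _) s
  rw [← hJe, ← hτ'] at key
  -- The factor d may be dropped because d ≡ 1 mod N, N | c, and both NQ(α) and N²Q(β) are integers.
  have hex : e (b * d * (F.Q α : ℂ) - c * d * (F.Q β : ℂ)) =
      e (b * (F.Q α : ℂ) - c * (F.Q β : ℂ)) := by
    obtain ⟨m, hm⟩ := hN α hα
    obtain ⟨k, hk⟩ := he _ hNβ
    have hdd : d = N * d' + 1 := by linarith
    refine e_eq_of_sub (b * d' * m - c' * d' * k) ?_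
    have hm' : ((N : ℝ) : ℂ) * (F.Q α : ℂ) = m := by exact_mod_cast hm
    have hk' : ((N : ℝ) : ℂ) ^ 2 * (F.Q β : ℂ) = k := by
      rw [F.Q_zsmul] at hk
      exact_mod_cast hk
    push_cast at hm' hk' ⊢
    rw [← hm', ← hk', hdd, hc']
    push_cast
    ring
  rw [hex] at key
  have hroot : x.mp.root τ = ((ε : ℤ) : ℂ) * autJ x.mp.mat τ ^ (1 / 2 : ℂ) := hε τ
  have hP : autJ x.mp.mat τ ^ (1 / 2 : ℂ) ≠ 0 := cpow_half_ne_zero (autJ_ne_zero _ _)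
  have hshift := theta_shift (β := β) hα hv hw he.isIntegral τ z
  have hf : facJ F x τ z = (x.ξ : ℂ) * (e (-((c : ℂ) / autJ x.mp.mat τ) * F.QC s) *
      e ((τ : ℂ) * (F.Q x.v : ℂ) + F.BC (toC x.v) z + (F.B x.v x.w : ℂ) / 2)) := by
    rw [facJ, ← e_add, ← hs]
    congr 2
    ring
  have hs' : s = z + (τ : ℂ) • toC x.v + toC x.w := rfl
  rw [← hs'] at hshift
  rw [theta_eq α β τ s] at hshift
  rw [slash, hf, theta_eq α β (x.mp.mat • τ), hroot, ← hs]
  -- The n-th powers of √(cτ+d) cancel, which is what fixes the weight n/2.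
  have hn : (((ε : ℤ) : ℂ) * autJ x.mp.mat τ ^ (1 / 2 : ℂ)) ^ (-(Module.finrank ℝ V : ℤ)) *
      (rootFactor c d * autJ x.mp.mat τ ^ (1 / 2 : ℂ)) ^ Module.finrank ℝ V =
      ((ε : ℤ) : ℂ) ^ (-(Module.finrank ℝ V : ℤ)) * rootFactor c d ^ Module.finrank ℝ V := by
    rw [mul_zpow, mul_pow, zpow_neg (_ ^ (1 / 2 : ℂ)), zpow_natCast (_ ^ (1 / 2 : ℂ))]
    field_simp
  rw [thetaFactor, gaussSum_eq]
  have hsplit : e ((b : ℂ) * (F.Q α : ℂ) - c * (F.Q β : ℂ) +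
      (F.B x.v x.w : ℂ) / 2 - (F.B x.v β : ℂ)) = e (b * (F.Q α : ℂ) - c * (F.Q β : ℂ)) *
      e ((F.B x.v x.w : ℂ) / 2 - (F.B x.v β : ℂ)) := by
    rw [← e_add]; congr 1; ring
  have hr := rootFactor_pow c d (Module.finrank ℝ V)
  change _ = ((ε : ℤ) : ℂ) ^ (-(Module.finrank ℝ V : ℤ)) * (x.ξ : ℂ) *
    (-Complex.I) ^ ((Module.finrank ℝ V : ℤ) * ((1 - d.sign) / 2) * signSymbol c) *
    (_ * ∑ r : LatQuot L d, e ((b : ℂ) * (F.Q (Quotient.out r : L) : ℂ) / d)) *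
    e ((b : ℂ) * (F.Q α : ℂ) - c * (F.Q β : ℂ) +
      (F.B x.v x.w : ℂ) / 2 - (F.B x.v β : ℂ)) * _
  rw [hsplit]
  set P := autJ x.mp.mat τ ^ (1 / 2 : ℂ)
  set G := ∑ r : LatQuot L d, e ((b : ℂ) * (F.Q (Quotient.out r : L) : ℂ) / d)
  set E1 := e ((τ : ℂ) * (F.Q x.v : ℂ) + F.BC (toC x.v) z + (F.B x.v x.w : ℂ) / 2)
  set E2 := e (-(F.B β α : ℂ))
  set ε' := (((ε : ℤ) : ℂ) * P) ^ (-(Module.finrank ℝ V : ℤ))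
  set E3 := e (b * (F.Q α : ℂ) - c * (F.Q β : ℂ))
  calc _ = ε' * x.ξ * E1 * E2 * (e (-((c : ℂ) / autJ x.mp.mat τ) * F.QC s) *
        latTheta F L ((x.mp.mat • τ : ℍ) : ℂ) ((autJ x.mp.mat τ)⁻¹ • s + toC β) α) := by ring
    _ = (ε' * (rootFactor c d * P) ^ Module.finrank ℝ V) * x.ξ * G * E3 *
        (E1 * (E2 * latTheta F L τ (s + toC β) α)) := by rw [key]; ring
    _ = _ := by rw [hshift, hn, hr]; ring

end Characters

/-! ### Gauss sums are eighth roots of unity up to normalisation. -/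

section GaussSums

set_option linter.unusedSectionVars false

variable {V : Type*} [AddCommGroup V] [Module ℝ V] [FiniteDimensional ℝ V]
variable {F : SymForm V} {L : Submodule ℤ V}

/-- Substituting r + s for r in the double sum leaves, for each r, the sum over s of the character
e(bB(r,s)/d). This vanishes unless the character is trivial, which happens only for r = 0. -/
theorem norm_gauss_sq (hL : IsLattice L) (he : F.IsEven L) {a b c d : ℤ}
    (hdet : a * d - b * c = 1) (hd : d ≠ 0) [Fintype (LatQuot L d)]
    (hcL : ∀ t ∈ F.dual L, c • t ∈ L) :
    (∑ r : LatQuot L d, e ((b : ℂ) * (F.Q (Quotient.out r : L) : ℂ) / d)) *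
      (∑ r : LatQuot L d, e (-((b : ℂ) * (F.Q (Quotient.out r : L) : ℂ) / d))) =
      (d.natAbs : ℂ) ^ Module.finrank ℝ V := by
  have hd' : (d : ℂ) ≠ 0 := Int.cast_ne_zero.2 hd
  have hdR : (d : ℝ) ≠ 0 := Int.cast_ne_zero.2 hd
  have h1 : (∑ r : LatQuot L d, e ((b : ℂ) * (F.Q (Quotient.out r : L) : ℂ) / d)) *
      (∑ r : LatQuot L d, e (-((b : ℂ) * (F.Q (Quotient.out r : L) : ℂ) / d))) =
      ∑ r : LatQuot L d, e ((b : ℂ) * (F.Q (Quotient.out r : L) : ℂ) / d) *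
        ∑ s : LatQuot L d, e ((b : ℂ) * (F.B (Quotient.out r : L) (Quotient.out s : L) : ℂ) / d) := by
    rw [Finset.mul_sum]
    simp_rw [Finset.mul_sum (s := Finset.univ) (f := fun s : LatQuot L d =>
      e ((b : ℂ) * (F.B _ (Quotient.out s : L) : ℂ) / d))]
    rw [Finset.sum_comm]
    refine Finset.sum_congr rfl fun s _ => ?_
    rw [← sum_quot_shift (f := fun x : L => e ((b : ℂ) * (F.Q (x : V) : ℂ) / d))
      (gauss_periodic he b hd) (Quotient.out s), Finset.sum_mul]
    refine Finset.sum_congr rfl fun r _ => ?_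
    rw [← e_add, ← e_add, Submodule.coe_add, F.Q_add]
    congr 1
    push_cast
    ring
  rw [h1, Finset.sum_eq_single (0 : LatQuot L d)]
  · obtain ⟨l, hl⟩ := LatQuot.mk_eq_mk.1 ((LatQuot.mk_out (0 : LatQuot L d)).trans
      (Submodule.Quotient.mk_zero _).symm)
    rw [zero_add] at hl
    rw [hl]
    have h2 : ∀ s : LatQuot L d,
        e ((b : ℂ) * (F.B ((d • l : L) : V) (Quotient.out s : L) : ℂ) / d) = 1 := by
      intro s
      obtain ⟨m, hm⟩ := IsEven.B_int he l (Quotient.out s)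
      rw [← e_int (b * m)]
      congr 1
      rw [Submodule.coe_smul, F.B_zsmul_left, hm]
      push_cast
      field_simp
    have h3 := gauss_periodic he b hd 0 l
    rw [zero_add] at h3
    rw [h3]
    have hcard : (Fintype.card (LatQuot L d) : ℂ) = (d.natAbs : ℂ) ^ Module.finrank ℝ V := by
      rw [← Nat.card_eq_fintype_card, LatQuot.card hL hd, Nat.cast_pow]
    simp only [h2, Submodule.coe_zero, F.Q_zero, Complex.ofReal_zero, mul_zero, zero_div, e_zero,
      one_mul, Finset.sum_const, Finset.card_univ, nsmul_eq_mul, mul_one]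
    exact hcard
  · intro r _ hr
    refine mul_eq_zero_of_right _ ?_
    set x : L := Quotient.out r with hx
    have hex : ∃ s : L, e ((b : ℂ) * (F.B x s : ℂ) / d) ≠ 1 := by
      by_contra! hall
      apply hr
      -- A trivial character means (b/d)x ∈ L♯. Then ad - bc = 1 gives x = d(ax - c(b/d)x), and cL♯
      -- ⊆ L places x in dL.
      have h4 : ((b : ℝ) / d) • (x : V) ∈ F.dual L := by
        intro l hl
        have h5 := hall ⟨l, hl⟩
        rw [e, Complex.exp_eq_one_iff] at h5
        obtain ⟨m, hm⟩ := h5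
        refine ⟨m, ?_⟩
        rw [mul_comm (m : ℂ)] at hm
        have h6 := mul_left_cancel₀ Complex.two_pi_I_ne_zero hm
        rw [map_smul, LinearMap.smul_apply, smul_eq_mul, div_mul_eq_mul_div]
        exact_mod_cast h6
      have h5 : (x : V) = d • (a • (x : V) - c • (((b : ℝ) / d) • (x : V))) := by
        have hdet' : (a : ℝ) * d - b * c = 1 := by exact_mod_cast hdet
        simp only [← Int.cast_smul_eq_zsmul ℝ, smul_smul, ← sub_smul]
        rw [show (d : ℝ) * (a - c * (b / d)) = 1 by field_simp; linarith, one_smul]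
      rw [← LatQuot.mk_out r, ← hx, ← Submodule.Quotient.mk_zero, LatQuot.mk_eq_mk]
      refine ⟨⟨a • (x : V) - c • (((b : ℝ) / d) • (x : V)),
        L.sub_mem (L.smul_mem _ x.2) (hcL _ h4)⟩, Subtype.ext ?_⟩
      rw [zero_add, Submodule.coe_smul]
      exact h5
    obtain ⟨s, hs⟩ := hex
    have hper : ∀ y l : L, e ((b : ℂ) * (F.B x (y + d • l : L) : ℂ) / d) =
        e ((b : ℂ) * (F.B x y : ℂ) / d) := by
      intro y l
      obtain ⟨m, hm⟩ := IsEven.B_int he x l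
      refine e_eq_of_sub (b * m) ?_
      rw [Submodule.coe_add, Submodule.coe_smul, map_add, F.B_zsmul_right, hm]
      push_cast
      field_simp
      ring
    have h7 := sum_quot_shift (f := fun y : L => e ((b : ℂ) * (F.B x y : ℂ) / d)) hper s
    have h8 : ∀ y : LatQuot L d, e ((b : ℂ) * (F.B x (Quotient.out y + s : L) : ℂ) / d) =
        e ((b : ℂ) * (F.B x (Quotient.out y : L) : ℂ) / d) * e ((b : ℂ) * (F.B x s : ℂ) / d) := by
      intro y
      rw [← e_add, Submodule.coe_add, map_add]
      congr 1
      push_cast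
      ring
    simp only [h8] at h7
    rw [← Finset.sum_mul] at h7
    by_contra hne
    exact hs (mul_left_cancel₀ hne (by rw [h7, mul_one]))
  · intro h
    exact absurd (Finset.mem_univ _) h

/-- Left multiplication by the quaternion `p + qi + rj + sk`. -/
def quatMul {M : Type*} [AddCommGroup M] (p q r s : ℤ) (x : Fin 4 → M) : Fin 4 → M :=
  ![p • x 0 - q • x 1 - r • x 2 - s • x 3, q • x 0 + p • x 1 - s • x 2 + r • x 3,
    r • x 0 + s • x 1 + p • x 2 - q • x 3, s • x 0 - r • x 1 + q • x 2 + p • x 3]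

/-- The product with the conjugate quaternion is the norm; this makes the multiplication injective
on L/dL when the norm is ≡ -1 mod d. -/
theorem quatMul_conj {M : Type*} [AddCommGroup M] (p q r s : ℤ) (x : Fin 4 → M) :
    quatMul p (-q) (-r) (-s) (quatMul p q r s x) = (p ^ 2 + q ^ 2 + r ^ 2 + s ^ 2) • x := by
  ext i
  fin_cases i <;>
  · simp only [quatMul, Fin.zero_eta, Fin.mk_one, Fin.reduceFinMk, Matrix.cons_val, Pi.smul_apply]
    module

/-- Multiplicativity of the quaternion norm: the mixed terms cancel by the symmetry of B. -/
theorem sum_Q_quatMul (p q r s : ℤ) (x : Fin 4 → V) :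
    ∑ i, F.Q (quatMul p q r s x i) = (p ^ 2 + q ^ 2 + r ^ 2 + s ^ 2) * ∑ i, F.Q (x i) := by
  simp only [Fin.sum_univ_four, quatMul, Matrix.cons_val, SymForm.Q, map_add, map_sub, map_zsmul,
    LinearMap.add_apply, LinearMap.sub_apply, LinearMap.smul_apply, zsmul_eq_mul,
    F.symm (x 1) (x 0), F.symm (x 2) (x 0), F.symm (x 3) (x 0), F.symm (x 2) (x 1),
    F.symm (x 3) (x 1), F.symm (x 3) (x 2)]
  ring

/-- The fourth power of a Gauss sum is real. -/
theorem gauss_pow_four (he : F.IsEven L) (b : ℤ) {d : ℤ} (hd : d ≠ 0) [Fintype (LatQuot L d)] :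
    (∑ r : LatQuot L d, e ((b : ℂ) * (F.Q (Quotient.out r : L) : ℂ) / d)) ^ 4 =
      (∑ r : LatQuot L d, e (-((b : ℂ) * (F.Q (Quotient.out r : L) : ℂ) / d))) ^ 4 := by
  have hd' : (d : ℂ) ≠ 0 := Int.cast_ne_zero.2 hd
  -- Lagrange's theorem provides an integral quaternion of norm |d| - 1 ≡ -1 mod d, for any d ≠ 0.
  obtain ⟨p, q, r, s, hpqrs⟩ := Nat.sum_four_squares (d.natAbs - 1)
  have hS : (p : ℤ) ^ 2 + (q : ℤ) ^ 2 + (r : ℤ) ^ 2 + (s : ℤ) ^ 2 = d.natAbs - 1 := by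
    have h1 : 1 ≤ d.natAbs := Int.natAbs_pos.2 hd
    have h2 : ((p ^ 2 + q ^ 2 + r ^ 2 + s ^ 2 : ℕ) : ℤ) = ((d.natAbs - 1 : ℕ) : ℤ) := by rw [hpqrs]
    rw [Nat.cast_sub h1] at h2
    exact_mod_cast h2
  obtain ⟨δ, hδ⟩ : d ∣ (d.natAbs : ℤ) := Int.dvd_natAbs.2 dvd_rfl
  have hkill : ∀ y : LatQuot L d, d • y = 0 := by
    intro y
    rw [← LatQuot.mk_out y, ← Submodule.Quotient.mk_smul, ← Submodule.Quotient.mk_zero,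
      LatQuot.mk_eq_mk]
    exact ⟨_, (zero_add _).symm⟩
  -- Both sides become sums over (L/dL)⁴. The quaternion permutes this set and changes ∑Q(x_i) into
  -- its negative modulo d.
  rw [Fintype.sum_pow, Fintype.sum_pow]
  have hinj : Function.Injective (quatMul (M := LatQuot L d) p q r s) := by
    intro x y hxy
    have h1 := congrArg (quatMul (p : ℤ) (-q) (-r) (-s)) hxy
    have hneg : ∀ y : LatQuot L d, ((d.natAbs : ℤ) - 1) • y = -y := by
      intro y
      rw [hδ, sub_smul, one_smul, mul_comm, mul_smul, hkill, smul_zero, zero_sub]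
    rw [quatMul_conj, quatMul_conj, hS] at h1
    ext i
    have h2 := congrFun h1 i
    rw [Pi.smul_apply, Pi.smul_apply, hneg, hneg] at h2
    exact neg_injective h2
  have hbij := Finite.injective_iff_bijective.1 hinj
  rw [← hbij.sum_comp]
  refine Finset.sum_congr rfl fun x _ => ?_
  rw [← e_sum, ← e_sum]
  set y : Fin 4 → L := fun i => Quotient.out (x i) with hy
  have hmk : ∀ i, quatMul (M := LatQuot L d) p q r s x i =
      Submodule.Quotient.mk (quatMul (M := L) p q r s y i) := by
    intro i
    have hx : ∀ i, x i = Submodule.Quotient.mk (y i) := fun i => (LatQuot.mk_out (x i)).symm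
    fin_cases i <;> simp [quatMul, hx]
  have hout : ∀ i, ∃ l : L, (Quotient.out (quatMul (M := LatQuot L d) p q r s x i) : L) =
      quatMul (M := L) p q r s y i + d • l := by
    intro i
    rw [← LatQuot.mk_eq_mk, LatQuot.mk_out, hmk]
  choose l hl using hout
  have hcoe : ∀ i, ((quatMul (M := L) p q r s y i : L) : V) =
      quatMul (p : ℤ) q r s (fun i => (y i : V)) i := by
    intro i
    fin_cases i <;> simp [quatMul]
  rw [e_sum]
  have h3 : ∀ i, e ((b : ℂ) * (F.Q (Quotient.out (quatMul (M := LatQuot L d) p q r s x i) : L) : ℂ)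
      / d) = e ((b : ℂ) * (F.Q (quatMul (p : ℤ) q r s (fun i => (y i : V)) i) : ℂ) / d) := by
    intro i
    rw [hl, gauss_periodic he b hd, hcoe]
  simp only [h3]
  rw [← e_sum]
  choose m hm using fun i => he (y i) (y i).2
  refine e_eq_of_sub (b * δ * ∑ i, m i) ?_
  have h4 := sum_Q_quatMul (F := F) p q r s (fun i => (y i : V))
  have h5 : (∑ i, (F.Q (quatMul (p : ℤ) q r s (fun i => (y i : V)) i) : ℂ)) =
      (d * δ - 1) * ∑ i, (m i : ℂ) := by
    have hS' : ((p : ℤ) : ℝ) ^ 2 + ((q : ℤ) : ℝ) ^ 2 + ((r : ℤ) : ℝ) ^ 2 + ((s : ℤ) : ℝ) ^ 2 =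
        d * δ - 1 := by
      rw [hδ] at hS
      exact_mod_cast hS
    rw [hS'] at h4
    simp only [hm] at h4
    exact_mod_cast h4
  have h6 : ∀ i, (F.Q (Quotient.out (x i) : L) : ℂ) = m i := by
    intro i
    have := hm i
    exact_mod_cast this
  simp only [h6]
  rw [← Finset.sum_div, ← Finset.mul_sum, h5, Finset.sum_neg_distrib, ← Finset.sum_div,
    ← Finset.mul_sum]
  push_cast
  field_simp
  ring

/-- With G' the conjugate sum, G⁸ = G⁴G'⁴ = (GG')⁴ = |d|^(4n), and the normalisation removes this
power. -/
theorem gaussSum_pow_eight (hL : IsLattice L) (he : F.IsEven L) {a b c d : ℤ}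
    (hdet : a * d - b * c = 1) (hd : d ≠ 0) (hcL : ∀ t ∈ F.dual L, c • t ∈ L) :
    gaussSum F L b d 0 ^ 8 = 1 := by
  have := LatQuot.finite hL hd
  have := Fintype.ofFinite (LatQuot L d)
  rw [gaussSum_eq]
  have h1 := norm_gauss_sq hL he hdet hd hcL
  have h2 := gauss_pow_four he b hd
  set G := ∑ r : LatQuot L d, e ((b : ℂ) * (F.Q (Quotient.out r : L) : ℂ) / d)
  set G' := ∑ r : LatQuot L d, e (-((b : ℂ) * (F.Q (Quotient.out r : L) : ℂ) / d))
  set n := Module.finrank ℝ V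
  have h3 : G ^ 8 = ((d.natAbs : ℂ) ^ n) ^ 4 := by
    rw [← h1, mul_pow, ← h2]; ring
  have habs : 0 < |(d : ℝ)| := abs_pos.2 (Int.cast_ne_zero.2 hd)
  have h4 : (|(d : ℝ)| ^ (-(n : ℝ) / 2)) ^ 8 * (|(d : ℝ)| ^ n) ^ 4 = 1 := by
    rw [← Real.rpow_natCast, ← Real.rpow_mul habs.le, ← pow_mul, ← Real.rpow_natCast,
      ← Real.rpow_add habs]
    rw [show -(n : ℝ) / 2 * (8 : ℕ) + ((n * 4 : ℕ) : ℝ) = 0 by push_cast; ring, Real.rpow_zero]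
  have h5 : (d.natAbs : ℂ) = ((|(d : ℝ)| : ℝ) : ℂ) := by
    rw [Nat.cast_natAbs, ← Int.cast_abs, Complex.ofReal_intCast]
  rw [mul_pow, h3, h5]
  exact_mod_cast h4

/-- The eighth power kills the signs, the power of -i and the Gauss sum; N² clears the denominators
coming from α and β. -/
theorem thetaFactor_pow (hF : F.PosDef) (hL : IsLattice L) (he : F.IsEven L) {α β : V}
    (hα : α ∈ F.dual L) (hβ : (F.level L : ℝ) • β ∈ L) {x : JacobiGroup F}
    (hγ : x.mp.mat ∈ CongruenceSubgroup.Gamma1 (F.level L)) (hv : x.v ∈ L) (hw : x.w ∈ L)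
    (hξ : x.ξ ^ 2 = 1) (hd : x.mp.mat 1 1 ≠ 0) (ε : ℤˣ) :
    thetaFactor L α β x ε ^ (8 * F.level L ^ 2) = 1 := by
  obtain ⟨hN0, hN⟩ := level_spec hF hL he
  obtain ⟨⟨c', hc'⟩, -⟩ := Gamma1_dvd hγ
  have hg := gaussSum_pow_eight hL he (det_eq x.mp.mat) hd fun t ht => by
    rw [hc', mul_comm, mul_smul]; exact L.smul_mem _ (level_smul_dual_mem hF hL he ht)
  have hNβ : ((F.level L : ℤ) : ℝ) • β ∈ L := by exact_mod_cast hβ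
  rw [Int.cast_smul_eq_zsmul] at hNβ
  set N := F.level L
  have h1 : (((ε : ℤ) : ℂ) ^ (-(Module.finrank ℝ V : ℤ))) ^ 8 = 1 := by
    rw [← zpow_natCast (_ ^ _), ← zpow_mul, mul_comm, zpow_mul]
    rcases Int.units_eq_one_or ε with rfl | rfl
    · simp
    · norm_num
  have h2 : (x.ξ : ℂ) ^ 8 = 1 := by
    have h3 : (x.ξ : ℂ) ^ 2 = 1 := by rw [← Circle.coe_pow, hξ, Circle.coe_one]
    rw [show 8 = 2 * 4 from rfl, pow_mul, h3, one_pow]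
  have h3 : ∀ k : ℤ, ((-Complex.I) ^ k) ^ 8 = 1 := by
    intro k
    rw [← zpow_natCast (_ ^ _), ← zpow_mul, mul_comm, zpow_mul]
    have : (-Complex.I) ^ ((8 : ℕ) : ℤ) = 1 := by
      rw [zpow_natCast, show 8 = 2 * 4 from rfl, pow_mul, neg_sq, Complex.I_sq]; norm_num
    rw [this, one_zpow]
  have h4 : e ((x.mp.mat 0 1 : ℂ) * (F.Q α : ℂ) - (x.mp.mat 1 0 : ℂ) * (F.Q β : ℂ) +
      (F.B x.v x.w : ℂ) / 2 - (F.B x.v β : ℂ)) ^ (8 * N ^ 2) = 1 := by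
    obtain ⟨m, hm⟩ := hN α hα
    obtain ⟨k, hk⟩ := he _ hNβ
    obtain ⟨p, hp⟩ := he.isIntegral _ hv _ hw
    obtain ⟨q, hq⟩ := he.isIntegral _ hv _ hNβ
    rw [← e_nat_mul, ← e_int (8 * N * x.mp.mat 0 1 * m - 8 * x.mp.mat 1 0 * k + 4 * N ^ 2 * p -
      8 * N * q)]
    congr 1
    have hm' : (N : ℂ) * (F.Q α : ℂ) = m := by exact_mod_cast hm
    rw [F.Q_zsmul] at hk
    have hk' : (N : ℂ) ^ 2 * (F.Q β : ℂ) = k := by exact_mod_cast hk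
    rw [F.B_zsmul_right] at hq
    have hq' : (N : ℂ) * (F.B x.v β : ℂ) = q := by exact_mod_cast hq
    push_cast
    rw [hp, ← hm', ← hk', ← hq']
    push_cast
    ring
  have h5 : ∀ {A X I g : ℂ}, A ^ 8 = 1 → X ^ 8 = 1 → I ^ 8 = 1 → g ^ 8 = 1 →
      (A * X * I * g) ^ 8 = 1 := by
    intro A X I g hA hX hI hg
    rw [mul_pow, mul_pow, mul_pow, hA, hX, hI, hg]; norm_num
  rw [thetaFactor, mul_pow, h4, mul_one, pow_mul, h5 h1 h2 (h3 _) hg, one_pow]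

end GaussSums

/-! ### Fourier expansions, their products and rescaling of the form. -/

section Expansions

set_option linter.unusedSectionVars false

open JacobiGroup

variable {V : Type*} [AddCommGroup V] [Module ℝ V] [FiniteDimensional ℝ V]
variable {F : SymForm V} {L : Submodule ℤ V}

/-- Terms of a series which are proportional to the same function may be collected. -/
theorem exists_hasSum_collect {I J X : Type*} [Nonempty X] (φ : I → J) (c : I → ℂ)
    {T : J → X → ℂ} (hT : ∀ j x, T j x ≠ 0) {f : X → ℂ}
    (hf : ∀ x, HasSum (fun i => c i * T (φ i) x) (f x)) :
    ∃ c' : J → ℂ, (∀ j, c' j ≠ 0 → ∃ i, φ i = j ∧ c i ≠ 0) ∧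
      ∀ x, HasSum (fun j => c' j * T j x) (f x) := by
  have hfib : ∀ x, HasSum (fun p : Σ j, {i // φ i = j} => c p.2 * T p.1 x) (f x) := by
    intro x
    refine ((Equiv.sigmaFiberEquiv φ).hasSum_iff.2 (hf x)).congr_fun ?_
    rintro ⟨j, i, rfl⟩
    rfl
  -- Because T does not vanish it can be divided out, so the collected coefficients converge and do
  -- not depend on x.
  have hs : ∀ j, Summable fun i : {i // φ i = j} => c i := by
    intro j
    have x : X := Classical.arbitrary X
    have h := (hfib x).summable.sigma_factor j
    exact (summable_mul_right_iff (hT j x)).1 h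
  refine ⟨fun j => ∑' i : {i // φ i = j}, c i, fun j hj => ?_, fun x =>
    (hfib x).sigma fun j => (hs j).hasSum.mul_right _⟩
  by_contra! h
  refine hj ?_
  have : ∀ i : {i // φ i = j}, c i = 0 := fun i => h i i.2
  simp [this]

/-- The exponential `e(n τ / M) e(B(t, z) / M)`. -/
def expTerm (F : SymForm V) (L : Submodule ℤ V) (M : ℕ) (p : ℤ × F.dual L)
    (x : ℍ × (ℂ ⊗[ℝ] V)) : ℂ :=
  e (((p.1 : ℂ) / M) * (x.1 : ℂ)) * e (F.BC (toC ((M : ℝ)⁻¹ • (p.2 : V))) x.2)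

theorem expTerm_ne_zero (M : ℕ) (p : ℤ × F.dual L) (x : ℍ × (ℂ ⊗[ℝ] V)) :
    expTerm F L M p x ≠ 0 := mul_ne_zero (e_ne_zero _) (e_ne_zero _)

theorem expTerm_add (M : ℕ) (p q : ℤ × F.dual L) (x : ℍ × (ℂ ⊗[ℝ] V)) :
    expTerm F L M (p + q) x = expTerm F L M p x * expTerm F L M q x := by
  simp only [expTerm, ← e_add, Prod.fst_add, Prod.snd_add, Submodule.coe_add, smul_add, toC_add,
    map_add, LinearMap.add_apply]
  congr 1
  push_cast
  ring

/-- `f` has a Fourier expansion with denominator `M`, supported on `Q(t) ≤ k n`. -/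
def HasExpansion (F : SymForm V) (L : Submodule ℤ V) (k M : ℕ) (f : ℍ → ℂ ⊗[ℝ] V → ℂ) : Prop :=
  ∃ c : ℤ × F.dual L → ℂ,
    (∀ p, c p ≠ 0 → F.Q ((M : ℝ)⁻¹ • (p.2 : V)) ≤ k * ((p.1 : ℝ) / M)) ∧
    ∀ x : ℍ × (ℂ ⊗[ℝ] V), HasSum (fun p => c p * expTerm F L M p x) (f x.1 x.2)

/-- Convexity of Q in the form Q(x+y)/(k+k') ≤ Q(x)/k + Q(y)/k'; the defect is a positive multiple
of Q(k'x - ky). -/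
theorem Q_add_le (hF : F.PosDef) {k k' : ℕ} (hk : 0 < k) (hk' : 0 < k') {x y : V} {r s : ℝ}
    (hx : F.Q x ≤ k * r) (hy : F.Q y ≤ k' * s) : F.Q (x + y) ≤ ((k + k' : ℕ) : ℝ) * (r + s) := by
  have h := hF.Q_nonneg ((k' : ℝ) • x - (k : ℝ) • y)
  rw [F.Q_sub, F.Q_smul, F.Q_smul, map_smul, map_smul, LinearMap.smul_apply, smul_eq_mul,
    smul_eq_mul] at h
  rw [F.Q_add]
  push_cast
  have hk0 : (0 : ℝ) < k := by exact_mod_cast hk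
  have hk0' : (0 : ℝ) < k' := by exact_mod_cast hk'
  have h1 : (k : ℝ) * k' * (F.Q x + F.B x y + F.Q y) ≤
      k * k' * ((k + k') * (r + s)) := by
    have h2 := mul_le_mul_of_nonneg_left hx (a := (k' : ℝ) * (k + k')) (by positivity)
    have h3 := mul_le_mul_of_nonneg_left hy (a := (k : ℝ) * (k + k')) (by positivity)
    linarith
  have h4 := le_of_mul_le_mul_left h1 (by positivity)
  linarith

theorem hasSum_mul_prod {I J : Type*} {f : I → ℂ} {g : J → ℂ} {a b : ℂ} (hf : HasSum f a)
    (hg : HasSum g b) : HasSum (fun p : I × J => f p.1 * g p.2) (a * b) :=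
  hf.mul hg (summable_mul_of_summable_norm hf.summable.norm hg.summable.norm)

/-- Complex series converge absolutely, so the product is a double series whose exponents add;
`Q_add_le` controls the support. -/
theorem HasExpansion.mul (hF : F.PosDef) {k k' M : ℕ} (hk : 0 < k) (hk' : 0 < k')
    {f g : ℍ → ℂ ⊗[ℝ] V → ℂ} (hf : HasExpansion F L k M f) (hg : HasExpansion F L k' M g) :
    HasExpansion F L (k + k') M fun τ z => f τ z * g τ z := by
  obtain ⟨c, hc, hcs⟩ := hf
  obtain ⟨c', hc', hcs'⟩ := hg
  obtain ⟨C, hC, hCs⟩ := exists_hasSum_collect (X := ℍ × (ℂ ⊗[ℝ] V))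
    (fun i : (ℤ × F.dual L) × (ℤ × F.dual L) => i.1 + i.2) (fun i => c i.1 * c' i.2)
    (expTerm_ne_zero (F := F) (L := L) M) (f := fun x => f x.1 x.2 * g x.1 x.2) (fun x => by
      refine (hasSum_mul_prod (hcs x) (hcs' x)).congr_fun fun i => ?_
      rw [expTerm_add]; ring)
  refine ⟨C, fun p hp => ?_, hCs⟩
  obtain ⟨⟨i, j⟩, rfl, hij⟩ := hC p hp
  have h := Q_add_le hF hk hk' (hc i (left_ne_zero_of_mul hij)) (hc' j (right_ne_zero_of_mul hij))
  rw [← smul_add, ← add_div] at h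
  simpa using h

theorem HasExpansion.pow (hF : F.PosDef) {M m : ℕ} (hm : 0 < m) {f : ℍ → ℂ ⊗[ℝ] V → ℂ}
    (hf : HasExpansion F L 1 M f) : HasExpansion F L m M fun τ z => f τ z ^ m := by
  induction m, Nat.succ_le_of_lt hm using Nat.le_induction with
  | base => simpa using hf
  | succ m hm' ih =>
    simp only [pow_succ]
    exact (ih hm').mul hF hm' one_pos hf

theorem HasExpansion.const_mul {k M : ℕ} {f : ℍ → ℂ ⊗[ℝ] V → ℂ} (hf : HasExpansion F L k M f)
    (a : ℂ) : HasExpansion F L k M fun τ z => a * f τ z := by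
  obtain ⟨c, hc, hcs⟩ := hf
  refine ⟨fun p => a * c p, fun p hp => hc p (right_ne_zero_of_mul hp), fun x => ?_⟩
  simpa only [mul_assoc] using (hcs x).mul_left a

theorem HasExpansion.hasHoloExpansion {M : ℕ} (hM : 0 < M) {f : ℍ → ℂ ⊗[ℝ] V → ℂ}
    (hf : HasExpansion F L 1 M f) : HasHoloExpansion F L f := by
  obtain ⟨c, hc, hcs⟩ := hf
  refine ⟨M, hM, c, fun p hp => ?_, fun τ z => ?_⟩
  · have := hc p hp
    rw [Nat.cast_one, one_mul] at this
    linarith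
  · simpa only [expTerm, mul_assoc] using hcs (τ, z)

theorem scale_B (m : ℕ) (v w : V) : (F.scale m).B v w = m * F.B v w := by simp [SymForm.scale]

theorem scale_Q (m : ℕ) (v : V) : (F.scale m).Q v = m * F.Q v := by
  rw [SymForm.Q, scale_B, SymForm.Q]; ring

theorem scale_BC (m : ℕ) (v w : ℂ ⊗[ℝ] V) : (F.scale m).BC v w = m * F.BC v w := by
  induction v using TensorProduct.induction_on with
  | zero => simp
  | add x y hx hy => simp only [map_add, LinearMap.add_apply, hx, hy]; ring
  | tmul a v =>
    induction w using TensorProduct.induction_on with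
    | zero => simp
    | add x y hx hy => simp only [map_add, hx, hy]; ring
    | tmul c w =>
      rw [SymForm.BC_tmul, SymForm.BC_tmul, scale_B]
      push_cast
      ring

theorem scale_QC (m : ℕ) (z : ℂ ⊗[ℝ] V) : (F.scale m).QC z = m * F.QC z := by
  rw [SymForm.QC, scale_BC, SymForm.QC]; ring

theorem inv_smul_mem_scale_dual {m : ℕ} (hm : 0 < m) {t : V} (ht : t ∈ F.dual L) :
    (m : ℝ)⁻¹ • t ∈ (F.scale m).dual L := by
  intro l hl
  obtain ⟨k, hk⟩ := ht l hl
  have : (m : ℝ) ≠ 0 := by positivity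
  refine ⟨k, ?_⟩
  rw [scale_B, map_smul, LinearMap.smul_apply, smul_eq_mul, mul_inv_cancel_left₀ this, hk]

/-- With respect to kB the exponential e(B(t,z)) has index t/k, and kQ(t/k) = Q(t)/k turns Q(t) ≤ kn
into the required support condition. -/
theorem HasExpansion.hasHoloExpansion_scale {k M : ℕ} (hk : 0 < k) (hM : 0 < M)
    {f : ℍ → ℂ ⊗[ℝ] V → ℂ} (hf : HasExpansion F L k M f) :
    HasHoloExpansion (F.scale k) L f := by
  obtain ⟨c, hc, hcs⟩ := hf
  have hk0 : (k : ℝ) ≠ 0 := by positivity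
  have hk0' : (k : ℂ) ≠ 0 := Nat.cast_ne_zero.2 hk.ne'
  obtain ⟨c', hc', hcs'⟩ := exists_hasSum_collect (X := ℍ × (ℂ ⊗[ℝ] V))
    (fun p : ℤ × F.dual L =>
      (p.1, (⟨(k : ℝ)⁻¹ • (p.2 : V), inv_smul_mem_scale_dual hk p.2.2⟩ : (F.scale k).dual L)))
    c (expTerm_ne_zero M) (f := fun x => f x.1 x.2) (fun x => by
      refine (hcs x).congr_fun fun p => ?_
      simp only [expTerm]
      rw [scale_BC, smul_comm, toC_smul, map_smul, LinearMap.smul_apply, smul_eq_mul]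
      push_cast
      rw [mul_inv_cancel_left₀ hk0'])
  have hfin : HasExpansion (F.scale k) L 1 M f := by
    refine ⟨c', fun p hp => ?_, hcs'⟩
    obtain ⟨q, rfl, hq⟩ := hc' p hp
    have h := hc q hq
    have hk1 : (0 : ℝ) < k := by exact_mod_cast hk
    dsimp only
    rw [smul_comm, scale_Q, F.Q_smul, Nat.cast_one, one_mul]
    have h2 : (k : ℝ) * ((k : ℝ)⁻¹ ^ 2 * F.Q ((M : ℝ)⁻¹ • (q.2 : V))) =
        (k : ℝ)⁻¹ * F.Q ((M : ℝ)⁻¹ • (q.2 : V)) := by field_simp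
    rw [h2, inv_mul_le_iff₀ hk1]
    exact h
  exact hfin.hasHoloExpansion hM

/-- A sum of Gaussian terms over points of `L / N` has an expansion. -/
theorem hasExpansion_of_gaussTerm (he : F.IsEven L) {N : ℕ} (hN : 0 < N) {I : Type*} (c : I → ℂ)
    (s : I → V) (hs : ∀ i, (N : ℤ) • s i ∈ L) {f : ℍ → ℂ ⊗[ℝ] V → ℂ}
    (hf : ∀ (τ : ℍ) z, HasSum (fun i => c i * gaussTerm F τ z (s i)) (f τ z)) :
    HasExpansion F L 1 (N ^ 2) f := by
  have hq : ∀ i, ∃ m : ℤ, F.Q ((N : ℤ) • s i) = m := fun i => he _ (hs i)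
  choose q hq using hq
  have hN0 : (N : ℝ) ≠ 0 := by positivity
  have hN1 : (N : ℂ) ≠ 0 := Nat.cast_ne_zero.2 hN.ne'
  -- The denominator N² serves both exponents: N²s ∈ L ⊆ L♯, and Q(s) = Q(Ns)/N² with Q(Ns) ∈ ℤ.
  have hmem : ∀ i, (N : ℤ) • (N : ℤ) • s i ∈ F.dual L := fun i =>
    le_dual he.isIntegral (L.smul_mem _ (hs i))
  have hinv : ∀ i, ((N ^ 2 : ℕ) : ℝ)⁻¹ • ((N : ℤ) • (N : ℤ) • s i) = s i := by
    intro i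
    rw [← Int.cast_smul_eq_zsmul ℝ, ← Int.cast_smul_eq_zsmul ℝ (N : ℤ) (s i), smul_smul, smul_smul]
    push_cast
    rw [show ((N : ℝ) ^ 2)⁻¹ * N * N = 1 by field_simp, one_smul]
  have hqs : ∀ i, F.Q (s i) = (q i : ℝ) / ((N ^ 2 : ℕ) : ℝ) := by
    intro i
    rw [← hq i, F.Q_zsmul]
    push_cast
    field_simp
  obtain ⟨c', hc', hcs'⟩ := exists_hasSum_collect (X := ℍ × (ℂ ⊗[ℝ] V))
    (fun i => ((q i, ⟨_, hmem i⟩) : ℤ × F.dual L)) c (expTerm_ne_zero (N ^ 2))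
    (f := fun x => f x.1 x.2) (fun x => by
      refine (hf x.1 x.2).congr_fun fun i => ?_
      simp only [expTerm]
      rw [hinv, gaussTerm, e_add, hqs, mul_comm (x.1 : ℂ)]
      push_cast
      rfl)
  refine ⟨c', fun p hp => ?_, hcs'⟩
  obtain ⟨i, rfl, -⟩ := hc' p hp
  dsimp only
  rw [hinv, hqs, Nat.cast_one, one_mul]

end Expansions

/-! ### Expansions of theta series at all cusps. -/

section Cusps

set_option linter.unusedSectionVars false

open JacobiGroup

variable {V : Type*} [AddCommGroup V] [Module ℝ V] [FiniteDimensional ℝ V]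
variable {F : SymForm V} {L : Submodule ℤ V}

/-- The analogue of d²τ' = bd + τ₁ at the cusp a/c: in `latTheta_split`, c takes the role of d and a
that of b. -/
theorem sq_mul_coe_smul (γ : SL(2, ℤ)) (τ : ℍ) :
    (γ 1 0 : ℂ) ^ 2 * ((γ • τ : ℍ) : ℂ) =
      (γ 0 0 : ℂ) * (γ 1 0 : ℂ) + -(γ 1 0 : ℂ) / autJ γ τ := by
  have hdet : (γ 0 0 : ℂ) * (γ 1 1 : ℂ) - (γ 0 1 : ℂ) * (γ 1 0 : ℂ) = 1 := by
    exact_mod_cast det_eq γ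
  have hJ := autJ_ne_zero γ τ
  rw [coe_smul_eq]
  field_simp
  rw [autJ]
  linear_combination (-(γ 1 0 : ℂ)) * hdet

theorem im_neg_div_autJ {γ : SL(2, ℤ)} (hc : γ 1 0 ≠ 0) (τ : ℍ) :
    0 < (-(γ 1 0 : ℂ) / autJ γ τ).im := by
  have h : -(γ 1 0 : ℂ) / autJ γ τ =
      ((γ 1 0 ^ 2 : ℤ) : ℝ) * ((γ • τ : ℍ) : ℂ) - ((γ 0 0 * γ 1 0 : ℤ) : ℝ) := by
    push_cast
    rw [sq_mul_coe_smul]; ring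
  rw [h, Complex.sub_im, Complex.im_ofReal_mul, Complex.ofReal_im, sub_zero]
  exact mul_pos (by exact_mod_cast (pow_pos (abs_pos.2 hc) 2).trans_le (sq_abs _).le)
    (UpperHalfPlane.im_pos _)

/-- The square of the product is the constant ic, so by continuity on the connected half-plane the
product itself is constant. No branch has to be determined. -/
theorem exists_root_mul_const (x : Metaplectic) (hc : x.mat 1 0 ≠ 0) :
    ∃ K : ℂ, ∀ τ, x.root τ * (-Complex.I * (-(x.mat 1 0 : ℂ) / autJ x.mat τ)) ^ (1 / 2 : ℂ) = K := by
  set g : ℍ → ℂ := fun τ =>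
    x.root τ * (-Complex.I * (-(x.mat 1 0 : ℂ) / autJ x.mat τ)) ^ (1 / 2 : ℂ) with hg
  have hJc : Continuous fun τ => autJ x.mat τ := by
    simp only [autJ]
    exact (continuous_const.mul UpperHalfPlane.continuous_coe).add continuous_const
  have hcont : Continuous g := by
    refine x.continuous_root.mul (Continuous.cpow ?_ continuous_const fun τ => ?_)
    · exact continuous_const.mul (continuous_const.div hJc (autJ_ne_zero _))
    · exact Or.inl (by simpa using im_neg_div_autJ hc τ)
  have hc' : (x.mat 1 0 : ℂ) ≠ 0 := Int.cast_ne_zero.2 hc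
  have hsq : ∀ τ, g τ ^ 2 = Complex.I * (x.mat 1 0 : ℂ) := by
    intro τ
    have := autJ_ne_zero x.mat τ
    rw [hg]
    simp only
    rw [mul_pow, cpow_half_sq, x.root_sq]
    field_simp
  have h := IsPreconnected.eq_or_eq_neg_of_sq_eq (f := g)
    (g := fun _ => (Complex.I * (x.mat 1 0 : ℂ)) ^ (1 / 2 : ℂ))
    (isPreconnected_univ (α := ℍ)) hcont.continuousOn continuousOn_const
    (fun τ _ => by simp only [Pi.pow_apply]; rw [hsq, cpow_half_sq])
    (fun {τ} _ => cpow_half_ne_zero (mul_ne_zero Complex.I_ne_zero hc'))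
  rcases h with h | h
  · exact ⟨_, fun τ => h (Set.mem_univ τ)⟩
  · exact ⟨_, fun τ => h (Set.mem_univ τ)⟩

theorem slash_theta_eq (κ : ℤ) (α β : V) (x : JacobiGroup F) (τ : ℍ) (z : ℂ ⊗[ℝ] V) :
    slash κ F (theta F L α β) x τ z = x.mp.root τ ^ (-κ) * facJ F x τ z *
      e (-(F.B β α : ℂ)) * latTheta F L ((x.mp.mat • τ : ℍ) : ℂ)
        ((autJ x.mp.mat τ)⁻¹ • shift x τ z + toC β) α := by
  rw [slash, theta_eq]; ring

/-- Since -1/τ₁ = τ + d/c for τ₁ = -c/(cτ+d), the terms in Q(s) cancel. What remains is a constant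
plus the exponent of a Gaussian term at u + v. -/
theorem cusp_exponent_identity {c d τ J Qs Bu Bw Qu Qv Bvz Bvw Buv p : ℂ} (hc : c ≠ 0)
    (hJ : J = c * τ + d) (hJ0 : J ≠ 0) :
    (-(c / J) * Qs + τ * Qv + Bvz + Bvw / 2) + (p +
      -((c / J) ^ 2 * Qs + Qu + c / J * (Bu + τ * Buv + Bw)) / (-c / J)) =
    (p + Bw + d / c * Qu + Bvw / 2) + (τ * (Qu + Qv + Buv) + (Bu + Bvz)) := by
  field_simp
  rw [hJ]
  ring

/-- The expansion of a theta series at a cusp different from infinity. -/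
theorem exists_hasSum_slash_theta_of_ne (hF : F.PosDef) (hL : IsLattice L) (he : F.IsEven L)
    {α β : V} (hα : α ∈ F.dual L) {x : JacobiGroup F} (hc : x.mp.mat 1 0 ≠ 0) :
    ∃ C : F.dual L → ℂ, ∀ (τ : ℍ) z,
      HasSum (fun t => C t * gaussTerm F τ z (x.mp.mat 1 0 • β - (t : V) + x.v))
        (slash (Module.finrank ℝ V) F (theta F L α β) x τ z) := by
  have := LatQuot.finite hL hc
  have := Fintype.ofFinite (LatQuot L (x.mp.mat 1 0))
  obtain ⟨K, hK⟩ := exists_root_mul_const x.mp hc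
  obtain ⟨D, hD⟩ := exists_latTheta_eq hF hL
  set a := x.mp.mat 0 0 with ha
  set c := x.mp.mat 1 0 with hcdef
  set d := x.mp.mat 1 1 with hd
  have hc' : (c : ℂ) ≠ 0 := Int.cast_ne_zero.2 hc
  have hcr : (c : ℝ) ≠ 0 := Int.cast_ne_zero.2 hc
  -- At a general cusp c satisfies no congruence, so α is written as c(α/c) instead of being moved
  -- within its class modulo L.
  set α₀ : V := (c : ℝ)⁻¹ • α with hα₀
  have hcα : c • α₀ = α := by
    rw [hα₀, ← Int.cast_smul_eq_zsmul ℝ, smul_inv_smul₀ hcr]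
  set n := Module.finrank ℝ V with hn
  set ph : LatQuot L c → ℂ := fun r => e (a * c * (F.Q α₀ : ℂ) +
    a * (F.B α₀ (Quotient.out r : L) : ℂ) + (a : ℂ) * (F.Q (Quotient.out r : L) : ℂ) / c) with hph
  set ρ : LatQuot L c → V := fun r => α₀ + (c : ℝ)⁻¹ • ((Quotient.out r : L) : V) with hρ
  refine ⟨fun t => K⁻¹ ^ n * D * (x.ξ : ℂ) * e (-(F.B β α : ℂ)) * ∑ r, ph r *
    e ((F.B t (ρ r) : ℂ) + (F.B (c • β - t) x.w : ℂ) + d / c * (F.Q (c • β - t) : ℂ) +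
      (F.B x.v x.w : ℂ) / 2), fun τ z => ?_⟩
  set J := autJ x.mp.mat τ with hJ
  have hJ0 : J ≠ 0 := autJ_ne_zero _ _
  set τ₁ : ℂ := -(c : ℂ) / J with hτ₁
  have hτ₁im : 0 < τ₁.im := im_neg_div_autJ hc τ
  set s := shift x τ z with hs
  rw [slash_theta_eq]
  have hsplit := latTheta_split hF hL he hc (b := a) (α := α₀) (fun l hl => by
      obtain ⟨m, hm⟩ := hα l hl
      refine ⟨a * m, ?_⟩
      rw [hα₀, map_smul, LinearMap.smul_apply, smul_eq_mul, hm]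
      push_cast
      field_simp)
    (UpperHalfPlane.im_pos (x.mp.mat • τ)) (sq_mul_coe_smul x.mp.mat τ) (J⁻¹ • s + toC β)
  rw [hcα] at hsplit
  rw [hsplit]
  have hroot : x.mp.root τ ^ (-(n : ℤ)) * ((-Complex.I * τ₁) ^ (1 / 2 : ℂ))⁻¹ ^ n = K⁻¹ ^ n := by
    rw [zpow_neg, zpow_natCast, ← inv_pow, ← mul_pow, ← mul_inv, hK τ]
  have hterm : ∀ (t : F.dual L) (r : LatQuot L c),
      facJ F x τ z * (e (F.B t (ρ r) : ℂ) *
        e (-F.QC ((c : ℂ) • (J⁻¹ • s + toC β) - toC (t : V)) / τ₁)) =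
      x.ξ * (e ((F.B t (ρ r) : ℂ) + (F.B (c • β - t) x.w : ℂ) + d / c * (F.Q (c • β - t) : ℂ) +
      (F.B x.v x.w : ℂ) / 2) * gaussTerm F τ z (c • β - (t : V) + x.v)) := by
    intro t r
    set u : V := c • β - t with hu
    have e1 : (c : ℂ) • (J⁻¹ • s + toC β) - toC (t : V) = ((c : ℂ) / J) • s + toC u := by
      rw [smul_add, smul_smul, ← div_eq_mul_inv, ← toC_zsmul, add_sub_assoc, ← toC_sub]
    rw [e1, facJ, gaussTerm, mul_assoc, ← e_add, ← e_add, ← e_add]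
    congr 2
    rw [F.QC_add, F.QC_smul, F.QC_toC, map_smul, LinearMap.smul_apply, smul_eq_mul, F.Q_add,
      toC_add, map_add F.BC, LinearMap.add_apply]
    have e2 : F.BC s (toC u) = F.BC (toC u) z + (τ : ℂ) * F.B u x.v + F.B u x.w := by
      rw [F.BC_symm, hs, shift, map_add, map_add, map_smul, F.BC_toC, F.BC_toC, smul_eq_mul]
    rw [e2, ← hs]
    push_cast
    exact cusp_exponent_identity hc' rfl hJ0
  have hr : ∀ r : LatQuot L c, HasSum (fun t : F.dual L =>
      (K⁻¹ ^ n * D * (x.ξ : ℂ) * e (-(F.B β α : ℂ)) * (ph r *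
        e ((F.B t (ρ r) : ℂ) + (F.B (c • β - t) x.w : ℂ) + d / c * (F.Q (c • β - t) : ℂ) +
          (F.B x.v x.w : ℂ) / 2))) * gaussTerm F τ z (c • β - (t : V) + x.v))
      (x.mp.root τ ^ (-(n : ℤ)) * facJ F x τ z * e (-(F.B β α : ℂ)) *
        (ph r * latTheta F L τ₁ ((c : ℂ) • (J⁻¹ • s + toC β)) (ρ r))) := by
    intro r
    have hsum : Summable fun t : F.dual L => e (F.B t (ρ r) : ℂ) *
        e (-F.QC ((c : ℂ) • (J⁻¹ • s + toC β) - toC (t : V)) / τ₁) := by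
      refine Summable.of_norm ?_
      refine (summable_dual_term hF hL hτ₁im ((c : ℂ) • (J⁻¹ • s + toC β))).congr fun t => ?_
      rw [norm_mul, norm_e_ofReal, one_mul]
    have h := hsum.hasSum.mul_left (K⁻¹ ^ n * D * e (-(F.B β α : ℂ)) * ph r * facJ F x τ z)
    rw [hD τ₁ hτ₁im]
    rw [show x.mp.root τ ^ (-(n : ℤ)) * facJ F x τ z * e (-(F.B β α : ℂ)) *
        (ph r * (D * ((-Complex.I * τ₁) ^ (1 / 2 : ℂ))⁻¹ ^ n * ∑' t : F.dual L,
          e (F.B t (ρ r) : ℂ) * e (-F.QC ((c : ℂ) • (J⁻¹ • s + toC β) - toC (t : V)) / τ₁))) =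
        K⁻¹ ^ n * D * e (-(F.B β α : ℂ)) * ph r * facJ F x τ z * ∑' t : F.dual L,
          e (F.B t (ρ r) : ℂ) * e (-F.QC ((c : ℂ) • (J⁻¹ • s + toC β) - toC (t : V)) / τ₁) by
      rw [← hroot]; ring]
    refine h.congr_fun fun t => ?_
    linear_combination (-(K⁻¹ ^ n * D * e (-(F.B β α : ℂ)) * ph r)) * hterm t r
  have h := hasSum_sum fun r (_ : r ∈ Finset.univ) => hr r
  rw [Finset.mul_sum]
  refine h.congr_fun fun t => ?_
  beta_reduce
  rw [Finset.mul_sum, Finset.sum_mul]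

/-- The expansion of a theta series at the cusp infinity. -/
theorem exists_hasSum_slash_theta_of_eq (hF : F.PosDef) (hL : IsLattice L) {α β : V}
    {x : JacobiGroup F} (hc : x.mp.mat 1 0 = 0) :
    ∃ C : L → ℂ, ∀ (τ : ℍ) z,
      HasSum (fun l : L => C l * gaussTerm F τ z (x.mp.mat 1 1 • (α + (l : V)) + x.v))
        (slash (Module.finrank ℝ V) F (theta F L α β) x τ z) := by
  obtain ⟨ε, hε⟩ := x.mp.root_spec
  have hdet := det_eq x.mp.mat
  rw [hc, mul_zero, sub_zero] at hdet
  have hJ : ∀ τ : ℍ, autJ x.mp.mat τ = (x.mp.mat 1 1 : ℂ) := by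
    intro τ; rw [autJ, hc]; simp
  set a := x.mp.mat 0 0
  set b := x.mp.mat 0 1
  set d := x.mp.mat 1 1
  -- For c = 0 the determinant forces a = d = ±1, and the slash operator multiplies each term by a
  -- constant and maps its index α + l to d(α + l) + v.
  have had : a = d := by
    rcases Int.eq_one_or_neg_one_of_mul_eq_one' hdet with h | h <;> rw [h.1, h.2]
  have hdd : (d : ℂ) * d = 1 := by rw [had] at hdet; exact_mod_cast hdet
  have hd0 : (d : ℂ) ≠ 0 := fun h => by simp [h] at hdd
  have hdinv : (d : ℂ)⁻¹ = d := inv_eq_of_mul_eq_one_left hdd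
  have hroot : ∀ τ, x.mp.root τ = ((ε : ℤ) : ℂ) * (d : ℂ) ^ (1 / 2 : ℂ) := by
    intro τ; rw [hε, sqrtJ, hJ]
  refine ⟨fun l => (((ε : ℤ) : ℂ) * (d : ℂ) ^ (1 / 2 : ℂ)) ^ (-(Module.finrank ℝ V : ℤ)) *
    x.ξ * e (-(F.B β α : ℂ)) * e (b * d * (F.Q (α + l) : ℂ) + d * (F.B (α + l) x.w : ℂ) +
      (F.B (α + l) β : ℂ) + (F.B x.v x.w : ℂ) / 2), fun τ z => ?_⟩
  rw [slash_theta_eq, hroot]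
  have hτ' : ((x.mp.mat • τ : ℍ) : ℂ) = τ + b * d := by
    rw [coe_smul_eq, hJ, div_eq_mul_inv, hdinv, ← had]
    change ((a : ℂ) * τ + b) * a = _
    rw [had]
    linear_combination (τ : ℂ) * hdd
  have h := (summable_gaussTerm hF hL (UpperHalfPlane.im_pos (x.mp.mat • τ))
    ((autJ x.mp.mat τ)⁻¹ • shift x τ z + toC β) α).hasSum.mul_left
    ((((ε : ℤ) : ℂ) * (d : ℂ) ^ (1 / 2 : ℂ)) ^ (-(Module.finrank ℝ V : ℤ)) * facJ F x τ z *
      e (-(F.B β α : ℂ)))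
  refine h.congr_fun fun l => ?_
  have key : facJ F x τ z * gaussTerm F ((x.mp.mat • τ : ℍ) : ℂ)
      ((autJ x.mp.mat τ)⁻¹ • shift x τ z + toC β) (α + l) =
      x.ξ * (e (b * d * (F.Q (α + l) : ℂ) + d * (F.B (α + l) x.w : ℂ) +
      (F.B (α + l) β : ℂ) + (F.B x.v x.w : ℂ) / 2) *
        gaussTerm F τ z (d • (α + (l : V)) + x.v)) := by
    rw [facJ, gaussTerm, gaussTerm, mul_assoc, ← e_add, ← e_add, hc, hτ', hJ]
    congr 2
    set q : V := α + (l : V)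
    rw [F.Q_add (d • q), F.Q_zsmul, F.B_zsmul_left, toC_add (d • q), toC_zsmul, map_add F.BC,
      LinearMap.add_apply, map_smul F.BC, LinearMap.smul_apply, map_add (F.BC _), map_smul (F.BC _),
      shift, map_add (F.BC _), map_add (F.BC _), map_smul (F.BC _), F.BC_toC, F.BC_toC, F.BC_toC]
    change _ + (_ + ((d : ℂ)⁻¹ * _ + _)) = _
    rw [hdinv]
    simp only [smul_eq_mul]
    push_cast
    linear_combination (-(τ : ℂ) * F.Q (α + l)) * hdd
  linear_combination (-((((ε : ℤ) : ℂ) * (d : ℂ) ^ (1 / 2 : ℂ)) ^ (-(Module.finrank ℝ V : ℤ)) *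
    e (-(F.B β α : ℂ)))) * key

/-- In both cases the indices of the Gaussian terms lie in (1/N)L, because N carries α, β and L♯
into L. -/
theorem hasExpansion_slash_theta (hF : F.PosDef) (hL : IsLattice L) (he : F.IsEven L) {α β : V}
    (hα : α ∈ F.dual L) (hβ : (F.level L : ℝ) • β ∈ L) {x : JacobiGroup F} (hv : x.v ∈ L) :
    HasExpansion F L 1 (F.level L ^ 2)
      (slash (Module.finrank ℝ V) F (theta F L α β) x) := by
  have hN := (level_spec hF hL he).1
  have hNβ : (F.level L : ℤ) • β ∈ L := by
    rw [← Int.cast_smul_eq_zsmul ℝ]; exact_mod_cast hβ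
  by_cases hc : x.mp.mat 1 0 = 0
  · obtain ⟨C, hC⟩ := exists_hasSum_slash_theta_of_eq hF hL (α := α) (β := β) hc
    refine hasExpansion_of_gaussTerm he hN C _ (fun l => ?_) hC
    rw [smul_add, smul_comm, smul_add]
    exact add_mem (L.smul_mem _ (add_mem (level_smul_dual_mem hF hL he hα) (L.smul_mem _ l.2)))
      (L.smul_mem _ hv)
  · obtain ⟨C, hC⟩ := exists_hasSum_slash_theta_of_ne hF hL he (β := β) hα hc
    refine hasExpansion_of_gaussTerm he hN C _ (fun t => ?_) hC
    rw [smul_add, smul_sub, smul_comm]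
    exact add_mem (sub_mem (L.smul_mem _ hNβ) (level_smul_dual_mem hF hL he t.2))
      (L.smul_mem _ hv)

end Cusps

/-! ### Holomorphy by termwise differentiation. -/

section Holomorphy

set_option linter.unusedSectionVars false

variable {V : Type*} [AddCommGroup V] [Module ℝ V] [FiniteDimensional ℝ V]
variable {F : SymForm V} {L : Submodule ℤ V}

/-- The differential of the exponent `τ Q(v) + B(v, z)` with respect to `τ` and the coordinates of
`z` in the basis `b`. -/
def exponentCLM {κ : Type*} [Fintype κ] (F : SymForm V) (b : Module.Basis κ ℝ V) (v : V) :
    (ℂ × (κ → ℂ)) →L[ℂ] ℂ :=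
  (F.Q v : ℂ) • ContinuousLinearMap.fst ℂ ℂ (κ → ℂ) + ∑ j, (F.B v (b j) : ℂ) •
    (ContinuousLinearMap.proj j).comp (ContinuousLinearMap.snd ℂ ℂ (κ → ℂ))

theorem gaussTerm_eq_exponentCLM {κ : Type*} [Fintype κ] (b : Module.Basis κ ℝ V)
    (p : ℂ × (κ → ℂ)) (w : ℂ ⊗[ℝ] V) (v : V) :
    gaussTerm F p.1 (∑ i, p.2 i ⊗ₜ[ℝ] b i + w) v = e (exponentCLM F b v p + F.BC (toC v) w) := by
  have h : ∀ i, F.BC (toC v) (p.2 i ⊗ₜ[ℝ] b i) = (F.B v (b i) : ℂ) * p.2 i := by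
    intro i
    rw [toC, SymForm.BC_tmul]; ring
  rw [gaussTerm, map_add, map_sum]
  simp only [h, exponentCLM, _root_.add_apply, _root_.sum_apply,
    _root_.smul_apply, ContinuousLinearMap.comp_apply, ContinuousLinearMap.proj_apply,
    ContinuousLinearMap.coe_fst', ContinuousLinearMap.coe_snd', smul_eq_mul]
  congr 1
  ring

theorem hasFDerivAt_gaussTerm {κ : Type*} [Fintype κ] (b : Module.Basis κ ℝ V)
    (p : ℂ × (κ → ℂ)) (w : ℂ ⊗[ℝ] V) (v : V) :
    HasFDerivAt (fun p : ℂ × (κ → ℂ) => gaussTerm F p.1 (∑ i, p.2 i ⊗ₜ[ℝ] b i + w) v)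
      ((gaussTerm F p.1 (∑ i, p.2 i ⊗ₜ[ℝ] b i + w) v * (2 * Real.pi * Complex.I)) •
        exponentCLM F b v) p := by
  simp only [gaussTerm_eq_exponentCLM]
  have h := (((exponentCLM F b v).hasFDerivAt (x := p)).add_const (F.BC (toC v) w)).const_mul
    (2 * Real.pi * Complex.I)
  have h2 := h.cexp
  rw [smul_smul] at h2
  exact h2

theorem norm_exponentCLM_le {κ κ' : Type*} [Fintype κ] [Fintype κ'] (F : SymForm V)
    (b : Module.Basis κ ℝ V) (b' : Module.Basis κ' ℝ V) :
    ∃ C ≥ 0, ∀ v, ‖exponentCLM F b v‖ ≤ C * Real.exp (∑ i, |b'.repr v i|) := by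
  obtain ⟨D, hD0, hD⟩ := SymForm.exists_Q_le F b'
  choose A hA0 hA using fun j => exists_bound_BC F b' (toC (b j))
  refine ⟨2 * D + ∑ j, A j, add_nonneg (by positivity) (Finset.sum_nonneg fun j _ => hA0 j),
    fun v => ?_⟩
  set S := ∑ i, |b'.repr v i| with hS
  have hS0 : 0 ≤ S := Finset.sum_nonneg fun _ _ => abs_nonneg _
  -- 1 + S + S²/2 ≤ e^S dominates both the quadratic coefficient of τ and the linear coefficients of
  -- z.
  have hexp := Real.quadratic_le_exp_of_nonneg hS0
  have h1 : |F.Q v| ≤ 2 * D * Real.exp S := by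
    refine (hD v).trans ?_
    rw [← hS]
    nlinarith [mul_nonneg hD0 hS0]
  have h2 : ∀ j, |F.B v (b j)| ≤ A j * Real.exp S := by
    intro j
    have h := norm_BC_le b' (hA j) v
    rw [F.BC_toC, Complex.norm_real, Real.norm_eq_abs] at h
    refine h.trans (mul_le_mul_of_nonneg_left ?_ (hA0 j))
    nlinarith [sq_nonneg S]
  refine (norm_add_le _ _).trans ?_
  rw [add_mul]
  refine add_le_add ?_ ?_
  · rw [norm_smul, Complex.norm_real, Real.norm_eq_abs]
    refine (mul_le_of_le_one_right (abs_nonneg _) ?_).trans h1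
    exact ContinuousLinearMap.norm_fst_le ℂ ℂ (κ → ℂ)
  · rw [Finset.sum_mul]
    refine (norm_sum_le _ _).trans (Finset.sum_le_sum fun j _ => ?_)
    rw [norm_smul, Complex.norm_real, Real.norm_eq_abs]
    refine (mul_le_of_le_one_right (abs_nonneg _) ?_).trans (h2 j)
    refine ContinuousLinearMap.opNorm_le_bound _ zero_le_one fun q => ?_
    rw [one_mul]
    exact (norm_le_pi_norm q.2 j).trans (norm_snd_le q)

/-- A summable bound for the terms of a theta series near a given point. -/
theorem exists_gaussTerm_bound_ball (hF : F.PosDef) {κ κ' : Type*} [Fintype κ] [Fintype κ']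
    (b : Module.Basis κ ℝ V) (b' : Module.Basis κ' ℝ V) (w : ℂ ⊗[ℝ] V) (ρ : V)
    {p₀ : ℂ × (κ → ℂ)} (hp₀ : 0 < p₀.1.im) :
    ∃ r > 0, ∃ u : (κ' → ℤ) → ℝ, Summable u ∧ ∀ p ∈ Metric.ball p₀ r, ∀ k,
      ‖gaussTerm F p.1 (∑ j, p.2 j ⊗ₜ[ℝ] b j + w) (ρ + latEquiv b' k)‖ *
        Real.exp (∑ i, |b'.repr (ρ + latEquiv b' k) i|) ≤ u k := by
  set r := p₀.1.im / 2 with hr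
  have hr0 : 0 < r := by positivity
  set R' := ‖p₀‖ + r with hR'
  have hR'0 : 0 ≤ R' := by positivity
  choose A hA0 hA using fun j => exists_bound_BC F b' (toC (b j))
  obtain ⟨A', hA'0, hA'⟩ := exists_bound_BC F b' w
  obtain ⟨R, hR⟩ := exists_bound_repr b' ρ
  obtain ⟨u, hu, hub⟩ := exists_gaussTerm_bound hF b' (y := r) (A := ∑ j, R' * A j + A') hr0
    (add_nonneg (Finset.sum_nonneg fun j _ => mul_nonneg hR'0 (hA0 j)) hA'0) R
  refine ⟨r, hr0, u, hu, fun p hp k => ?_⟩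
  rw [Metric.mem_ball, dist_eq_norm] at hp
  have him : r ≤ p.1.im := by
    have h1 : ‖p.1 - p₀.1‖ < r := (norm_fst_le (p - p₀)).trans_lt hp
    have h2 := (abs_le.1 ((Complex.abs_im_le_norm (p.1 - p₀.1)).trans h1.le)).1
    rw [Complex.sub_im] at h2
    linarith
  have hBC : ∀ i, ‖F.BC (toC (b' i)) (∑ j, p.2 j ⊗ₜ[ℝ] b j + w)‖ ≤ ∑ j, R' * A j + A' := by
    intro i
    have hn : ‖p‖ ≤ R' := by
      have := norm_sub_norm_le p p₀
      linarith
    rw [map_add, map_sum]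
    refine (norm_add_le _ _).trans (add_le_add ?_ (hA' i))
    refine (norm_sum_le _ _).trans (Finset.sum_le_sum fun j _ => ?_)
    have h3 : p.2 j ⊗ₜ[ℝ] b j = p.2 j • toC (b j) := by
      rw [toC, TensorProduct.smul_tmul', smul_eq_mul, mul_one]
    rw [h3, map_smul, norm_smul]
    exact mul_le_mul (((norm_le_pi_norm p.2 j).trans (norm_snd_le p)).trans hn) (hA j i)
      (norm_nonneg _) hR'0
  have hval : ρ + (latEquiv b' k : V) = vec b' ((fun i => b'.repr ρ i) + intVec k) := by
    rw [coe_latEquiv, vec_add, vec_repr]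
  have h := hub p.1 _ him hBC k _ hR
  rw [hval]
  simpa only [repr_vec] using h

theorem norm_deriv_gaussTerm_le {κ : Type*} [Fintype κ] (b : Module.Basis κ ℝ V) (g : ℂ) (v : V)
    {C E u : ℝ} (hC0 : 0 ≤ C) (hC : ‖exponentCLM F b v‖ ≤ C * E) (hu : ‖g‖ * E ≤ u) :
    ‖(g * (2 * Real.pi * Complex.I)) • exponentCLM F b v‖ ≤ 2 * Real.pi * C * u := by
  have h1 : ‖(2 * Real.pi * Complex.I : ℂ)‖ = 2 * Real.pi := by
    simp [abs_of_pos Real.pi_pos]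
  rw [norm_smul, norm_mul, h1]
  calc ‖g‖ * (2 * Real.pi) * ‖exponentCLM F b v‖ ≤ ‖g‖ * (2 * Real.pi) * (C * E) :=
        mul_le_mul_of_nonneg_left hC (by positivity)
    _ = 2 * Real.pi * C * (‖g‖ * E) := by ring
    _ ≤ _ := mul_le_mul_of_nonneg_left hu (by positivity)

/-- On a small ball the exponential weight in `exists_gaussTerm_bound_ball` absorbs the derivative
of the exponent, so the differentiated series converges uniformly. -/
theorem differentiableAt_latTheta (hF : F.PosDef) (hL : IsLattice L) {κ : Type*} [Fintype κ]
    (b : Module.Basis κ ℝ V) (w : ℂ ⊗[ℝ] V) (ρ : V) {p₀ : ℂ × (κ → ℂ)} (hp₀ : 0 < p₀.1.im) :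
    DifferentiableAt ℂ
      (fun p : ℂ × (κ → ℂ) => latTheta F L p.1 (∑ i, p.2 i ⊗ₜ[ℝ] b i + w) ρ) p₀ := by
  obtain ⟨b', rfl⟩ := hL
  obtain ⟨C, hC0, hC⟩ := norm_exponentCLM_le F b b'
  obtain ⟨r, hr0, u, hu, hbound⟩ := exists_gaussTerm_bound_ball hF b b' w ρ hp₀
  have hsum : Summable fun k : Fin (Module.finrank ℝ V) → ℤ =>
      gaussTerm F p₀.1 (∑ j, p₀.2 j ⊗ₜ[ℝ] b j + w) (ρ + latEquiv b' k) :=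
    (summable_gaussTerm hF ⟨b', rfl⟩ hp₀ (∑ j, p₀.2 j ⊗ₜ[ℝ] b j + w) ρ).comp_injective
      (latEquiv b').injective
  have hderiv := hasFDerivAt_tsum_of_isPreconnected
    (f := fun (k : Fin (Module.finrank ℝ V) → ℤ) (p : ℂ × (κ → ℂ)) =>
      gaussTerm F p.1 (∑ j, p.2 j ⊗ₜ[ℝ] b j + w) (ρ + latEquiv b' k))
    (f' := fun k p => (gaussTerm F p.1 (∑ j, p.2 j ⊗ₜ[ℝ] b j + w) (ρ + latEquiv b' k) *
      (2 * Real.pi * Complex.I)) • exponentCLM F b (ρ + latEquiv b' k))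
    (hu.mul_left (2 * Real.pi * C)) (Metric.isOpen_ball (x := p₀) (ε := r))
    (convex_ball p₀ r).isPreconnected
    (fun k p _ => hasFDerivAt_gaussTerm b p w _)
    (fun k p hp => norm_deriv_gaussTerm_le b _ _ hC0 (hC _) (hbound p hp k))
    (Metric.mem_ball_self hr0) hsum (Metric.mem_ball_self hr0)
  have hfun : (fun p : ℂ × (κ → ℂ) =>
      latTheta F (Submodule.span ℤ (Set.range b')) p.1 (∑ i, p.2 i ⊗ₜ[ℝ] b i + w) ρ) =
      fun p => ∑' k, gaussTerm F p.1 (∑ j, p.2 j ⊗ₜ[ℝ] b j + w) (ρ + latEquiv b' k) := by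
    funext p
    exact ((latEquiv b').tsum_eq fun l : Submodule.span ℤ (Set.range b') =>
      gaussTerm F p.1 (∑ j, p.2 j ⊗ₜ[ℝ] b j + w) (ρ + l)).symm
  rw [hfun]
  exact hderiv.differentiableAt

theorem isHolomorphic_theta (hF : F.PosDef) (hL : IsLattice L) (α β : V) :
    IsHolomorphic (theta F L α β) := by
  intro b
  refine DifferentiableOn.congr (f := fun p : ℂ × (Fin (Module.finrank ℝ V) → ℂ) =>
    e (-(F.B β α : ℂ)) * latTheta F L p.1 (∑ i, p.2 i ⊗ₜ[ℝ] b i + toC β) α) ?_ fun p hp => ?_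
  · intro p hp
    exact ((differentiableAt_latTheta hF hL b _ _ hp).const_mul _).differentiableWithinAt
  · rw [theta_eq, UpperHalfPlane.ofComplex_apply_of_im_pos hp]

theorem IsHolomorphic.pow {f : ℍ → ℂ ⊗[ℝ] V → ℂ} (hf : IsHolomorphic f) (m : ℕ) :
    IsHolomorphic fun τ z => f τ z ^ m := fun b => (hf b).pow m

end Holomorphy

/-! ### Theta series and their powers as Jacobi forms. -/

section ThetaForms

set_option linter.unusedSectionVars false

open JacobiGroup CongruenceSubgroup

variable {V : Type*} [AddCommGroup V] [Module ℝ V] [FiniteDimensional ℝ V]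
variable {F : SymForm V} {L : Submodule ℤ V}

theorem isThetaCharacter_unique {hL : F.IsIntegral L} {N : ℕ} {α β : V}
    {χ χ' : jacobiSubgroup F L hL (Gamma1 N) →* ℂˣ}
    (h : IsThetaCharacter F L hL (Gamma1 N) α β χ)
    (h' : IsThetaCharacter F L hL (Gamma1 N) α β χ') : χ' = χ := by
  refine character_ext fun x hd => ?_
  obtain ⟨ε, hε⟩ := (x : JacobiGroup F).mp.root_spec
  rw [h x x.2 _ _ _ _ ε rfl rfl rfl rfl hε hd, h' x x.2 _ _ _ _ ε rfl rfl rfl rfl hε hd]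

theorem exists_thetaCharacter (hF : F.PosDef) (hL : IsLattice L) (he : F.IsEven L) {α β : V}
    (hα : α ∈ F.dual L) (hβ : (F.level L : ℝ) • β ∈ L) :
    ∃ χ : jacobiSubgroup F L he.isIntegral (Gamma1 (F.level L)) →* ℂˣ,
      IsThetaCharacter F L he.isIntegral (Gamma1 (F.level L)) α β χ ∧
      theta F L α β ∈ JacobiForms (Module.finrank ℝ V) F L he.isIntegral
        (Gamma1 (F.level L)) χ := by
  have hN := (level_spec hF hL he).1
  have : NeZero (F.level L) := ⟨hN.ne'⟩
  obtain ⟨τ₀, z₀, h0⟩ := theta_ne_zero hF hL α β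
  obtain ⟨χ, hχ⟩ := exists_character (hL := he.isIntegral) (N := F.level L)
    (κ := Module.finrank ℝ V) ⟨τ₀, z₀, h0⟩ (fun x hd => by
      obtain ⟨ε, hε⟩ := (x : JacobiGroup F).mp.root_spec
      exact ⟨_, theta_slash hF hL he hα hβ x.2.1 x.2.2.1 x.2.2.2.1 hd hε⟩)
  have hval : ∀ (x : jacobiSubgroup F L he.isIntegral (Gamma1 (F.level L))) (ε : ℤˣ),
      (∀ τ, (x : JacobiGroup F).mp.root τ =
        ((ε : ℤ) : ℂ) * sqrtJ (x : JacobiGroup F).mp.mat τ) →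
      (x : JacobiGroup F).mp.mat 1 1 ≠ 0 → (χ x : ℂ) = thetaFactor L α β (x : JacobiGroup F) ε := by
    intro x ε hε hd
    have h := hχ x τ₀ z₀
    rw [theta_slash hF hL he hα hβ x.2.1 x.2.2.1 x.2.2.2.1 hd hε] at h
    exact (mul_right_cancel₀ h0 h).symm
  refine ⟨χ, ?_, hF, inferInstance, ?_, isHolomorphic_theta hF hL α β, hχ, fun x hx => ?_⟩
  · rintro x hx _ _ _ _ ε rfl rfl rfl rfl hε hd
    exact hval ⟨x, hx⟩ ε hε hd
  · refine finiteIndex_ker χ (K := 8 * F.level L ^ 2) (by positivity) fun x hd => ?_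
    obtain ⟨ε, hε⟩ := (x : JacobiGroup F).mp.root_spec
    rw [hval x ε hε hd]
    exact thetaFactor_pow hF hL he hα hβ x.2.1 x.2.2.1 x.2.2.2.1 x.2.2.2.2 hd ε
  · exact (hasExpansion_slash_theta hF hL he hα hβ hx.2.1).hasHoloExpansion (by positivity)

theorem PosDef.scale (hF : F.PosDef) {m : ℕ} (hm : 0 < m) : (F.scale m).PosDef := by
  intro v hv
  rw [scale_B]
  exact mul_pos (by exact_mod_cast hm) (hF v hv)

/-- The element of the Jacobi group of `F` with the data of `x` and trivial central component. -/
def unscale {m : ℕ} (x : JacobiGroup (F.scale m)) : JacobiGroup F where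
  mp := x.mp
  v := x.v
  w := x.w
  ξ := 1

/-- The automorphic factor of mB is the m-th power of that of B except for ξ, which occurs only
once; therefore `unscale` sets it to 1. -/
theorem slash_scale_pow (m : ℕ) (κ : ℤ) (f : ℍ → ℂ ⊗[ℝ] V → ℂ) (x : JacobiGroup (F.scale m))
    (τ : ℍ) (z : ℂ ⊗[ℝ] V) :
    slash (m * κ) (F.scale m) (fun τ z => f τ z ^ m) x τ z =
      (x.ξ : ℂ) * slash κ F f (unscale x) τ z ^ m := by
  have hs : shift (unscale x) τ z = shift x τ z := rfl
  have hξ : ((unscale x).ξ : ℂ) = 1 := Circle.coe_one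
  simp only [slash, facJ, hs, hξ, one_mul, mul_pow, ← e_nat_mul, scale_QC, scale_Q, scale_BC,
    scale_B]
  change _ = (x.ξ : ℂ) * ((x.mp.root τ ^ (-κ)) ^ m * e ((m : ℂ) *
    (-((x.mp.mat 1 0 : ℂ) / autJ x.mp.mat τ) * F.QC (shift x τ z) + (τ : ℂ) * (F.Q x.v : ℂ) +
      F.BC (toC x.v) z + (F.B x.v x.w : ℂ) / 2)) * _)
  rw [← zpow_natCast (x.mp.root τ ^ (-κ)), ← zpow_mul, show -κ * (m : ℤ) = -(m * κ) by ring]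
  have harg : -((x.mp.mat 1 0 : ℂ) / autJ x.mp.mat τ) * (m * F.QC (shift x τ z)) +
      (τ : ℂ) * ((m * F.Q x.v : ℝ) : ℂ) + m * F.BC (toC x.v) z + ((m * F.B x.v x.w : ℝ) : ℂ) / 2 =
      m * (-((x.mp.mat 1 0 : ℂ) / autJ x.mp.mat τ) * F.QC (shift x τ z) +
        (τ : ℂ) * (F.Q x.v : ℂ) + F.BC (toC x.v) z + (F.B x.v x.w : ℂ) / 2) := by
    push_cast; ring
  rw [harg]
  change _ = (x.ξ : ℂ) * (_ * _ * f (x.mp.mat • τ) ((autJ x.mp.mat τ)⁻¹ • shift x τ z) ^ m)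
  ring

/-- The value at `x` of the character of the `m`-th powers of theta series. -/
def thetaPowFactor (L : Submodule ℤ V) {m : ℕ} (x : JacobiGroup (F.scale m)) (ε : ℤˣ) : ℂ :=
  ((ε : ℤ) : ℂ) ^ (-((m : ℤ) * (Module.finrank ℝ V : ℤ))) * (x.ξ : ℂ) *
    (-Complex.I) ^ ((m : ℤ) * (Module.finrank ℝ V : ℤ) * ((1 - (x.mp.mat 1 1).sign) / 2) *
      signSymbol (x.mp.mat 1 0)) *
    gaussSum F L (x.mp.mat 0 1) (x.mp.mat 1 1) 0 ^ m * e ((m : ℂ) * (F.B x.v x.w : ℂ) / 2)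

/-- The integrality conditions make the m-th power of the phase lose α and β, so that all the powers
share one character. -/
theorem mul_thetaFactor_pow {m : ℕ} {α β : V} {x : JacobiGroup (F.scale m)}
    (hα : ∃ k : ℤ, (m : ℝ) * F.Q α = k) (hcβ : ∃ k : ℤ, m * x.mp.mat 1 0 * F.Q β = k)
    (hvβ : ∃ k : ℤ, m * F.B x.v β = k) (ε : ℤˣ) :
    (x.ξ : ℂ) * thetaFactor L α β (unscale x) ε ^ m = thetaPowFactor L x ε := by
  obtain ⟨p, hp⟩ := hα
  obtain ⟨q, hq⟩ := hcβ
  obtain ⟨r, hr⟩ := hvβ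
  have hξ : ((unscale x).ξ : ℂ) = 1 := Circle.coe_one
  have he : e ((x.mp.mat 0 1 : ℂ) * (F.Q α : ℂ) - (x.mp.mat 1 0 : ℂ) * (F.Q β : ℂ) +
      (F.B x.v x.w : ℂ) / 2 - (F.B x.v β : ℂ)) ^ m = e ((m : ℂ) * (F.B x.v x.w : ℂ) / 2) := by
    rw [← e_nat_mul]
    refine e_eq_of_sub (x.mp.mat 0 1 * p - q - r) ?_
    have hp' : (m : ℂ) * (F.Q α : ℂ) = p := by exact_mod_cast hp
    have hq' : (m : ℂ) * (x.mp.mat 1 0 : ℂ) * (F.Q β : ℂ) = q := by exact_mod_cast hq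
    have hr' : (m : ℂ) * (F.B x.v β : ℂ) = r := by exact_mod_cast hr
    push_cast
    linear_combination (x.mp.mat 0 1 : ℂ) * hp' - hq' - hr'
  rw [thetaFactor, hξ, thetaPowFactor, ← he]
  change (x.ξ : ℂ) * (((ε : ℤ) : ℂ) ^ (-(Module.finrank ℝ V : ℤ)) * 1 *
    (-Complex.I) ^ ((Module.finrank ℝ V : ℤ) * ((1 - (x.mp.mat 1 1).sign) / 2) *
      signSymbol (x.mp.mat 1 0)) *
    gaussSum F L (x.mp.mat 0 1) (x.mp.mat 1 1) 0 *
    e ((x.mp.mat 0 1 : ℂ) * (F.Q α : ℂ) - (x.mp.mat 1 0 : ℂ) * (F.Q β : ℂ) +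
      (F.B x.v x.w : ℂ) / 2 - (F.B x.v β : ℂ))) ^ m = _
  simp only [mul_pow, ← zpow_natCast (_ ^ (_ : ℤ)), ← zpow_mul, one_pow]
  rw [show -(Module.finrank ℝ V : ℤ) * (m : ℤ) = -((m : ℤ) * (Module.finrank ℝ V : ℤ)) by ring,
    show (Module.finrank ℝ V : ℤ) * ((1 - (x.mp.mat 1 1).sign) / 2) * signSymbol (x.mp.mat 1 0) *
      (m : ℤ) = (m : ℤ) * (Module.finrank ℝ V : ℤ) * ((1 - (x.mp.mat 1 1).sign) / 2) *
      signSymbol (x.mp.mat 1 0) by ring]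
  ring

theorem isThetaPowCharacter_unique {m : ℕ} {hL : (F.scale m).IsIntegral L} {N : ℕ}
    {χ χ' : jacobiSubgroup (F.scale m) L hL (Gamma1 N) →* ℂˣ}
    (h : IsThetaPowCharacter F L m hL (Gamma1 N) χ)
    (h' : IsThetaPowCharacter F L m hL (Gamma1 N) χ') : χ' = χ := by
  refine character_ext fun x hd => ?_
  obtain ⟨ε, hε⟩ := (x : JacobiGroup (F.scale m)).mp.root_spec
  rw [h x x.2 _ _ _ _ ε rfl rfl rfl rfl hε hd, h' x x.2 _ _ _ _ ε rfl rfl rfl rfl hε hd]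

/-- From m | N and β ∈ L♯ + (1/m)L follow Nβ ∈ L, so the results on single theta series apply, and
the integrality of mcQ(β) and mB(v, β). -/
theorem exists_thetaPowCharacter (hF : F.PosDef) (hL : IsLattice L) (he : F.IsEven L) {m : ℕ}
    (hm : 0 < m) (hmN : m ∣ F.level L) {α β : V} (hα : α ∈ F.dual L)
    (hQα : ∃ k : ℤ, (m : ℝ) * F.Q α = k)
    (hβ : ∃ s ∈ F.dual L, ∃ l ∈ L, β = s + (m : ℝ)⁻¹ • l) :
    ∃ χ : jacobiSubgroup (F.scale m) L (he.scale m).isIntegral (Gamma1 (F.level L)) →* ℂˣ,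
      IsThetaPowCharacter F L m (he.scale m).isIntegral (Gamma1 (F.level L)) χ ∧
      (fun τ z => theta F L α β τ z ^ m) ∈ JacobiForms (m * Module.finrank ℝ V) (F.scale m) L
        (he.scale m).isIntegral (Gamma1 (F.level L)) χ := by
  obtain ⟨hN, hNQ⟩ := level_spec hF hL he
  have : NeZero (F.level L) := ⟨hN.ne'⟩
  obtain ⟨s, hs, l, hl, rfl⟩ := hβ
  obtain ⟨N', hN'⟩ := hmN
  have hm0 : (m : ℝ) ≠ 0 := by positivity
  have hNβ : (F.level L : ℝ) • (s + (m : ℝ)⁻¹ • l) ∈ L := by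
    have h1 : (F.level L : ℝ) • (s + (m : ℝ)⁻¹ • l) = (F.level L : ℤ) • s + (N' : ℤ) • l := by
      rw [smul_add, smul_smul, ← Int.cast_smul_eq_zsmul ℝ, ← Int.cast_smul_eq_zsmul ℝ (N' : ℤ)]
      congr 2
      rw [hN']
      push_cast
      field_simp
    rw [h1]
    exact add_mem (level_smul_dual_mem hF hL he hs) (L.smul_mem _ hl)
  have hcβ : ∀ γ ∈ Gamma1 (F.level L), ∃ k : ℤ,
      m * (γ 1 0 : ℝ) * F.Q (s + (m : ℝ)⁻¹ • l) = k := by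
    intro γ hγ
    obtain ⟨c, hc⟩ := (Gamma1_dvd hγ).1
    obtain ⟨p, hp⟩ := hNQ s hs
    obtain ⟨q, hq⟩ := he l hl
    obtain ⟨r, hr⟩ := hs l hl
    refine ⟨m * c * p + N' * c * q + F.level L * c * r, ?_⟩
    rw [F.Q_add, F.Q_smul, map_smul, smul_eq_mul, hc]
    push_cast
    rw [← hp, ← hq, ← hr, hN']
    push_cast
    field_simp
  have hvβ : ∀ v ∈ L, ∃ k : ℤ, m * F.B v (s + (m : ℝ)⁻¹ • l) = k := by
    intro v hv
    obtain ⟨p, hp⟩ := hs v hv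
    obtain ⟨q, hq⟩ := he.isIntegral v hv l hl
    refine ⟨m * p + q, ?_⟩
    rw [map_add, map_smul, smul_eq_mul, F.symm v s, hp, hq]
    push_cast
    field_simp
  set β := s + (m : ℝ)⁻¹ • l
  obtain ⟨τ₀, z₀, h0⟩ := theta_ne_zero hF hL α β
  have h0m : theta F L α β τ₀ z₀ ^ m ≠ 0 := pow_ne_zero _ h0
  have hfac : ∀ (x : jacobiSubgroup (F.scale m) L (he.scale m).isIntegral (Gamma1 (F.level L)))
      (ε : ℤˣ), ((x : JacobiGroup (F.scale m)).ξ : ℂ) *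
        thetaFactor L α β (unscale (x : JacobiGroup (F.scale m))) ε ^ m =
        thetaPowFactor L (x : JacobiGroup (F.scale m)) ε := fun x ε =>
    mul_thetaFactor_pow hQα (hcβ _ x.2.1) (hvβ _ x.2.2.1) ε
  have hslash : ∀ (x : jacobiSubgroup (F.scale m) L (he.scale m).isIntegral
      (Gamma1 (F.level L))) (ε : ℤˣ),
      (∀ τ, (x : JacobiGroup (F.scale m)).mp.root τ =
        ((ε : ℤ) : ℂ) * sqrtJ (x : JacobiGroup (F.scale m)).mp.mat τ) →
      (x : JacobiGroup (F.scale m)).mp.mat 1 1 ≠ 0 → ∀ τ z,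
      slash (m * Module.finrank ℝ V) (F.scale m) (fun τ z => theta F L α β τ z ^ m)
        (x : JacobiGroup (F.scale m)) τ z =
        thetaPowFactor L (x : JacobiGroup (F.scale m)) ε * theta F L α β τ z ^ m := by
    intro x ε hε hd τ z
    rw [slash_scale_pow, theta_slash hF hL he hα hNβ 
      (x := unscale (x : JacobiGroup (F.scale m))) x.2.1 x.2.2.1 x.2.2.2.1 hd hε,
      mul_pow, ← mul_assoc, hfac]
  obtain ⟨χ, hχ⟩ := exists_character (hL := (he.scale m).isIntegral) (N := F.level L)
    (κ := m * Module.finrank ℝ V) (f := fun τ z => theta F L α β τ z ^ m) ⟨τ₀, z₀, h0m⟩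
    (fun x hd => by
      obtain ⟨ε, hε⟩ := (x : JacobiGroup (F.scale m)).mp.root_spec
      exact ⟨_, hslash x ε hε hd⟩)
  have hval : ∀ (x : jacobiSubgroup (F.scale m) L (he.scale m).isIntegral
      (Gamma1 (F.level L))) (ε : ℤˣ),
      (∀ τ, (x : JacobiGroup (F.scale m)).mp.root τ =
        ((ε : ℤ) : ℂ) * sqrtJ (x : JacobiGroup (F.scale m)).mp.mat τ) →
      (x : JacobiGroup (F.scale m)).mp.mat 1 1 ≠ 0 → (χ x : ℂ) = thetaPowFactor L (x : JacobiGroup (F.scale m)) ε := by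
    intro x ε hε hd
    have h := hχ x τ₀ z₀
    rw [hslash x ε hε hd] at h
    exact (mul_right_cancel₀ h0m h).symm
  refine ⟨χ, ?_, PosDef.scale hF hm, inferInstance, ?_, (isHolomorphic_theta hF hL α β).pow m, hχ,
    fun x hx => ?_⟩
  · rintro x hx _ _ _ _ ε rfl rfl rfl rfl hε hd
    exact hval ⟨x, hx⟩ ε hε hd
  -- The additional factor 2 kills ξ, which `unscale` has removed from the theta factor.
  · refine finiteIndex_ker χ (K := 2 * (8 * F.level L ^ 2)) (by positivity) fun x hd => ?_
    obtain ⟨ε, hε⟩ := (x : JacobiGroup (F.scale m)).mp.root_spec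
    have hξ : ((x : JacobiGroup (F.scale m)).ξ : ℂ) ^ 2 = 1 := by
      rw [← Circle.coe_pow, x.2.2.2.2, Circle.coe_one]
    have h := thetaFactor_pow hF hL he hα hNβ (x := unscale (x : JacobiGroup (F.scale m))) x.2.1
      x.2.2.1 x.2.2.2.1 (one_pow 2) hd ε
    rw [hval x ε hε hd, ← hfac, mul_pow, pow_mul, hξ, one_pow, one_mul, ← pow_mul,
      show m * (2 * (8 * F.level L ^ 2)) = 8 * F.level L ^ 2 * (2 * m) by ring, pow_mul, h, one_pow]
  · have h := (((hasExpansion_slash_theta hF hL he hα hNβ (x := unscale x) hx.2.1).pow hF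
      hm).const_mul (x.ξ : ℂ)).hasHoloExpansion_scale hm (by positivity)
    have hfun : slash (m * Module.finrank ℝ V) (F.scale m) (fun τ z => theta F L α β τ z ^ m) x =
        fun τ z => (x.ξ : ℂ) * slash (Module.finrank ℝ V) F (theta F L α β) (unscale x) τ z ^ m :=
      funext fun τ => funext fun z => slash_scale_pow m _ _ x τ z
    rw [hfun]
    exact h

end ThetaForms
end LatticeJacobi
end
-- The main theorem.
open LatticeJacobi in
theorem mainTheorem9 {V : Type*} [AddCommGroup V] [Module ℝ V] [FiniteDimensional ℝ V]
    (F : SymForm V) (hpos : F.PosDef) (L : Submodule ℤ V) (hlat : IsLattice L)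
    (heven : F.IsEven L) :
    (∀ α ∈ F.dual L, ∀ β : V, (F.level L : ℝ) • β ∈ L →
      (∀ τ z, Summable fun l : L => thetaTerm F α β τ z l) ∧
      ∃ χ : jacobiSubgroup F L heven.isIntegral (CongruenceSubgroup.Gamma1 (F.level L)) →* ℂˣ,
        IsThetaCharacter F L heven.isIntegral (CongruenceSubgroup.Gamma1 (F.level L)) α β χ ∧
        (∀ χ', IsThetaCharacter F L heven.isIntegral
          (CongruenceSubgroup.Gamma1 (F.level L)) α β χ' → χ' = χ) ∧
        theta F L α β ∈ JacobiForms (Module.finrank ℝ V) F L heven.isIntegral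
          (CongruenceSubgroup.Gamma1 (F.level L)) χ) ∧
    (∀ m : ℕ, 0 < m → m ∣ F.level L →
      ∃ χ : jacobiSubgroup (F.scale m) L (heven.scale m).isIntegral
          (CongruenceSubgroup.Gamma1 (F.level L)) →* ℂˣ,
        IsThetaPowCharacter F L m (heven.scale m).isIntegral
          (CongruenceSubgroup.Gamma1 (F.level L)) χ ∧
        (∀ χ', IsThetaPowCharacter F L m (heven.scale m).isIntegral
          (CongruenceSubgroup.Gamma1 (F.level L)) χ' → χ' = χ) ∧
        ∀ α ∈ F.dual L, (∃ k : ℤ, (m : ℝ) * F.Q α = k) →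
          ∀ β : V, (∃ s ∈ F.dual L, ∃ l ∈ L, β = s + (m : ℝ)⁻¹ • l) →
            (fun τ z => theta F L α β τ z ^ m) ∈
              JacobiForms (m * Module.finrank ℝ V) (F.scale m) L (heven.scale m).isIntegral
                (CongruenceSubgroup.Gamma1 (F.level L)) χ) := by
  refine ⟨fun α hα β hβ => ⟨fun τ z => summable_thetaTerm hpos hlat α β τ z, ?_⟩,
    fun m hm hmN => ?_⟩
  · obtain ⟨χ, hχ, hmem⟩ := exists_thetaCharacter hpos hlat heven hα hβ
    exact ⟨χ, hχ, fun χ' hχ' => isThetaCharacter_unique hχ hχ', hmem⟩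
  -- The common character is obtained from α = β = 0; uniqueness identifies it with the one
  -- belonging to any other admissible pair.
  · obtain ⟨χ, hχ, -⟩ := exists_thetaPowCharacter hpos hlat heven hm hmN (F.dual L).zero_mem
      ⟨0, by simp [F.Q_zero]⟩ ⟨0, (F.dual L).zero_mem, 0, L.zero_mem, rfl⟩
    refine ⟨χ, hχ, fun χ' hχ' => isThetaPowCharacter_unique hχ hχ', fun α hα hQα β hβ => ?_⟩
    obtain ⟨χ', hχ', hmem⟩ := exists_thetaPowCharacter hpos hlat heven hm hmN hα hQα hβ
    rwa [isThetaPowCharacter_unique hχ hχ'] at hmem
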